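/- **Conventions.** An étale groupoid $\mathcal G$ is a second countable locally compact Hausdorff topological groupoid whose range map is a local homeomorphism; $\mathcal G^{(0)}$ is its unit space and $r,s$ are its range and source maps. A $\mathcal G$-set is a subset of $\mathcal G$ on which $r$ and $s$ are injective. A Cantor set is a nonempty compact metrizable totally disconnected space without isolated points. $\mathcal G$ is *minimal* if every orbit is dense in $\mathcal G^{(0)}$, and *essentially principal* if the interior of $\{g: r(g)=s(g)\}$ is $\mathcal G^{(0)}$. An essentially principal étale groupoid whose unit space is a Cantor set is *purely infinite* if for every clopen $A\subset\mathcal G^{(0)}$ there are compact open $\mathcal G$-sets $U,V$ with $s(U)=s(V)=A$, $r(U)\cup r(V)\subset A$ and $r(U)\cap r(V)=\emptyset$. $H_0(\mathcal G)$ is the quotient of $C_c(\mathcal G^{(0)},\mathbb Z)$ by the image of $s_*-r_*:C_c(\mathcal G,\mathbb Z)\to C_c(\mathcal G^{(0)},\mathbb Z)$, where $\pi_*(f)(y)=\sum_{\pi(g)=y}f(g)$. $C^*_r(\mathcal G)$ is the reduced groupoid $C^*$-algebra. If $\mathcal G^{(0)}$ is compact, the topological full group $[[\mathcal G]]$ is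 the group of all homeomorphisms of $\mathcal G^{(0)}$ of the form $\theta(U)=(r|U)\circ(s|U)^{-1}$, where $U$ is a compact open $\mathcal G$-set with $r(U)=s(U)=\mathcal G^{(0)}$. Let $A$ be the adjacency matrix of a finite directed graph with edge set $\mathcal E$, where an edge $e$ goes from $i(e)$ to $t(e)$. Assume that $A$ is irreducible (for all $\xi,\eta$ there is $m\ge1$ with $A^m(\xi,\eta)>0$) and is not a permutation matrix. Let $X_A=\{(x_k)_k\in\mathcal E^{\mathbb N}: t(x_k)=i(x_{k+1})\ \forall k\}$ with shift $\sigma$. The SFT groupoid is $\mathcal G_A=\{(x,k-l,y): x,y\in X_A,\ k,l\ge 0,\ \sigma^k(x)=\sigma^l(y)\}$, with $(x,m,y)(y,m',z)=(x,m+m',z)$, $(x,m,y)^{-1}=(y,-m,x)$, and the topology generated by the sets $\{(x,k-l,y): x\in P,\ y\in Q,\ \sigma^k(x)=\sigma^l(y)\}$ for $P,Q\subset X_A$ open and $k,l\ge0$. **Theorem.** Let $n\ge1$ and let $\mathcal G=\mathcal G_{A_1}\times\dots\times\mathcal G_{A_n}$ be a product of SFT groupoids. (I) Let $\mathcal H_1,\dots,\mathcal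 H_n$ be minimal, purely infinite étale groupoids (in particular essentially principal with Cantor unit spaces) and let $\mathcal H=\mathcal H_1\times\dots\times\mathcal H_n$. For each $i$ let $\varphi_i:H_0(\mathcal G_{A_i})\to H_0(\mathcal H_i)$ be a homomorphism with $\varphi_i([1_{\mathcal G_{A_i}^{(0)}}])=[1_{\mathcal H_i^{(0)}}]$. Then $[f_1]\otimes\dots\otimes[f_n]\mapsto[f_1\times\dots\times f_n]$, where $(f_1\times\dots\times f_n)(x_1,\dots,x_n)=f_1(x_1)\cdots f_n(x_n)$, defines isomorphisms $\bigotimes_iH_0(\mathcal G_{A_i})\cong H_0(\mathcal G)$ and $\bigotimes_iH_0(\mathcal H_i)\cong H_0(\mathcal H)$; let $\varphi:H_0(\mathcal G)\to H_0(\mathcal H)$ be the homomorphism that corresponds to $\varphi_1\otimes\dots\otimes\varphi_n$ under them. There is a unital $*$-homomorphism $\pi:C^*_r(\mathcal G)\to C^*_r(\mathcal H)$ such that 1. $\pi(C(\mathcal G^{(0)}))\subset C(\mathcal H^{(0)})$; 2. for every compact open $\mathcal G$-set $U$ there is a compact open $\mathcal H$-set $V$ with $\pi(1_U)=1_V$;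 3. for every clopen $C\subset\mathcal G^{(0)}$, $\pi(1_C)=1_D$ for a clopen set $D\subset\mathcal H^{(0)}$ with $[1_D]=\varphi([1_C])$ in $H_0(\mathcal H)$. Moreover, $\pi$ induces an embedding of $[[\mathcal G]]$ into $[[\mathcal H]]$: there is an injective group homomorphism $\iota:[[\mathcal G]]\to[[\mathcal H]]$ such that $\iota(\theta(U))=\theta(V)$ whenever $U$ is a compact open $\mathcal G$-set with $r(U)=s(U)=\mathcal G^{(0)}$ and $V$ is a compact open $\mathcal H$-set with $\pi(1_U)=1_V$ (in which case $r(V)=s(V)=\mathcal H^{(0)}$). (II) The group $[[\mathcal G]]$ embeds into the higher dimensional Thompson group $nV_{2,1}$, i.e. the group of all homeomorphisms of $(\{0,1\}^{\mathbb N})^n$ that map, for some two partitions into the same finite number of dyadic bricks $\{x: x_i \text{ begins with the finite word } u_i \text{ for all } i\}$, each brick of the first partition onto a brick of the second by replacing the prefixes $u_i$ by the corresponding prefixes $v_i$. -/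

import Mathlib

open Set Topology
open scoped CompactlySupported lp TensorProduct

/-- The characteristic function of a compact open set, as a continuous compactly supported
function. -/
noncomputable def charFn {Y : Type*} [TopologicalSpace Y] [T2Space Y] (R : Type*)
    [TopologicalSpace R] [Zero R] [One R] (U : TopologicalSpace.CompactOpens Y) : C_c(Y, R) where
  toFun := (U : Set Y).indicator 1
  continuous_toFun :=
    IsClopen.continuous_indicator ⟨U.isCompact.isClosed, U.isOpen⟩ continuous_const
  hasCompactSupport' := HasCompactSupport.intro U.isCompact
    fun _ hx => Set.indicator_of_notMem hx _

/-! ### Fibres of local homeomorphisms -/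

theorem isLocalHomeomorph_of_isOpenMap {Y Z : Type*} [TopologicalSpace Y] [TopologicalSpace Z]
    {f : Y → Z} (hc : Continuous f) (ho : IsOpenMap f)
    (hi : ∀ y, ∃ U, IsOpen U ∧ y ∈ U ∧ InjOn f U) : IsLocalHomeomorph f := by
  rw [isLocalHomeomorph_iff_isOpenEmbedding_restrict]
  intro y
  obtain ⟨U, hU, hy, hinj⟩ := hi y
  refine ⟨U, hU.mem_nhds hy, ?_⟩
  exact IsOpenEmbedding.of_continuous_injective_isOpenMap (hc.comp continuous_subtype_val)
    (injOn_iff_injective.mp hinj) (ho.domRestrict hU)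

theorem IsLocalHomeomorph.exists_injOn {Y Z : Type*} [TopologicalSpace Y] [TopologicalSpace Z]
    {f : Y → Z} (hf : IsLocalHomeomorph f) (y : Y) : ∃ U, IsOpen U ∧ y ∈ U ∧ InjOn f U := by
  obtain ⟨e, hy, rfl⟩ := hf y
  exact ⟨e.source, e.open_source, hy, e.injOn⟩

theorem IsLocalHomeomorph.exists_encard_fiber_le {Y Z : Type*} [TopologicalSpace Y]
    [TopologicalSpace Z] {f : Y → Z} (hf : IsLocalHomeomorph f) {K : Set Y} (hK : IsCompact K) :
    ∃ N : ℕ, ∀ z, (K ∩ f ⁻¹' {z}).encard ≤ N := by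
  refine hK.induction_on (p := fun K => ∃ N : ℕ, ∀ z, (K ∩ f ⁻¹' {z}).encard ≤ N)
    ⟨0, by simp⟩ ?_ ?_ ?_
  · rintro s t hst ⟨N, hN⟩
    exact ⟨N, fun z => (Set.encard_le_encard (inter_subset_inter_left _ hst)).trans (hN z)⟩
  · rintro s t ⟨N, hN⟩ ⟨M, hM⟩
    refine ⟨N + M, fun z => ?_⟩
    rw [union_inter_distrib_right]
    push_cast
    exact (Set.encard_union_le _ _).trans (add_le_add (hN z) (hM z))
  · intro y _
    obtain ⟨U, hU, hyU, hinj⟩ := hf.exists_injOn y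
    refine ⟨U, mem_nhdsWithin_of_mem_nhds (hU.mem_nhds hyU), 1, fun z => ?_⟩
    rw [Nat.cast_one, Set.encard_le_one_iff]
    rintro a b ⟨ha, ha'⟩ ⟨hb, hb'⟩
    exact hinj ha hb (ha'.trans hb'.symm)

/-! ### Operators on `ℓ²` given by matrices with uniformly finite rows and columns -/

/-- The matrix `K` has bounded entries, and a uniformly bounded number of nonzero entries in each
row and in each column. -/
def IsBandMatrix {α : Type*} (K : α → α → ℂ) : Prop :=
  ∃ (N : ℕ) (C : ℝ), (∀ g h, ‖K g h‖ ≤ C) ∧ (∀ g, {h | K g h ≠ 0}.encard ≤ N) ∧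
    ∀ h, {g | K g h ≠ 0}.encard ≤ N

namespace IsBandMatrix

variable {α : Type*} {K : α → α → ℂ}

theorem finite_row (hK : IsBandMatrix K) (g : α) : {h | K g h ≠ 0}.Finite := by
  obtain ⟨N, C, -, h2, -⟩ := hK
  exact Set.finite_of_encard_le_coe (h2 g)

theorem finite_col (hK : IsBandMatrix K) (h : α) : {g | K g h ≠ 0}.Finite := by
  obtain ⟨N, C, -, -, h3⟩ := hK
  exact Set.finite_of_encard_le_coe (h3 h)

theorem tsum_eq (hK : IsBandMatrix K) (ξ : α → ℂ) (g : α) :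
    ∑' h, K g h * ξ h = ∑ h ∈ (hK.finite_row g).toFinset, K g h * ξ h := by
  refine tsum_eq_sum fun h hh => ?_
  have : K g h = 0 := by simpa using hh
  rw [this, zero_mul]

theorem summable (hK : IsBandMatrix K) (ξ : α → ℂ) (g : α) :
    Summable fun h => K g h * ξ h := by
  refine summable_of_hasFiniteSupport ((hK.finite_row g).subset fun h hh => ?_)
  intro h0
  exact hh (by simp [h0])

theorem exists_bound (hK : IsBandMatrix K) : ∃ D : ℝ, 0 ≤ D ∧ ∀ (ξ : ℓ²(α, ℂ)) (S : Finset α),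
    ∑ g ∈ S, ‖∑' h, K g h * ξ h‖ ^ (2 : ENNReal).toReal ≤ (D * ‖ξ‖) ^ (2 : ENNReal).toReal := by
  classical
  obtain ⟨N, C, h1, h2, h3⟩ := id hK
  refine ⟨N * |C|, by positivity, fun ξ S => ?_⟩
  have hrow : ∀ g, (hK.finite_row g).toFinset.card ≤ N := by
    intro g
    have := h2 g
    rw [(hK.finite_row g).encard_eq_coe_toFinset_card] at this
    exact_mod_cast this
  have hcol : ∀ h, (hK.finite_col h).toFinset.card ≤ N := by
    intro g
    have := h3 g
    rw [(hK.finite_col g).encard_eq_coe_toFinset_card] at this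
    exact_mod_cast this
  simp only [ENNReal.toReal_ofNat, Real.rpow_ofNat]
  have step1 : ∀ g, ‖∑' h, K g h * ξ h‖ ^ 2 ≤
      N * |C| ^ 2 * ∑ h ∈ (hK.finite_row g).toFinset, ‖ξ h‖ ^ 2 := by
    intro g
    rw [hK.tsum_eq]
    calc ‖∑ h ∈ (hK.finite_row g).toFinset, K g h * ξ h‖ ^ 2
        ≤ (∑ h ∈ (hK.finite_row g).toFinset, |C| * ‖ξ h‖) ^ 2 := by
          gcongr
          refine norm_sum_le_of_le _ fun h _ => ?_
          rw [norm_mul]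
          gcongr
          exact (h1 g h).trans (le_abs_self C)
      _ ≤ (hK.finite_row g).toFinset.card *
            ∑ h ∈ (hK.finite_row g).toFinset, (|C| * ‖ξ h‖) ^ 2 := sq_sum_le_card_mul_sum_sq
      _ ≤ N * ∑ h ∈ (hK.finite_row g).toFinset, (|C| * ‖ξ h‖) ^ 2 := by
          gcongr
          exact hrow g
      _ = _ := by
          simp only [mul_pow]
          rw [← Finset.mul_sum]
          ring
  set T := S.biUnion fun g => (hK.finite_row g).toFinset with hT
  calc ∑ g ∈ S, ‖∑' h, K g h * ξ h‖ ^ 2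
      ≤ ∑ g ∈ S, N * |C| ^ 2 * ∑ h ∈ (hK.finite_row g).toFinset, ‖ξ h‖ ^ 2 :=
        Finset.sum_le_sum fun g _ => step1 g
    _ = N * |C| ^ 2 * ∑ g ∈ S, ∑ h ∈ (hK.finite_row g).toFinset, ‖ξ h‖ ^ 2 := by
        rw [Finset.mul_sum]
    _ = N * |C| ^ 2 * ∑ h ∈ T, ∑ g ∈ S with K g h ≠ 0, ‖ξ h‖ ^ 2 := by
        congr 1
        refine Finset.sum_comm' fun g h => ?_
        simp only [hT, Finite.mem_toFinset, mem_ofPred_eq, Finset.mem_filter, Finset.mem_biUnion]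
        grind
    _ ≤ N * |C| ^ 2 * ∑ h ∈ T, N * ‖ξ h‖ ^ 2 := by
        gcongr with h _
        rw [Finset.sum_const, nsmul_eq_mul]
        gcongr
        refine (Finset.card_le_card fun g hg => ?_).trans (hcol h)
        simpa using (Finset.mem_filter.mp hg).2
    _ = (N * |C|) ^ 2 * ∑ h ∈ T, ‖ξ h‖ ^ 2 := by
        rw [← Finset.mul_sum]
        ring
    _ ≤ (N * |C|) ^ 2 * ‖ξ‖ ^ 2 := by
        gcongr
        have := lp.sum_rpow_le_norm_rpow (p := 2) (by norm_num) ξ T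
        simpa using this
    _ = _ := by ring

/-- The bounded operator on `ℓ²` given by the matrix `K`. -/
noncomputable def toOp (hK : IsBandMatrix K) : ℓ²(α, ℂ) →L[ℂ] ℓ²(α, ℂ) :=
  LinearMap.mkContinuousOfExistsBound
    { toFun := fun ξ => ⟨fun g => ∑' h, K g h * ξ h, by
        obtain ⟨D, -, hD⟩ := hK.exists_bound
        exact memℓp_gen' (hD ξ)⟩
      map_add' := fun ξ η => by
        ext g
        simp only [lp.coeFn_add, Pi.add_apply, mul_add]
        exact (hK.summable _ g).tsum_add (hK.summable _ g)
      map_smul' := fun c ξ => by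
        ext g
        simp only [lp.coeFn_smul, Pi.smul_apply, smul_eq_mul, RingHom.id_apply]
        rw [← tsum_mul_left]
        exact tsum_congr fun h => by ring }
    (by
      obtain ⟨D, hD0, hD⟩ := hK.exists_bound
      exact ⟨D, fun ξ => lp.norm_le_of_forall_sum_le (by norm_num) (by positivity) (hD ξ)⟩)

theorem toOp_apply (hK : IsBandMatrix K) (ξ : ℓ²(α, ℂ)) (g : α) :
    hK.toOp ξ g = ∑' h, K g h * ξ h := rfl

end IsBandMatrix

/-! ### Étale groupoids -/

universe u

/-- An étale groupoid: a second countable locally compact Hausdorff topological groupoid whose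
range map is a local homeomorphism. `Arr` is the groupoid itself and `Obj` is its unit space;
the product `mul g h` is defined when `src g = rng h`. -/
structure EtaleGroupoid where
  Arr : Type u
  Obj : Type u
  [topArr : TopologicalSpace Arr]
  [topObj : TopologicalSpace Obj]
  [t2Arr : T2Space Arr]
  [locallyCompactArr : LocallyCompactSpace Arr]
  [secondCountableArr : SecondCountableTopology Arr]
  src : Arr → Obj
  rng : Arr → Obj
  unit : Obj → Arr
  inv : Arr → Arr
  mul : (g h : Arr) → src g = rng h → Arr
  src_unit : ∀ x, src (unit x) = x
  rng_unit : ∀ x, rng (unit x) = x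
  src_inv : ∀ g, src (inv g) = rng g
  rng_inv : ∀ g, rng (inv g) = src g
  src_mul : ∀ g h (H : src g = rng h), src (mul g h H) = src h
  rng_mul : ∀ g h (H : src g = rng h), rng (mul g h H) = rng g
  unit_mul : ∀ g, mul (unit (rng g)) g (src_unit _) = g
  mul_unit : ∀ g, mul g (unit (src g)) (rng_unit _).symm = g
  inv_mul : ∀ g, mul (inv g) g (src_inv g) = unit (src g)
  mul_inv : ∀ g, mul g (inv g) (rng_inv g).symm = unit (rng g)
  mul_assoc : ∀ f g h (H : src f = rng g) (H' : src g = rng h),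
    mul (mul f g H) h ((src_mul f g H).trans H') = mul f (mul g h H') (H.trans (rng_mul g h H').symm)
  continuous_unit : Continuous unit
  continuous_inv : Continuous inv
  continuous_mul : Continuous fun p : {p : Arr × Arr // src p.1 = rng p.2} => mul p.1.1 p.1.2 p.2
  isLocalHomeomorph_rng : IsLocalHomeomorph rng

namespace EtaleGroupoid

attribute [instance] topArr topObj t2Arr locallyCompactArr secondCountableArr

variable (G : EtaleGroupoid.{u})

theorem continuous_rng : Continuous G.rng := G.isLocalHomeomorph_rng.continuous

theorem src_eq : G.src = G.rng ∘ G.inv := funext fun g => (G.rng_inv g).symm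

theorem continuous_src : Continuous G.src := by
  rw [src_eq]
  exact G.continuous_rng.comp G.continuous_inv

theorem unit_injective : Function.Injective G.unit :=
  Function.LeftInverse.injective G.src_unit

instance : T2Space G.Obj := T2Space.of_injective_continuous G.unit_injective G.continuous_unit

variable {G}

theorem mul_congr {g g' h h' : G.Arr} (hg : g = g') (hh : h = h') (H : G.src g = G.rng h) :
    G.mul g h H = G.mul g' h' (by rw [← hg, ← hh, H]) := by
  subst hg hh
  rfl

theorem mul_inv_cancel_right {g h : G.Arr} (H : G.src g = G.rng h) :
    G.mul (G.mul g h H) (G.inv h) ((G.src_mul _ _ _).trans (G.rng_inv h).symm) = g := by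
  rw [G.mul_assoc g h (G.inv h) H (G.rng_inv h).symm, mul_congr rfl (G.mul_inv h)]
  exact (mul_congr rfl (by rw [H]) _).trans (G.mul_unit g)

theorem inv_mul_cancel_right {g h : G.Arr} (H : G.src g = G.src h) :
    G.mul (G.mul g (G.inv h) (H.trans (G.rng_inv h).symm)) h
      ((G.src_mul _ _ _).trans (G.src_inv h)) = g := by
  rw [G.mul_assoc g (G.inv h) h (H.trans (G.rng_inv h).symm) (G.src_inv h),
    mul_congr rfl (G.inv_mul h)]
  exact (mul_congr rfl (by rw [H]) _).trans (G.mul_unit g)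

theorem mul_inv_cancel_left {g h : G.Arr} (H : G.rng g = G.rng h) :
    G.mul g (G.mul (G.inv g) h ((G.src_inv g).trans H))
      ((G.rng_inv g).symm.trans (G.rng_mul _ _ _).symm) = h := by
  rw [← G.mul_assoc g (G.inv g) h (G.rng_inv g).symm ((G.src_inv g).trans H),
    mul_congr (G.mul_inv g) rfl]
  exact (mul_congr (by rw [H]) rfl _).trans (G.unit_mul h)

theorem inv_mul_cancel_left {g h : G.Arr} (H : G.src g = G.rng h) :
    G.mul (G.inv g) (G.mul g h H) ((G.src_inv g).trans (G.rng_mul _ _ _).symm) = h := by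
  rw [← G.mul_assoc (G.inv g) g h (G.src_inv g) H, mul_congr (G.inv_mul g) rfl]
  exact (mul_congr (by rw [H]) rfl _).trans (G.unit_mul h)

theorem inv_inv (g : G.Arr) : G.inv (G.inv g) = g := by
  have h := inv_mul_cancel_left (g := G.inv g) (h := g) (G.src_inv g)
  rw [← h]
  have h2 := G.mul_unit (G.inv (G.inv g))
  rw [mul_congr rfl (show G.unit (G.src (G.inv (G.inv g))) = _ from by
    rw [G.src_inv, G.rng_inv, ← G.inv_mul])] at h2
  rw [h, ← h2]
  exact h

variable (G)

theorem isLocalHomeomorph_src : IsLocalHomeomorph G.src := by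
  rw [src_eq]
  let e : G.Arr ≃ₜ G.Arr := ⟨⟨G.inv, G.inv, inv_inv, inv_inv⟩, G.continuous_inv, G.continuous_inv⟩
  exact G.isLocalHomeomorph_rng.comp e.isLocalHomeomorph

theorem isOpenMap_unit : IsOpenMap G.unit := by
  intro V hV
  rw [isOpen_iff_mem_nhds]
  rintro _ ⟨x, hx, rfl⟩
  obtain ⟨U, hU, hxU, hinj⟩ := G.isLocalHomeomorph_rng.exists_injOn (G.unit x)
  have h1 : IsOpen (U ∩ (G.unit ∘ G.rng) ⁻¹' U ∩ G.rng ⁻¹' V) :=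
    (hU.inter (hU.preimage (G.continuous_unit.comp G.continuous_rng))).inter
      (hV.preimage G.continuous_rng)
  refine Filter.mem_of_superset (h1.mem_nhds ⟨⟨hxU, ?_⟩, ?_⟩) ?_
  · simpa [G.rng_unit] using hxU
  · simpa [G.rng_unit] using hx
  · rintro g ⟨⟨hg, hg'⟩, hgV⟩
    exact ⟨G.rng g, hgV, hinj hg' hg (G.rng_unit _)⟩

/-- The open subset `unit '' C` of the groupoid, for a compact open set `C` of units. -/
def unitSet (C : TopologicalSpace.CompactOpens G.Obj) : TopologicalSpace.CompactOpens G.Arr where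
  carrier := G.unit '' C
  isCompact' := C.isCompact.image G.continuous_unit
  isOpen' := G.isOpenMap_unit _ C.isOpen

/-! ### `G`-sets, minimality, pure infiniteness -/

/-- `U` is a `G`-set (a bisection): the range and source maps are injective on `U`. -/
def IsGSet (U : Set G.Arr) : Prop := InjOn G.rng U ∧ InjOn G.src U

/-- Every orbit is dense in the unit space. -/
def IsMinimal : Prop := ∀ x : G.Obj, Dense {y | ∃ g, G.src g = x ∧ G.rng g = y}

/-- The interior of the isotropy bundle is the unit space. -/
def IsEssentiallyPrincipal : Prop := interior {g | G.rng g = G.src g} = Set.range G.unit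

/-- A clopen set `A` of units is properly infinite. -/
def IsProperlyInfinite (A : Set G.Obj) : Prop :=
  ∃ U V : TopologicalSpace.CompactOpens G.Arr, G.IsGSet U ∧ G.IsGSet V ∧
    G.src '' U = A ∧ G.src '' V = A ∧ G.rng '' U ∪ G.rng '' V ⊆ A ∧
    Disjoint (G.rng '' U) (G.rng '' V)

/-- Every clopen set of units is properly infinite. -/
def IsPurelyInfinite : Prop := ∀ A : Set G.Obj, IsClopen A → G.IsProperlyInfinite A

/-! ### The homology group `H₀` -/

/-- The image of `∂₁ = s_* - r_* : C_c(G, ℤ) → C_c(G⁽⁰⁾, ℤ)`, where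
`π_*(f)(y) = ∑_{π(g) = y} f(g)` (a finite sum). -/
noncomputable def boundaries : AddSubgroup C_c(G.Obj, ℤ) where
  carrier := {a | ∃ f : C_c(G.Arr, ℤ), ∀ y,
    a y = (∑ᶠ g : G.src ⁻¹' {y}, f g) - ∑ᶠ g : G.rng ⁻¹' {y}, f g}
  zero_mem' := ⟨0, fun y => by simp⟩
  add_mem' := by
    have key : ∀ (p : G.Arr → G.Obj), IsLocalHomeomorph p → ∀ (f : C_c(G.Arr, ℤ)) (y : G.Obj),
        (Function.support fun g : p ⁻¹' {y} => f g).Finite := by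
      intro p hp f y
      obtain ⟨N, hN⟩ := hp.exists_encard_fiber_le f.hasCompactSupport
      have h1 : (tsupport f ∩ p ⁻¹' {y}).Finite := Set.finite_of_encard_le_coe (hN y)
      refine Set.Finite.of_finite_image (f := Subtype.val) (h1.subset ?_)
        Subtype.val_injective.injOn
      rintro _ ⟨g, hg, rfl⟩
      exact ⟨subset_tsupport _ hg, g.2⟩
    rintro a b ⟨f, hf⟩ ⟨g, hg⟩
    refine ⟨f + g, fun y => ?_⟩
    simp only [CompactlySupportedContinuousMap.add_apply, hf y, hg y]
    rw [finsum_add_distrib (key _ G.isLocalHomeomorph_src f y) (key _ G.isLocalHomeomorph_src g y),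
      finsum_add_distrib (key _ G.isLocalHomeomorph_rng f y) (key _ G.isLocalHomeomorph_rng g y)]
    ring
  neg_mem' := by
    rintro a ⟨f, hf⟩
    refine ⟨-f, fun y => ?_⟩
    simp only [CompactlySupportedContinuousMap.coe_neg, Pi.neg_apply, hf y, finsum_neg_distrib]
    ring

/-- The homology group `H₀(G) = C_c(G⁽⁰⁾, ℤ) / im ∂₁`. -/
abbrev H0 : Type u := C_c(G.Obj, ℤ) ⧸ G.boundaries

/-- The class `[f]` in `H₀(G)`. -/
noncomputable def toH0 (f : C_c(G.Obj, ℤ)) : G.H0 := QuotientAddGroup.mk f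

/-! ### The reduced groupoid C⋆-algebra -/

open Classical in
/-- The matrix of the left regular representation: the entry at `(g, h)` is `f(gh⁻¹)` if
`s(g) = s(h)`, and zero otherwise. -/
noncomputable def regMatrix (f : C_c(G.Arr, ℂ)) (g h : G.Arr) : ℂ :=
  if H : G.src g = G.src h then f (G.mul g (G.inv h) (H.trans (G.rng_inv h).symm)) else 0

theorem isBandMatrix_regMatrix (f : C_c(G.Arr, ℂ)) : IsBandMatrix (G.regMatrix f) := by
  obtain ⟨N, hN⟩ := G.isLocalHomeomorph_rng.exists_encard_fiber_le f.hasCompactSupport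
  obtain ⟨M, hM⟩ := G.isLocalHomeomorph_src.exists_encard_fiber_le f.hasCompactSupport
  obtain ⟨C, hC⟩ := f.hasCompactSupport.exists_bound_of_continuous f.continuous
  have hreg : ∀ {g h : G.Arr}, G.regMatrix f g h ≠ 0 → ∃ H : G.src g = G.src h,
      f (G.mul g (G.inv h) (H.trans (G.rng_inv h).symm)) ≠ 0 := by
    intro g h hgh
    unfold regMatrix at hgh
    split_ifs at hgh with H
    · exact ⟨H, hgh⟩
    · exact absurd rfl hgh
  classical
  refine ⟨max N M, |C|, fun g h => ?_, fun g => ?_, fun h => ?_⟩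
  · unfold regMatrix
    split_ifs with H
    · exact (hC _).trans (le_abs_self C)
    · simp
  · refine le_trans ?_ ((hN (G.rng g)).trans (by exact_mod_cast le_max_left N M))
    refine Set.encard_le_encard_of_injOn (f := fun h => if H : G.src g = G.src h then
      G.mul g (G.inv h) (H.trans (G.rng_inv h).symm) else g) ?_ ?_
    · intro h hh
      obtain ⟨H, hf⟩ := hreg hh
      simp only [H, dite_true]
      exact ⟨subset_tsupport _ hf, G.rng_mul _ _ _⟩
    · intro h hh h' hh' he
      obtain ⟨H, -⟩ := hreg hh
      obtain ⟨H', -⟩ := hreg hh'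
      simp only [dif_pos H, dif_pos H'] at he
      have e1 := inv_mul_cancel_left (H.trans (G.rng_inv h).symm)
      have e2 := inv_mul_cancel_left (H'.trans (G.rng_inv h').symm)
      rw [mul_congr rfl he, e2] at e1
      rw [← inv_inv h, ← inv_inv h', e1]
  · refine le_trans ?_ ((hM (G.rng h)).trans (by exact_mod_cast le_max_right N M))
    refine Set.encard_le_encard_of_injOn (f := fun g => if H : G.src g = G.src h then
      G.mul g (G.inv h) (H.trans (G.rng_inv h).symm) else g) ?_ ?_
    · intro g hg
      obtain ⟨H, hf⟩ := hreg hg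
      simp only [H, dite_true]
      exact ⟨subset_tsupport _ hf, (G.src_mul _ _ _).trans (G.src_inv h)⟩
    · intro g hg g' hg' he
      obtain ⟨H, -⟩ := hreg hg
      obtain ⟨H', -⟩ := hreg hg'
      simp only [dif_pos H, dif_pos H'] at he
      have e1 := inv_mul_cancel_right H
      have e2 := inv_mul_cancel_right H'
      rw [mul_congr he rfl, e2] at e1
      exact e1.symm

/-- The operator `λ(f)` on `ℓ²(G)`, `(λ(f)ξ)(g) = ∑_{s(h) = s(g)} f(gh⁻¹) ξ(h)`. It is the direct
sum of the left regular representations of `f` on the spaces `ℓ²(s⁻¹(x))`, over all units `x`. -/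
noncomputable def leftReg (f : C_c(G.Arr, ℂ)) : ℓ²(G.Arr, ℂ) →L[ℂ] ℓ²(G.Arr, ℂ) :=
  (G.isBandMatrix_regMatrix f).toOp

theorem leftReg_apply (f : C_c(G.Arr, ℂ)) (ξ : ℓ²(G.Arr, ℂ)) (g : G.Arr) :
    G.leftReg f ξ g = ∑' h, G.regMatrix f g h * ξ h := rfl

/-- The characteristic function of the unit space acts as the identity. -/
theorem leftReg_charFn_unitSet [CompactSpace G.Obj] :
    G.leftReg (charFn ℂ (G.unitSet ⊤)) = 1 := by
  classical
  ext ξ g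
  rw [leftReg_apply, tsum_eq_single g]
  · have : G.regMatrix (charFn ℂ (G.unitSet ⊤)) g g = 1 := by
      unfold regMatrix
      rw [dif_pos rfl, G.mul_inv]
      exact Set.indicator_of_mem (Set.mem_image_of_mem G.unit (Set.mem_univ _)) _
    rw [this, one_mul]
    rfl
  · intro h hh
    have : G.regMatrix (charFn ℂ (G.unitSet ⊤)) g h = 0 := by
      unfold regMatrix
      split_ifs with H
      · refine Set.indicator_of_notMem ?_ _
        rintro ⟨x, -, hx⟩
        apply hh
        have e1 := inv_mul_cancel_right H
        rw [mul_congr hx.symm rfl] at e1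
        rw [← e1]
        have hx2 : x = G.rng h := by
          have := congrArg G.src hx
          rw [G.src_unit, G.src_mul, G.src_inv] at this
          exact this
        subst hx2
        exact (G.unit_mul h).symm
      · rfl
    rw [this, zero_mul]

/-- The reduced groupoid C⋆-algebra of an étale groupoid with compact unit space: the
C⋆-algebra of operators on `ℓ²(G)` generated by the operators `λ(f)`, `f ∈ C_c(G)`. Its unit is
`λ(1)`, where `1` is the characteristic function of the unit space. -/
noncomputable def reducedCStar [CompactSpace G.Obj] :
    StarSubalgebra ℂ (ℓ²(G.Arr, ℂ) →L[ℂ] ℓ²(G.Arr, ℂ)) :=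
  (StarAlgebra.adjoin ℂ (Set.range G.leftReg)).topologicalClosure

/-- A function `f ∈ C_c(G)` as an element of the reduced C⋆-algebra. -/
noncomputable def ofCc [CompactSpace G.Obj] (f : C_c(G.Arr, ℂ)) : G.reducedCStar :=
  ⟨G.leftReg f, StarSubalgebra.le_topologicalClosure _
    (StarAlgebra.subset_adjoin ℂ _ ⟨f, rfl⟩)⟩

/-- The subalgebra `C(G⁽⁰⁾)` of the reduced C⋆-algebra: the functions that vanish outside the
unit space. -/
noncomputable def diagonal [CompactSpace G.Obj] : Set G.reducedCStar :=
  G.ofCc '' {f | ∀ g, g ∉ Set.range G.unit → f g = 0}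

/-! ### The topological full group -/

/-- `U` is a compact open `G`-set with source and range the whole unit space, and `α` is the
homeomorphism `θ(U) = (r|U) ∘ (s|U)⁻¹`. -/
structure IsTheta (U : TopologicalSpace.CompactOpens G.Arr) (α : G.Obj ≃ₜ G.Obj) : Prop where
  isGSet : G.IsGSet U
  src_image : G.src '' U = Set.univ
  rng_image : G.rng '' U = Set.univ
  apply_src : ∀ g ∈ U, α (G.src g) = G.rng g

theorem isLocalHomeomorph_mul : IsLocalHomeomorph
    fun p : {p : G.Arr × G.Arr // G.src p.1 = G.rng p.2} => G.mul p.1.1 p.1.2 p.2 := by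
  refine IsLocalHomeomorph.of_comp ?_ G.isLocalHomeomorph_rng G.continuous_mul
  have : (G.rng ∘ fun p : {p : G.Arr × G.Arr // G.src p.1 = G.rng p.2} =>
      G.mul p.1.1 p.1.2 p.2) = G.rng ∘ fun p => p.1.1 := by
    ext p
    exact G.rng_mul _ _ _
  rw [this]
  refine G.isLocalHomeomorph_rng.comp (isLocalHomeomorph_of_isOpenMap (by fun_prop) ?_ ?_)
  · rw [IsOpenMap]
    intro W hW
    rw [isOpen_iff_mem_nhds]
    rintro _ ⟨⟨⟨g, h⟩, H⟩, hp, rfl⟩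
    obtain ⟨W', hW', rfl⟩ := isOpen_induced_iff.mp hW
    obtain ⟨A, B, hA, hB, hgA, hhB, hAB⟩ := isOpen_prod_iff.mp hW' g h hp
    have h1 : IsOpen (A ∩ G.src ⁻¹' (G.rng '' B)) :=
      hA.inter ((G.isLocalHomeomorph_rng.isOpenMap _ hB).preimage G.continuous_src)
    refine Filter.mem_of_superset (h1.mem_nhds ⟨hgA, h, hhB, H.symm⟩) ?_
    rintro g' ⟨hg', h', hh', H'⟩
    exact ⟨⟨(g', h'), H'.symm⟩, hAB ⟨hg', hh'⟩, rfl⟩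
  · rintro ⟨⟨g, h⟩, H⟩
    obtain ⟨U, hU, hhU, hinj⟩ := G.isLocalHomeomorph_rng.exists_injOn h
    refine ⟨(fun p => p.1.2) ⁻¹' U, hU.preimage (by fun_prop), hhU, ?_⟩
    rintro ⟨⟨a, b⟩, Hab⟩ hb ⟨⟨a', b'⟩, Hab'⟩ hb' (rfl : a = a')
    obtain rfl : b = b' := hinj hb hb' (Hab.symm.trans Hab')
    rfl

/-- The topological full group `[[G]]`: all homeomorphisms `θ(U)` of the unit space, where `U` is
a compact open `G`-set. -/
def topologicalFullGroup [CompactSpace G.Obj] : Subgroup (G.Obj ≃ₜ G.Obj) where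
  carrier := {α | ∃ U, G.IsTheta U α}
  one_mem' := by
    refine ⟨G.unitSet ⊤, ⟨?_, ?_⟩, ?_, ?_, ?_⟩
    · rintro _ ⟨x, -, rfl⟩ _ ⟨y, -, rfl⟩ h
      rw [G.rng_unit, G.rng_unit] at h
      rw [h]
    · rintro _ ⟨x, -, rfl⟩ _ ⟨y, -, rfl⟩ h
      rw [G.src_unit, G.src_unit] at h
      rw [h]
    · exact eq_univ_of_forall fun x => ⟨G.unit x, Set.mem_image_of_mem _ (Set.mem_univ _),
        G.src_unit x⟩
    · exact eq_univ_of_forall fun x => ⟨G.unit x, Set.mem_image_of_mem _ (Set.mem_univ _),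
        G.rng_unit x⟩
    · rintro _ ⟨x, -, rfl⟩
      rw [G.rng_unit, G.src_unit]
      rfl
  mul_mem' := by
    rintro α β ⟨U, hU⟩ ⟨V, hV⟩
    let Z := {p : G.Arr × G.Arr // G.src p.1 = G.rng p.2}
    let m : Z → G.Arr := fun p => G.mul p.1.1 p.1.2 p.2
    let W : Set Z := Subtype.val ⁻¹' ((U : Set G.Arr) ×ˢ (V : Set G.Arr))
    have hWc : IsCompact W := by
      have hcl : IsClosed {p : G.Arr × G.Arr | G.src p.1 = G.rng p.2} :=
        isClosed_eq (G.continuous_src.comp continuous_fst) (G.continuous_rng.comp continuous_snd)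
      exact hcl.isClosedEmbedding_subtypeVal.isCompact_preimage (U.isCompact.prod V.isCompact)
    have hWo : IsOpen W := (U.isOpen.prod V.isOpen).preimage continuous_subtype_val
    have hθ : ∀ k ∈ m '' W, α (β (G.src k)) = G.rng k := by
      rintro _ ⟨⟨⟨g, h⟩, H⟩, ⟨hg, hh⟩, rfl⟩
      change α (β (G.src (G.mul g h H))) = G.rng (G.mul g h H)
      rw [G.src_mul, G.rng_mul, hV.apply_src h hh, ← hU.apply_src g hg]
      exact congrArg α H.symm
    have hsrc : InjOn G.src (m '' W) := by
      rintro _ ⟨⟨⟨g, h⟩, H⟩, ⟨hg, hh⟩, rfl⟩ _ ⟨⟨⟨g', h'⟩, H'⟩, ⟨hg', hh'⟩, rfl⟩ he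
      change G.src (G.mul g h H) = G.src (G.mul g' h' H') at he
      rw [G.src_mul, G.src_mul] at he
      obtain rfl : h = h' := hV.isGSet.2 hh hh' he
      obtain rfl : g = g' := hU.isGSet.2 hg hg' (Eq.trans H (Eq.symm H'))
      rfl
    have hsurj : G.src '' (m '' W) = univ := by
      refine eq_univ_of_forall fun x => ?_
      obtain ⟨h, hh, rfl⟩ := hV.src_image.symm ▸ mem_univ x
      obtain ⟨g, hg, H⟩ := hU.src_image.symm ▸ mem_univ (G.rng h)
      exact ⟨_, ⟨⟨(g, h), H⟩, ⟨hg, hh⟩, rfl⟩, G.src_mul _ _ _⟩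
    refine ⟨⟨⟨m '' W, hWc.image G.continuous_mul⟩, G.isLocalHomeomorph_mul.isOpenMap W hWo⟩,
      ⟨?_, hsrc⟩, hsurj, ?_, hθ⟩
    · intro k hk k' hk' he
      rw [← hθ k hk, ← hθ k' hk'] at he
      exact hsrc hk hk' (β.injective (α.injective he))
    · refine eq_univ_of_forall fun x => ?_
      obtain ⟨k, hk, hx⟩ := hsurj.symm ▸ mem_univ (β.symm (α.symm x))
      exact ⟨k, hk, by rw [← hθ k hk, hx]; simp⟩
  inv_mem' := by
    rintro α ⟨U, hU⟩
    let e : G.Arr ≃ₜ G.Arr := ⟨⟨G.inv, G.inv, inv_inv, inv_inv⟩, G.continuous_inv, G.continuous_inv⟩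
    have hsrc : ∀ g, G.src (e g) = G.rng g := G.src_inv
    have hrng : ∀ g, G.rng (e g) = G.src g := G.rng_inv
    refine ⟨⟨⟨e '' U, U.isCompact.image e.continuous⟩, e.isOpenMap _ U.isOpen⟩,
      ⟨?_, ?_⟩, ?_, ?_, ?_⟩
    · rintro _ ⟨g, hg, rfl⟩ _ ⟨h, hh, rfl⟩ he
      rw [hrng, hrng] at he
      rw [hU.isGSet.2 hg hh he]
    · rintro _ ⟨g, hg, rfl⟩ _ ⟨h, hh, rfl⟩ he
      rw [hsrc, hsrc] at he
      rw [hU.isGSet.1 hg hh he]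
    · refine eq_univ_of_forall fun x => ?_
      obtain ⟨g, hg, rfl⟩ := hU.rng_image.symm ▸ mem_univ x
      exact ⟨_, ⟨g, hg, rfl⟩, hsrc g⟩
    · refine eq_univ_of_forall fun x => ?_
      obtain ⟨g, hg, rfl⟩ := hU.src_image.symm ▸ mem_univ x
      exact ⟨_, ⟨g, hg, rfl⟩, hrng g⟩
    · rintro _ ⟨g, hg, rfl⟩
      rw [hsrc, hrng, ← hU.apply_src g hg]
      exact α.symm_apply_apply _

end EtaleGroupoid

namespace EtaleGroupoid

/-! ### Products -/

/-- The product groupoid, with componentwise operations and the product topology. -/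
def pi {n : ℕ} (G : Fin n → EtaleGroupoid.{u}) : EtaleGroupoid.{u} where
  Arr := ∀ i, (G i).Arr
  Obj := ∀ i, (G i).Obj
  src g i := (G i).src (g i)
  rng g i := (G i).rng (g i)
  unit x i := (G i).unit (x i)
  inv g i := (G i).inv (g i)
  mul g h H i := (G i).mul (g i) (h i) (congrFun H i)
  src_unit _ := funext fun _ => (G _).src_unit _
  rng_unit _ := funext fun _ => (G _).rng_unit _
  src_inv _ := funext fun _ => (G _).src_inv _
  rng_inv _ := funext fun _ => (G _).rng_inv _
  src_mul _ _ _ := funext fun _ => (G _).src_mul _ _ _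
  rng_mul _ _ _ := funext fun _ => (G _).rng_mul _ _ _
  unit_mul _ := funext fun _ => (G _).unit_mul _
  mul_unit _ := funext fun _ => (G _).mul_unit _
  inv_mul _ := funext fun _ => (G _).inv_mul _
  mul_inv _ := funext fun _ => (G _).mul_inv _
  mul_assoc _ _ _ _ _ := funext fun _ => (G _).mul_assoc _ _ _ _ _
  continuous_unit := continuous_pi fun i => (G i).continuous_unit.comp (continuous_apply i)
  continuous_inv := continuous_pi fun i => (G i).continuous_inv.comp (continuous_apply i)
  continuous_mul := continuous_pi fun i => (G i).continuous_mul.comp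
    (f := fun p : {p : (∀ i, (G i).Arr) × (∀ i, (G i).Arr) //
      (fun i => (G i).src (p.1 i)) = fun i => (G i).rng (p.2 i)} =>
        (⟨(p.1.1 i, p.1.2 i), congrFun p.2 i⟩ :
          {p : (G i).Arr × (G i).Arr // (G i).src p.1 = (G i).rng p.2})) (by fun_prop)
  isLocalHomeomorph_rng := by
    refine isLocalHomeomorph_of_isOpenMap
      (continuous_pi fun i => (G i).continuous_rng.comp (continuous_apply i))
      (IsOpenMap.piMap (fun i => (G i).isLocalHomeomorph_rng.isOpenMap)
        (by rw [Filter.cofinite_eq_bot]; exact Filter.eventually_bot)) ?_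
    intro g
    choose U hU hgU hinj using fun i => (G i).isLocalHomeomorph_rng.exists_injOn (g i)
    refine ⟨Set.univ.pi U, isOpen_set_pi Set.finite_univ fun i _ => hU i, fun i _ => hgU i, ?_⟩
    intro a ha b hb hab
    exact funext fun i => hinj i (ha i trivial) (hb i trivial) (congrFun hab i)

instance {n : ℕ} (G : Fin n → EtaleGroupoid.{u}) [∀ i, CompactSpace (G i).Obj] :
    CompactSpace (pi G).Obj :=
  inferInstanceAs (CompactSpace (∀ i, (G i).Obj))

/-- The external product `(x₁, …, xₙ) ↦ f₁(x₁) ⋯ fₙ(xₙ)` of functions on the unit spaces. -/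
noncomputable def extProd {n : ℕ} (G : Fin n → EtaleGroupoid.{u})
    (f : ∀ i, C_c((G i).Obj, ℤ)) : C_c((pi G).Obj, ℤ) where
  toFun := fun x => ∏ i, f i (x i)
  continuous_toFun := continuous_finsetProd _ fun i _ =>
    (f i).continuous.comp (continuous_apply (A := fun i => (G i).Obj) i)
  hasCompactSupport' := by
    refine HasCompactSupport.intro
      (isCompact_univ_pi fun i => (f i).hasCompactSupport) fun x hx => ?_
    obtain ⟨i, hi⟩ : ∃ i, x i ∉ tsupport (f i) := by
      by_contra! h
      exact hx fun i _ => h i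
    exact Finset.prod_eq_zero (Finset.mem_univ i) (image_eq_zero_of_notMem_tsupport hi)

end EtaleGroupoid

/-! ### Groupoids of one-sided shifts of finite type -/

/-- A finite directed graph; the edge `e` goes from `ini e` to `ter e`. -/
structure FiniteDigraph where
  V : Type
  E : Type
  [fintypeV : Fintype V]
  [decidableEqV : DecidableEq V]
  [fintypeE : Fintype E]
  ini : E → V
  ter : E → V

namespace FiniteDigraph

attribute [instance] fintypeV decidableEqV fintypeE

variable (Γ : FiniteDigraph)

/-- The adjacency matrix. -/
noncomputable def adj : Matrix Γ.V Γ.V ℕ :=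
  Matrix.of fun ξ η => Nat.card {e : Γ.E // Γ.ini e = ξ ∧ Γ.ter e = η}

/-- The adjacency matrix is irreducible. -/
def IsIrreducible : Prop := ∀ ξ η, ∃ m : ℕ, 0 < m ∧ 0 < (Γ.adj ^ m) ξ η

/-- The adjacency matrix is a permutation matrix. -/
def IsPermutation : Prop := ∃ σ : Equiv.Perm Γ.V, Γ.adj = σ.permMatrix ℕ

instance : TopologicalSpace Γ.E := ⊥

instance : DiscreteTopology Γ.E := ⟨rfl⟩

/-- The one-sided shift space: infinite paths in the graph, with the product topology. -/
def PathSpace : Type := {x : ℕ → Γ.E // ∀ k, Γ.ter (x k) = Γ.ini (x (k + 1))}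

instance : TopologicalSpace Γ.PathSpace := instTopologicalSpaceSubtype

variable {Γ}

theorem PathSpace.continuous_val : Continuous fun x : Γ.PathSpace => x.1 := continuous_subtype_val

theorem PathSpace.continuous_coord (j : ℕ) : Continuous fun x : Γ.PathSpace => x.1 j :=
  (continuous_apply j).comp continuous_subtype_val

instance : T2Space Γ.PathSpace := inferInstanceAs (T2Space (Subtype _))

instance : SecondCountableTopology Γ.PathSpace := by
  have h : SecondCountableTopology (ℕ → Γ.E) := inferInstance
  exact TopologicalSpace.Subtype.secondCountableTopology
    {x : ℕ → Γ.E | ∀ k, Γ.ter (x k) = Γ.ini (x (k + 1))}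

instance : CompactSpace Γ.PathSpace := by
  have h : IsClosed {x : ℕ → Γ.E | ∀ k, Γ.ter (x k) = Γ.ini (x (k + 1))} := by
    have : {x : ℕ → Γ.E | ∀ k, Γ.ter (x k) = Γ.ini (x (k + 1))} =
        ⋂ k, (fun x : ℕ → Γ.E => (x k, x (k + 1))) ⁻¹' {p | Γ.ter p.1 = Γ.ini p.2} := by
      ext x
      simp
    rw [this]
    exact isClosed_iInter fun k => (isClosed_discrete _).preimage (by fun_prop)
  exact isCompact_iff_compactSpace.mp h.isCompact

/-- The shift map. -/
def PathSpace.shift (x : Γ.PathSpace) : Γ.PathSpace := ⟨fun k => x.1 (k + 1), fun k => x.2 (k + 1)⟩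

namespace PathSpace

theorem continuous_shift : Continuous (shift (Γ := Γ)) :=
  Continuous.subtype_mk (continuous_pi fun k => continuous_coord (k + 1)) _

theorem shift_iterate_apply (x : Γ.PathSpace) (k j : ℕ) : (shift^[k] x).1 j = x.1 (j + k) := by
  induction k generalizing x with
  | zero => rfl
  | succ k ih =>
    rw [Function.iterate_succ_apply, ih]
    change x.1 (j + k + 1) = _
    congr 1

/-- The cylinder of length `m` around `x`. -/
def cyl (x : Γ.PathSpace) (m : ℕ) : Set Γ.PathSpace := {y | ∀ j < m, y.1 j = x.1 j}

theorem isOpen_cyl (x : Γ.PathSpace) (m : ℕ) : IsOpen (cyl x m) := by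
  have : cyl x m = ⋂ j ∈ Finset.range m, (fun y : Γ.PathSpace => y.1 j) ⁻¹' {x.1 j} := by
    ext y
    simp [cyl]
  rw [this]
  exact isOpen_biInter_finset fun j _ => (isOpen_discrete _).preimage (continuous_coord j)

theorem mem_cyl (x : Γ.PathSpace) (m : ℕ) : x ∈ cyl x m := fun _ _ => rfl

theorem exists_cyl_subset {P : Set Γ.PathSpace} (hP : IsOpen P) {x : Γ.PathSpace} (hx : x ∈ P) :
    ∃ m, cyl x m ⊆ P := by
  obtain ⟨P', hP', rfl⟩ := isOpen_induced_iff.mp hP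
  obtain ⟨I, u, h1, h2⟩ := isOpen_pi_iff.mp hP' x.1 hx
  refine ⟨I.sup id + 1, fun y hy => h2 fun j hj => ?_⟩
  have := hy j (Nat.lt_succ_of_le (Finset.le_sup (f := id) hj))
  rw [this]
  exact (h1 j hj).2

theorem isOpenMap_shift : IsOpenMap (shift (Γ := Γ)) := by
  intro P hP
  rw [isOpen_iff_mem_nhds]
  rintro _ ⟨x, hx, rfl⟩
  obtain ⟨m, hm⟩ := exists_cyl_subset hP hx
  refine Filter.mem_of_superset ((isOpen_cyl (shift x) (m + 1)).mem_nhds (mem_cyl _ _)) ?_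
  intro z hz
  let w : Γ.PathSpace := ⟨fun k => Nat.casesOn k (x.1 0) z.1, fun k => by
    cases k with
    | zero =>
      have h0 : z.1 0 = x.1 1 := hz 0 (Nat.succ_pos m)
      change Γ.ter (x.1 0) = Γ.ini (z.1 0)
      rw [h0]
      exact x.2 0
    | succ k => exact z.2 k⟩
  refine ⟨w, hm fun j hj => ?_, rfl⟩
  cases j with
  | zero => rfl
  | succ j => exact hz j (by omega)

theorem isOpenMap_shift_iterate (l : ℕ) : IsOpenMap (shift (Γ := Γ))^[l] := by
  induction l with
  | zero => exact IsOpenMap.id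
  | succ l ih =>
    rw [Function.iterate_succ]
    exact ih.comp isOpenMap_shift

/-- If `x, y` agree with `x', y'` on initial segments, then an equality of shifts of `x', y'` at
an earlier time follows from one at a later time. -/
theorem shift_eq_of_cyl {x y x' y' : Γ.PathSpace} {k l d : ℕ} (hx : x' ∈ cyl x (k + d))
    (hy : y' ∈ cyl y (l + d)) (h : shift^[k] x = shift^[l] y)
    (h' : shift^[k + d] x' = shift^[l + d] y') : shift^[k] x' = shift^[l] y' := by
  refine Subtype.ext (funext fun j => ?_)
  rw [shift_iterate_apply, shift_iterate_apply]
  by_cases hj : j < d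
  · rw [hx (j + k) (by omega), hy (j + l) (by omega)]
    have := congrArg (fun z => z.1 j) h
    simpa only [shift_iterate_apply] using this
  · have := congrArg (fun z => z.1 (j - d)) h'
    simp only [shift_iterate_apply] at this
    rw [show j - d + (k + d) = j + k by omega, show j - d + (l + d) = j + l by omega] at this
    exact this

theorem shift_eq_add {x y : Γ.PathSpace} {k l : ℕ} (h : shift^[k] x = shift^[l] y) (d : ℕ) :
    shift^[k + d] x = shift^[l + d] y := by
  rw [Nat.add_comm k, Nat.add_comm l, Function.iterate_add_apply, Function.iterate_add_apply, h]

theorem shift_eq_trans {x y z : Γ.PathSpace} {k l k' l' : ℕ} (h : shift^[k] x = shift^[l] y)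
    (h' : shift^[k'] y = shift^[l'] z) : shift^[k + k'] x = shift^[l + l'] z := by
  rw [shift_eq_add h k', Function.iterate_add_apply, h', ← Function.iterate_add_apply]

end PathSpace

open PathSpace

variable (Γ)

/-- The set of triples `(x, n, y)` such that `σᵏ(x) = σˡ(y)` for some `k, l` with `n = k - l`. -/
def SFTArr : Type := {p : Γ.PathSpace × ℤ × Γ.PathSpace //
  ∃ k l : ℕ, p.2.1 = (k : ℤ) - l ∧ shift^[k] p.1 = shift^[l] p.2.2}

variable {Γ}

namespace SFTArr

/-- The set of all `(x, k - l, y)` with `x ∈ P`, `y ∈ Q` and `σᵏ(x) = σˡ(y)`. -/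
def basic (P Q : Set Γ.PathSpace) (k l : ℕ) : Set Γ.SFTArr :=
  {g | g.1.1 ∈ P ∧ g.1.2.2 ∈ Q ∧ g.1.2.1 = (k : ℤ) - l ∧ shift^[k] g.1.1 = shift^[l] g.1.2.2}

/-- The topology generated by the sets `basic P Q k l` with `P`, `Q` open. -/
instance : TopologicalSpace Γ.SFTArr :=
  TopologicalSpace.generateFrom {W | ∃ P Q k l, IsOpen P ∧ IsOpen Q ∧ W = basic P Q k l}

theorem isOpen_basic {P Q : Set Γ.PathSpace} (hP : IsOpen P) (hQ : IsOpen Q) (k l : ℕ) :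
    IsOpen (basic P Q k l) :=
  TopologicalSpace.isOpen_generateFrom_of_mem ⟨P, Q, k, l, hP, hQ, rfl⟩

theorem basic_inter_subset (P Q P' Q' : Set Γ.PathSpace) {k l k' l' : ℕ} (hk : k ≤ k')
    (h : (k : ℤ) - l = k' - l') : basic (P ∩ P') (Q ∩ Q') k l ⊆ basic P Q k l ∩ basic P' Q' k' l' := by
  rintro g ⟨⟨hP, hP'⟩, ⟨hQ, hQ'⟩, hn, hs⟩
  refine ⟨⟨hP, hQ, hn, hs⟩, hP', hQ', hn.trans h, ?_⟩
  have := shift_eq_add hs (k' - k)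
  rw [show k + (k' - k) = k' by omega, show l + (k' - k) = l' by omega] at this
  exact this

theorem isTopologicalBasis_basic : TopologicalSpace.IsTopologicalBasis
    {W : Set Γ.SFTArr | ∃ P Q k l, IsOpen P ∧ IsOpen Q ∧ W = basic P Q k l} where
  exists_subset_inter := by
    rintro _ ⟨P, Q, k, l, hP, hQ, rfl⟩ _ ⟨P', Q', k', l', hP', hQ', rfl⟩ g
      ⟨⟨h1, h2, h3, h4⟩, h1', h2', h3', h4'⟩
    rcases le_total k k' with hk | hk
    · exact ⟨_, ⟨_, _, k, l, hP.inter hP', hQ.inter hQ', rfl⟩, ⟨⟨h1, h1'⟩, ⟨h2, h2'⟩, h3, h4⟩,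
        basic_inter_subset P Q P' Q' hk (h3.symm.trans h3')⟩
    · refine ⟨_, ⟨_, _, k', l', hP'.inter hP, hQ'.inter hQ, rfl⟩,
        ⟨⟨h1', h1⟩, ⟨h2', h2⟩, h3', h4'⟩, ?_⟩
      rw [inter_comm (basic P Q k l)]
      exact basic_inter_subset P' Q' P Q hk (h3'.symm.trans h3)
  sUnion_eq := by
    refine eq_univ_of_forall fun g => ?_
    obtain ⟨k, l, h, h'⟩ := g.2
    exact ⟨_, ⟨univ, univ, k, l, isOpen_univ, isOpen_univ, rfl⟩, trivial, trivial, h, h'⟩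
  eq_generateFrom := rfl

theorem continuous_fst : Continuous fun g : Γ.SFTArr => g.1.1 := by
  refine continuous_def.mpr fun P hP => isOpen_iff_mem_nhds.mpr fun g hg => ?_
  obtain ⟨k, l, h, h'⟩ := g.2
  exact Filter.mem_of_superset ((isOpen_basic hP isOpen_univ k l).mem_nhds ⟨hg, trivial, h, h'⟩)
    fun _ h => h.1

theorem continuous_snd : Continuous fun g : Γ.SFTArr => g.1.2.2 := by
  refine continuous_def.mpr fun P hP => isOpen_iff_mem_nhds.mpr fun g hg => ?_
  obtain ⟨k, l, h, h'⟩ := g.2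
  exact Filter.mem_of_superset ((isOpen_basic isOpen_univ hP k l).mem_nhds ⟨trivial, hg, h, h'⟩)
    fun _ h => h.2.1

theorem continuous_int : Continuous fun g : Γ.SFTArr => g.1.2.1 := by
  refine continuous_def.mpr fun P _ => isOpen_iff_mem_nhds.mpr fun g hg => ?_
  obtain ⟨k, l, h, h'⟩ := g.2
  refine Filter.mem_of_superset
    ((isOpen_basic isOpen_univ isOpen_univ k l).mem_nhds ⟨trivial, trivial, h, h'⟩) ?_
  intro g' hg'
  rw [mem_preimage, hg'.2.2.1, ← h]
  exact hg

theorem continuous_val : Continuous fun g : Γ.SFTArr => g.1 :=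
  continuous_fst.prodMk (continuous_int.prodMk continuous_snd)

instance : T2Space Γ.SFTArr :=
  T2Space.of_injective_continuous Subtype.val_injective continuous_val

theorem isLocalHomeomorph_fst : IsLocalHomeomorph fun g : Γ.SFTArr => g.1.1 := by
  refine isLocalHomeomorph_of_isOpenMap continuous_fst ?_ ?_
  · rw [isTopologicalBasis_basic.isOpenMap_iff]
    rintro _ ⟨P, Q, k, l, hP, hQ, rfl⟩
    have : (fun g : Γ.SFTArr => g.1.1) '' basic P Q k l =
        P ∩ shift^[k] ⁻¹' (shift^[l] '' Q) := by
      ext x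
      constructor
      · rintro ⟨g, ⟨h1, h2, -, h4⟩, rfl⟩
        exact ⟨h1, _, h2, h4.symm⟩
      · rintro ⟨h1, y, h2, h3⟩
        exact ⟨⟨(x, k - l, y), k, l, rfl, h3.symm⟩, ⟨h1, h2, rfl, h3.symm⟩, rfl⟩
    rw [this]
    exact hP.inter ((isOpenMap_shift_iterate l Q hQ).preimage (continuous_shift.iterate k))
  · intro g
    obtain ⟨k, l, h, h'⟩ := g.2
    refine ⟨basic univ (cyl g.1.2.2 l) k l, isOpen_basic isOpen_univ (isOpen_cyl _ _) k l,
      ⟨trivial, mem_cyl _ _, h, h'⟩, ?_⟩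
    rintro a ⟨-, ha, ha', ha''⟩ b ⟨-, hb, hb', hb''⟩ (hab : a.1.1 = b.1.1)
    refine Subtype.ext (Prod.ext hab (Prod.ext (ha'.trans hb'.symm) (Subtype.ext (funext fun j => ?_))))
    by_cases hj : j < l
    · exact (ha j hj).trans (hb j hj).symm
    · have := congrArg (fun z => z.1 (j - l)) (ha''.symm.trans ((congrArg _ hab).trans hb''))
      simp only [shift_iterate_apply] at this
      rwa [show j - l + l = j by omega] at this

instance : LocallyCompactSpace Γ.SFTArr := by
  have : WeaklyLocallyCompactSpace Γ.SFTArr := by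
    refine ⟨fun g => ?_⟩
    obtain ⟨e, hg, -⟩ := isLocalHomeomorph_fst g
    obtain ⟨K, hK, h1, h2⟩ := exists_compact_subset e.open_target (e.map_source hg)
    refine ⟨e.symm '' K, hK.image_of_continuousOn (e.continuousOn_symm.mono h2), ?_⟩
    have := e.symm.image_mem_nhds (e.map_source hg) (mem_interior_iff_mem_nhds.mp h1)
    rwa [e.left_inv hg] at this
  infer_instance

instance : SecondCountableTopology Γ.SFTArr := by
  let b := TopologicalSpace.countableBasis Γ.PathSpace
  have hb := TopologicalSpace.isBasis_countableBasis Γ.PathSpace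
  let B : Set (Set Γ.SFTArr) :=
    (fun q : (Set Γ.PathSpace × Set Γ.PathSpace) × (ℕ × ℕ) => basic q.1.1 q.1.2 q.2.1 q.2.2) ''
      ((b ×ˢ b) ×ˢ univ)
  have hB : TopologicalSpace.IsTopologicalBasis B := by
    refine TopologicalSpace.isTopologicalBasis_of_isOpen_of_nhds ?_ ?_
    · rintro _ ⟨⟨⟨P, Q⟩, k, l⟩, ⟨⟨hP, hQ⟩, -⟩, rfl⟩
      exact isOpen_basic (hb.isOpen hP) (hb.isOpen hQ) k l
    · intro g W hg hW
      obtain ⟨_, ⟨P, Q, k, l, hP, hQ, rfl⟩, ⟨h1, h2, h3, h4⟩, hsub⟩ :=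
        isTopologicalBasis_basic.exists_subset_of_mem_open hg hW
      obtain ⟨P', hP', hg1, hPP⟩ := hb.exists_subset_of_mem_open h1 hP
      obtain ⟨Q', hQ', hg2, hQQ⟩ := hb.exists_subset_of_mem_open h2 hQ
      exact ⟨_, ⟨⟨⟨P', Q'⟩, k, l⟩, ⟨⟨hP', hQ'⟩, trivial⟩, rfl⟩, ⟨hg1, hg2, h3, h4⟩,
        fun g' hg' => hsub ⟨hPP hg'.1, hQQ hg'.2.1, hg'.2.2⟩⟩
  refine hB.secondCountableTopology (Set.Countable.image ?_ _)
  exact (((TopologicalSpace.countable_countableBasis _).prod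
    (TopologicalSpace.countable_countableBasis _)).prod (Set.to_countable _))

/-- The product `(x, m, y) · (y, n, z) = (x, m + n, z)`. -/
def mul (g h : Γ.SFTArr) (H : g.1.2.2 = h.1.1) : Γ.SFTArr :=
  ⟨(g.1.1, g.1.2.1 + h.1.2.1, h.1.2.2), by
    obtain ⟨k, l, h1, h2⟩ := g.2
    obtain ⟨k', l', h1', h2'⟩ := h.2
    refine ⟨k + k', l + l', ?_, ?_⟩
    · change g.1.2.1 + h.1.2.1 = _
      rw [h1, h1']
      push_cast
      ring
    · rw [← H] at h2'
      exact shift_eq_trans h2 h2'⟩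

/-- The inverse `(x, n, y)⁻¹ = (y, -n, x)`. -/
def inv (g : Γ.SFTArr) : Γ.SFTArr :=
  ⟨(g.1.2.2, -g.1.2.1, g.1.1), by
    obtain ⟨k, l, h1, h2⟩ := g.2
    exact ⟨l, k, by change -g.1.2.1 = _; rw [h1]; ring, h2.symm⟩⟩

/-- The unit `(x, 0, x)`. -/
def unit (x : Γ.PathSpace) : Γ.SFTArr := ⟨(x, 0, x), 0, 0, by simp, rfl⟩

theorem continuous_unit : Continuous (unit (Γ := Γ)) := by
  refine continuous_generateFrom_iff.mpr ?_
  rintro _ ⟨P, Q, k, l, hP, hQ, rfl⟩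
  by_cases hkl : k = l
  · subst hkl
    convert hP.inter hQ using 1
    ext x
    simp [basic, unit]
  · convert isOpen_empty using 1
    ext x
    simp only [basic, unit, mem_preimage, mem_empty_iff_false, iff_false]
    rintro ⟨-, -, h, -⟩
    change (0 : ℤ) = _ at h
    omega

theorem continuous_inv : Continuous (inv (Γ := Γ)) := by
  refine continuous_generateFrom_iff.mpr ?_
  rintro _ ⟨P, Q, k, l, hP, hQ, rfl⟩
  convert isOpen_basic hQ hP l k using 1
  ext g
  constructor
  · rintro ⟨h1, h2, h3, h4⟩
    change -g.1.2.1 = _ at h3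
    exact ⟨h2, h1, by omega, h4.symm⟩
  · rintro ⟨h1, h2, h3, h4⟩
    exact ⟨h2, h1, by change -g.1.2.1 = _; omega, h4.symm⟩

theorem continuous_mul : Continuous fun p : {p : Γ.SFTArr × Γ.SFTArr // p.1.1.2.2 = p.2.1.1} =>
    mul p.1.1 p.1.2 p.2 := by
  refine continuous_generateFrom_iff.mpr ?_
  rintro _ ⟨P, Q, k, l, hP, hQ, rfl⟩
  rw [isOpen_iff_mem_nhds]
  rintro ⟨⟨g, h⟩, H⟩ ⟨h1, h2, h3, h4⟩
  obtain ⟨k1, l1, hg1, hg2⟩ := g.2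
  obtain ⟨k2, l2, hh1, hh2⟩ := h.2
  let A := basic (P ∩ cyl g.1.1 (k1 + k2)) univ k1 l1
  let B := basic univ (Q ∩ cyl h.1.2.2 (l1 + l2)) k2 l2
  have hA : IsOpen A := isOpen_basic (hP.inter (isOpen_cyl _ _)) isOpen_univ _ _
  have hB : IsOpen B := isOpen_basic isOpen_univ (hQ.inter (isOpen_cyl _ _)) _ _
  refine Filter.mem_of_superset (((hA.prod hB).preimage continuous_subtype_val).mem_nhds
    ⟨⟨⟨h1, mem_cyl _ _⟩, trivial, hg1, hg2⟩, trivial, ⟨h2, mem_cyl _ _⟩, hh1, hh2⟩) ?_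
  rintro ⟨⟨g', h'⟩, H'⟩ ⟨⟨⟨a1, a2⟩, -, a3, a4⟩, -, ⟨b1, b2⟩, b3, b4⟩
  have hn : (k : ℤ) - l = (k1 - l1) + (k2 - l2) := by
    rw [← hg1, ← hh1]
    exact h3.symm
  refine ⟨a1, b1, ?_, ?_⟩
  · change g'.1.2.1 + h'.1.2.1 = _
    rw [hn]
    exact congrArg₂ (· + ·) a3 b3
  · have e : shift^[k1 + k2] g'.1.1 = shift^[l1 + l2] h'.1.2.2 := by
      refine shift_eq_trans a4 ?_
      change shift^[k2] g'.1.2.2 = _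
      rw [show g'.1.2.2 = h'.1.1 from H']
      exact b4
    change shift^[k] g'.1.1 = shift^[l] h'.1.2.2
    rcases le_total (k1 + k2) k with hk | hk
    · have := shift_eq_add e (k - (k1 + k2))
      rwa [show k1 + k2 + (k - (k1 + k2)) = k by omega,
        show l1 + l2 + (k - (k1 + k2)) = l by omega] at this
    · obtain ⟨d, hd⟩ := Nat.exists_eq_add_of_le hk
      have hl : l1 + l2 = l + d := by omega
      rw [hd, hl] at e
      rw [hd] at a2
      rw [hl] at b2
      exact shift_eq_of_cyl a2 b2 h4 e

end SFTArr

variable (Γ)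

/-- The étale groupoid of the one-sided shift of finite type. -/
def sftGroupoid : EtaleGroupoid.{0} where
  Arr := Γ.SFTArr
  Obj := Γ.PathSpace
  src g := g.1.2.2
  rng g := g.1.1
  unit := SFTArr.unit
  inv := SFTArr.inv
  mul := SFTArr.mul
  src_unit _ := rfl
  rng_unit _ := rfl
  src_inv _ := rfl
  rng_inv _ := rfl
  src_mul _ _ _ := rfl
  rng_mul _ _ _ := rfl
  unit_mul g := Subtype.ext (Prod.ext rfl (Prod.ext (zero_add g.1.2.1) rfl))
  mul_unit g := Subtype.ext (Prod.ext rfl (Prod.ext (add_zero g.1.2.1) rfl))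
  inv_mul g := Subtype.ext (Prod.ext rfl (Prod.ext (neg_add_cancel g.1.2.1) rfl))
  mul_inv g := Subtype.ext (Prod.ext rfl (Prod.ext (add_neg_cancel g.1.2.1) rfl))
  mul_assoc f g h _ _ :=
    Subtype.ext (Prod.ext rfl (Prod.ext (add_assoc f.1.2.1 g.1.2.1 h.1.2.1) rfl))
  continuous_unit := SFTArr.continuous_unit
  continuous_inv := SFTArr.continuous_inv
  continuous_mul := SFTArr.continuous_mul
  isLocalHomeomorph_rng := SFTArr.isLocalHomeomorph_fst

instance : CompactSpace Γ.sftGroupoid.Obj := inferInstanceAs (CompactSpace Γ.PathSpace)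

end FiniteDigraph

/-- The product of the groupoids of the shifts of finite type given by the graphs `Γ i`. -/
abbrev sftProduct {n : ℕ} (Γ : Fin n → FiniteDigraph) : EtaleGroupoid.{0} :=
  EtaleGroupoid.pi fun i => (Γ i).sftGroupoid

/-- A Cantor set: a nonempty compact metrizable totally disconnected space without isolated
points. -/
class IsCantorSet (X : Type*) [TopologicalSpace X] : Prop extends CompactSpace X,
    TopologicalSpace.MetrizableSpace X, TotallyDisconnectedSpace X, PerfectSpace X where
  nonempty : Nonempty X

/-! ### The higher dimensional Thompson group `nV_{2,1}` -/

/-- The concatenation of a finite binary word and an infinite binary word. -/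
def prependWord (w : List Bool) (x : ℕ → Bool) : ℕ → Bool :=
  fun m => if h : m < w.length then w[m] else x (m - w.length)

theorem prependWord_append (w w' : List Bool) (x : ℕ → Bool) :
    prependWord (w ++ w') x = prependWord w (prependWord w' x) := by
  funext m
  unfold prependWord
  by_cases h : m < w.length
  · rw [dif_pos (by rw [List.length_append]; omega), dif_pos h, List.getElem_append_left h]
  · rw [dif_neg h]
    by_cases h' : m - w.length < w'.length
    · rw [dif_pos (by rw [List.length_append]; omega), dif_pos h',
        List.getElem_append_right (by omega)]
    · rw [dif_neg (by rw [List.length_append]; omega), dif_neg h', List.length_append]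
      congr 1
      omega

theorem prependWord_injective (w : List Bool) : Function.Injective (prependWord w) := by
  intro x y h
  funext m
  have := congrFun h (m + w.length)
  simpa [prependWord] using this

theorem exists_append_of_prependWord_eq {w w' : List Bool} {x x' : ℕ → Bool}
    (h : prependWord w x = prependWord w' x') (hl : w.length ≤ w'.length) :
    ∃ a, w' = w ++ a := by
  refine ⟨w'.drop w.length, List.ext_getElem ?_ ?_⟩
  · simp [hl]
  · intro m h1 h2
    by_cases hm : m < w.length
    · rw [List.getElem_append_left hm]
      have := congrFun h m
      simpa [prependWord, hm, h1] using this.symm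
    · rw [List.getElem_append_right (by omega)]
      simp only [List.getElem_drop]
      congr 1
      omega

/-- The canonical affine map of the `n`-dimensional Cantor cube onto the dyadic brick of the
points whose `i`-th coordinate starts with the word `u i`, for all `i`. -/
def brickMap {n : ℕ} (u : Fin n → List Bool) (x : Fin n → ℕ → Bool) : Fin n → ℕ → Bool :=
  fun i => prependWord (u i) (x i)

theorem brickMap_append {n : ℕ} (u a : Fin n → List Bool) (x : Fin n → ℕ → Bool) :
    brickMap (fun i => u i ++ a i) x = brickMap u (brickMap a x) :=
  funext fun _ => prependWord_append _ _ _

/-- Two intersecting bricks intersect in a brick. -/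
theorem exists_brick_inter {n : ℕ} {u v : Fin n → List Bool}
    (h : (Set.range (brickMap u) ∩ Set.range (brickMap v)).Nonempty) :
    ∃ a b : Fin n → List Bool, (∀ i, u i ++ a i = v i ++ b i) ∧
      Set.range (brickMap fun i => u i ++ a i) =
        Set.range (brickMap u) ∩ Set.range (brickMap v) := by
  obtain ⟨_, ⟨x, rfl⟩, ⟨y, hy⟩⟩ := h
  have key : ∀ i, ∃ a b : List Bool, u i ++ a = v i ++ b ∧ (a = [] ∨ b = []) := by
    intro i
    have hi : prependWord (v i) (y i) = prependWord (u i) (x i) := congrFun hy i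
    rcases le_total (u i).length (v i).length with hl | hl
    · obtain ⟨a, ha⟩ := exists_append_of_prependWord_eq hi.symm hl
      exact ⟨a, [], by simp [ha], Or.inr rfl⟩
    · obtain ⟨b, hb⟩ := exists_append_of_prependWord_eq hi hl
      exact ⟨[], b, by simp [hb], Or.inl rfl⟩
  choose a b hab hnil using key
  refine ⟨a, b, hab, Set.Subset.antisymm ?_ ?_⟩
  · rintro _ ⟨z, rfl⟩
    refine ⟨⟨brickMap a z, (brickMap_append u a z).symm⟩, brickMap b z, ?_⟩
    rw [← brickMap_append]
    exact congrArg (fun w => brickMap w z) (funext fun i => (hab i).symm)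
  · rintro _ ⟨⟨z, rfl⟩, z', hz'⟩
    refine ⟨fun i => if a i = [] then z i else z' i, funext fun i => ?_⟩
    change prependWord (u i ++ a i) (if a i = [] then z i else z' i) = prependWord (u i) (z i)
    by_cases ha : a i = []
    · rw [if_pos ha, ha, List.append_nil]
    · have hb : b i = [] := (hnil i).resolve_left ha
      rw [if_neg ha, hab i, hb, List.append_nil]
      exact congrFun hz' i

/-- The dyadic bricks given by the words `u j` form a partition of the `n`-dimensional Cantor
cube. -/
def IsBrickPartition {n : ℕ} {J : Type} (u : J → Fin n → List Bool) : Prop :=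
  ∀ x, ∃! j, x ∈ Set.range (brickMap (u j))

/-- The higher dimensional Thompson group `nV_{2,1}`: the homeomorphisms of the `n`-dimensional
Cantor cube that map, for some pair of finite partitions into the same number of dyadic bricks,
each brick of the first one canonically onto a brick of the second one. -/
def brinThompson (n : ℕ) : Subgroup ((Fin n → ℕ → Bool) ≃ₜ (Fin n → ℕ → Bool)) where
  carrier := {f | ∃ (J : Type) (_ : Finite J) (u v : J → Fin n → List Bool),
    IsBrickPartition u ∧ IsBrickPartition v ∧ ∀ j y, f (brickMap (u j) y) = brickMap (v j) y}
  one_mem' := by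
    have hnil : ∀ x : ℕ → Bool, prependWord [] x = x := fun x => rfl
    have h : IsBrickPartition fun (_ : Unit) (_ : Fin n) => ([] : List Bool) :=
      fun x => ⟨(), ⟨x, rfl⟩, fun _ _ => rfl⟩
    exact ⟨Unit, inferInstance, _, _, h, h, fun _ _ => rfl⟩
  inv_mem' := by
    rintro f ⟨J, hJ, u, v, hu, hv, h⟩
    exact ⟨J, hJ, v, u, hv, hu, fun j y => by rw [← h]; exact f.symm_apply_apply _⟩
  mul_mem' := by
    rintro f g ⟨J', hJ', u', v', hu', hv', hf⟩ ⟨J, hJ, u, v, hu, hv, hg⟩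
    let I := {p : J × J' //
      (Set.range (brickMap (v p.1)) ∩ Set.range (brickMap (u' p.2))).Nonempty}
    choose a b hab hrange using fun p : I => exists_brick_inter p.2
    have hact : ∀ (p : I) y, (f * g) (brickMap (fun i => u p.1.1 i ++ a p i) y) =
        brickMap (fun i => v' p.1.2 i ++ b p i) y := by
      intro p y
      change f (g _) = _
      rw [brickMap_append, hg, ← brickMap_append,
        show (fun i => v p.1.1 i ++ a p i) = fun i => u' p.1.2 i ++ b p i from funext (hab p),
        brickMap_append, hf, ← brickMap_append]
    have hact' : ∀ (p : I) y, g (brickMap (fun i => u p.1.1 i ++ a p i) y) =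
        brickMap (fun i => v p.1.1 i ++ a p i) y := by
      intro p y
      rw [brickMap_append, hg, ← brickMap_append]
    have hmem : ∀ (p : I) x, x ∈ Set.range (brickMap fun i => u p.1.1 i ++ a p i) ↔
        g x ∈ Set.range (brickMap (v p.1.1)) ∧ g x ∈ Set.range (brickMap (u' p.1.2)) := by
      intro p x
      rw [← Set.mem_inter_iff, ← hrange]
      constructor
      · rintro ⟨y, rfl⟩
        exact ⟨y, (hact' p y).symm⟩
      · rintro ⟨y, hy⟩
        exact ⟨y, g.injective (by rw [hact' p y]; exact hy)⟩
    have h1 : IsBrickPartition fun (p : I) i => u p.1.1 i ++ a p i := by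
      intro x
      obtain ⟨j, hj, hju⟩ := hv (g x)
      obtain ⟨j', hj', hju'⟩ := hu' (g x)
      refine ⟨⟨(j, j'), g x, hj, hj'⟩, (hmem _ _).mpr ⟨hj, hj'⟩, ?_⟩
      rintro p hp
      obtain ⟨e1, e2⟩ := (hmem p x).mp hp
      exact Subtype.ext (Prod.ext (hju _ e1) (hju' _ e2))
    have hmem' : ∀ (p : I) x, x ∈ Set.range (brickMap fun i => v' p.1.2 i ++ b p i) ↔
        (f * g).symm x ∈ Set.range (brickMap fun i => u p.1.1 i ++ a p i) := by
      intro p x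
      constructor
      · rintro ⟨y, rfl⟩
        exact ⟨y, by rw [← hact p y]; exact ((f * g).symm_apply_apply _).symm⟩
      · rintro ⟨y, hy⟩
        refine ⟨y, ?_⟩
        rw [← hact p y, hy]
        exact (f * g).apply_symm_apply x
    refine ⟨I, inferInstance, _, _, h1, fun x => ?_, hact⟩
    simp only [hmem']
    exact h1 _

/-! Part (I), one factor. Cut the Cantor set `(H i).Obj` into nonempty clopen sets `D v` whose class
is the image under `φ i` of the class of the paths starting at the vertex `v`, and cut each `D v`
into nonempty clopen sets `R e`, over the edges `e` leaving `v`, with classes given by the paths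
starting with `e`. In the homology of the shift groupoid the paths starting with `e` have the same
class as the paths starting at the end of `e` (`cls_edgeCyl`), so `R e` and `D (ter e)` have equal
classes. In a minimal purely infinite groupoid, nonempty clopen sets of equal class are source and
range of a compact open bisection (`exists_bisection_of_cls_eq`, from the cancellation law
`equidec_cancel`). The resulting bisections from `D (ter e)` to `R e` define a map `T` on the unit
space and a continuous surjection `p` onto the path space that carries `T` to the shift
(`exists_shiftAction`). An arrow `(x, k - l, y)` then lifts to each point over `y`: go forward `l`
steps and back `k` steps along these bisections. So the shift groupoid acts on `(H i).Obj`, and the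
action groupoid maps to `H i` by a homomorphism that is the identity on units. This is the structure
`Corr`; it is stable under finite products and sends compact open bisections to compact open
bisections (`isBisection_image`).

The assignment of `1_{image U}` to `1_U` extends to the reduced algebras because the shift groupoids
are amenable: orbit segments of the shift are Følner sets (`folner`). They give isometries from
`ℓ²(H)` to `ℓ²(H) ⊗ ℓ²(G)` that asymptotically intertwine the image of `f` with `1 ⊗ λ(f)`
(`tendsto_defect_transfer`). Hence the image of `f` has norm at most that of `λ(f)`, and the closed
⋆-algebra generated by the pairs is the graph of a ⋆-homomorphism (`exists_starAlgHom`).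

On `H₀` the construction is `[f] ↦ [f ∘ p]`. For one factor this is `φ i`, since a homomorphism on
the homology of a shift groupoid is determined on cylinders of length one (`H0_hom_ext`). For the
product it follows from the Künneth isomorphism `kunneth`, which comes from identifying functions on
a product with a tensor product and from generating the boundaries by boxes of bisections. The
embedding of full groups sends `θ(U)` to `θ(image U)`. It is well defined because the shift
groupoids are essentially principal, so that `θ(U)` determines `U`, and it is injective because `p`
is onto.

Part (II) is direct. Complete prefix codes for the edges leaving each vertex identify the path space
with `{0,1}^ℕ` in such a way that paths with a common initial segment become a dyadic interval
(`exists_coding`). Elements of the full group replace initial segments locally, so after conjugation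
they replace binary prefixes locally, and compactness puts them into the Thompson group
(`mem_brinThompson`). -/

namespace EtaleGroupoid

/-! ### The product of arrows as a total operation -/

section Algebra

variable {G : EtaleGroupoid.{u}}

attribute [simp] src_unit rng_unit src_inv rng_inv inv_inv

open Classical in
/-- The product of two arrows, with junk value `g` if they are not composable. -/
noncomputable def gmul (g h : G.Arr) : G.Arr :=
  if H : G.src g = G.rng h then G.mul g h H else g

/-- The product of two arrows. -/
notation:70 g:70 "⬝" h:71 => EtaleGroupoid.gmul g h

theorem gmul_eq {g h : G.Arr} (H : G.src g = G.rng h) : g ⬝ h = G.mul g h H := dif_pos H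

@[simp] theorem rng_gmul (g h : G.Arr) : G.rng (g ⬝ h) = G.rng g := by
  unfold gmul
  split_ifs with H
  · exact G.rng_mul _ _ _
  · rfl

theorem src_gmul {g h : G.Arr} (H : G.src g = G.rng h) : G.src (g ⬝ h) = G.src h := by
  rw [gmul_eq H, G.src_mul]

theorem gmul_assoc {g h k : G.Arr} (H : G.src g = G.rng h) (H' : G.src h = G.rng k) :
    g ⬝ h ⬝ k = g ⬝ (h ⬝ k) := by
  rw [gmul_eq ((src_gmul H).trans H'), gmul_eq (H.trans (rng_gmul h k).symm),
    mul_congr (gmul_eq H) rfl, G.mul_assoc _ _ _ H H']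
  exact (mul_congr rfl (gmul_eq H') _).symm

theorem unit_gmul {x : G.Obj} {g : G.Arr} (hx : G.rng g = x) : G.unit x ⬝ g = g := by
  subst hx
  rw [gmul_eq (G.src_unit _), G.unit_mul]

theorem gmul_unit {x : G.Obj} {g : G.Arr} (hx : G.src g = x) : g ⬝ G.unit x = g := by
  subst hx
  rw [gmul_eq (G.rng_unit _).symm, G.mul_unit]

theorem inv_gmul_self (g : G.Arr) : G.inv g ⬝ g = G.unit (G.src g) := by
  rw [gmul_eq (G.src_inv g), G.inv_mul]

theorem gmul_inv_self (g : G.Arr) : g ⬝ G.inv g = G.unit (G.rng g) := by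
  rw [gmul_eq (G.rng_inv g).symm, G.mul_inv]

theorem gmul_inv_gmul {g h : G.Arr} (H : G.rng g = G.rng h) : g ⬝ (G.inv g ⬝ h) = h := by
  rw [← gmul_assoc (by simp) (by simpa), gmul_inv_self, unit_gmul H.symm]

theorem inv_gmul_gmul {g h : G.Arr} (H : G.src g = G.rng h) : G.inv g ⬝ (g ⬝ h) = h := by
  rw [← gmul_assoc (by simp) H, inv_gmul_self, unit_gmul H.symm]

theorem gmul_gmul_inv {g h : G.Arr} (H : G.src g = G.rng h) : g ⬝ h ⬝ G.inv h = g := by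
  rw [gmul_assoc H (by simp), gmul_inv_self, gmul_unit H]

theorem gmul_inv_gmul' {g h : G.Arr} (H : G.src g = G.src h) : g ⬝ G.inv h ⬝ h = g := by
  rw [gmul_assoc (by simpa) (by simp), inv_gmul_self, gmul_unit H]

theorem gmul_left_cancel {g h h' : G.Arr} (H : G.src g = G.rng h) (H' : G.src g = G.rng h')
    (e : g ⬝ h = g ⬝ h') : h = h' := by
  rw [← inv_gmul_gmul H, e, inv_gmul_gmul H']

theorem inv_gmul {g h : G.Arr} (H : G.src g = G.rng h) :
    G.inv (g ⬝ h) = G.inv h ⬝ G.inv g := by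
  have h1 : G.src (G.inv h) = G.rng (G.inv g) := by simp [H]
  refine gmul_left_cancel (g := g ⬝ h) (by simp) (by simp [src_gmul H]) ?_
  rw [gmul_inv_self, ← gmul_assoc (by simp [src_gmul H]) h1, gmul_gmul_inv H, gmul_inv_self,
    rng_gmul]

theorem inv_unit (x : G.Obj) : G.inv (G.unit x) = G.unit x := by
  have := inv_gmul_self (G.unit x)
  rwa [gmul_unit (by simp), src_unit] at this

theorem _root_.Continuous.gmul {Z : Type*} [TopologicalSpace Z] {a b : Z → G.Arr}
    (ha : Continuous a) (hb : Continuous b) (H : ∀ z, G.src (a z) = G.rng (b z)) :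
    Continuous fun z => a z ⬝ b z := by
  have : (fun z => a z ⬝ b z) = (fun p : {p : G.Arr × G.Arr // G.src p.1 = G.rng p.2} =>
      G.mul p.1.1 p.1.2 p.2) ∘ fun z => ⟨(a z, b z), H z⟩ := funext fun z => gmul_eq (H z)
  rw [this]
  exact G.continuous_mul.comp ((ha.prodMk hb).subtype_mk _)

theorem inv_injective : Function.Injective G.inv :=
  Function.LeftInverse.injective (g := G.inv) inv_inv

end Algebra

/-! ### Compact open bisections -/

section Bisection

variable {G : EtaleGroupoid.{u}}

/-- Compact open bisections. -/
structure IsBisection (U : Set G.Arr) : Prop where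
  isCompact : IsCompact U
  isOpen : IsOpen U
  rng_injOn : InjOn G.rng U
  src_injOn : InjOn G.src U

namespace IsBisection

variable {U V : Set G.Arr}

theorem isGSet (hU : IsBisection U) : G.IsGSet U := ⟨hU.rng_injOn, hU.src_injOn⟩

/-- A bisection as a bundled compact open set. -/
def toCompactOpens (hU : IsBisection U) : TopologicalSpace.CompactOpens G.Arr :=
  ⟨⟨U, hU.isCompact⟩, hU.isOpen⟩

theorem of_compactOpens (U : TopologicalSpace.CompactOpens G.Arr) (hU : G.IsGSet U) :
    IsBisection (U : Set G.Arr) := ⟨U.isCompact, U.isOpen, hU.1, hU.2⟩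

theorem isClopen (hU : IsBisection U) : IsClopen U := ⟨hU.isCompact.isClosed, hU.isOpen⟩

theorem isClopen_src (hU : IsBisection U) : IsClopen (G.src '' U) :=
  ⟨(hU.isCompact.image G.continuous_src).isClosed,
    G.isLocalHomeomorph_src.isOpenMap _ hU.isOpen⟩

theorem isClopen_rng (hU : IsBisection U) : IsClopen (G.rng '' U) :=
  ⟨(hU.isCompact.image G.continuous_rng).isClosed,
    G.isLocalHomeomorph_rng.isOpenMap _ hU.isOpen⟩

theorem subset (hU : IsBisection U) (hV : IsClopen V) (hVU : V ⊆ U) : IsBisection V :=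
  ⟨hU.isCompact.of_isClosed_subset hV.isClosed hVU, hV.isOpen, hU.rng_injOn.mono hVU,
    hU.src_injOn.mono hVU⟩

protected theorem empty : IsBisection (∅ : Set G.Arr) :=
  ⟨isCompact_empty, isOpen_empty, injOn_empty _, injOn_empty _⟩

theorem inter (hU : IsBisection U) (hV : IsBisection V) : IsBisection (U ∩ V) :=
  hU.subset (hU.isClopen.inter hV.isClopen) inter_subset_left

theorem inter_src (hU : IsBisection U) {C : Set G.Obj} (hC : IsClopen C) :
    IsBisection (U ∩ G.src ⁻¹' C) :=
  hU.subset (hU.isClopen.inter (hC.preimage G.continuous_src)) inter_subset_left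

theorem inter_rng (hU : IsBisection U) {C : Set G.Obj} (hC : IsClopen C) :
    IsBisection (U ∩ G.rng ⁻¹' C) :=
  hU.subset (hU.isClopen.inter (hC.preimage G.continuous_rng)) inter_subset_left

theorem image_unit {C : Set G.Obj} (hc : IsCompact C) (ho : IsOpen C) :
    IsBisection (G.unit '' C) where
  isCompact := hc.image G.continuous_unit
  isOpen := G.isOpenMap_unit _ ho
  rng_injOn := by
    rintro _ ⟨x, -, rfl⟩ _ ⟨y, -, rfl⟩ h
    simp only [rng_unit] at h
    rw [h]
  src_injOn := by
    rintro _ ⟨x, -, rfl⟩ _ ⟨y, -, rfl⟩ h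
    simp only [src_unit] at h
    rw [h]

theorem preimage_inv (hU : IsBisection U) : IsBisection (G.inv ⁻¹' U) where
  isCompact := by
    have : G.inv ⁻¹' U = G.inv '' U := by
      ext g
      exact ⟨fun h => ⟨_, h, inv_inv g⟩, by rintro ⟨h, hh, rfl⟩; simpa using hh⟩
    rw [this]
    exact hU.isCompact.image G.continuous_inv
  isOpen := hU.isOpen.preimage G.continuous_inv
  rng_injOn := fun g hg h hh e => inv_injective (hU.src_injOn hg hh (by simpa))
  src_injOn := fun g hg h hh e => inv_injective (hU.rng_injOn hg hh (by simpa))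

theorem union (hU : IsBisection U) (hV : IsBisection V)
    (hs : Disjoint (G.src '' U) (G.src '' V)) (hr : Disjoint (G.rng '' U) (G.rng '' V)) :
    IsBisection (U ∪ V) where
  isCompact := hU.isCompact.union hV.isCompact
  isOpen := hU.isOpen.union hV.isOpen
  rng_injOn := by
    refine (injOn_union ?_).mpr ⟨hU.rng_injOn, hV.rng_injOn, fun a ha b hb e => ?_⟩
    · exact Set.disjoint_left.mpr fun g hg hg' =>
        Set.disjoint_left.mp hr ⟨g, hg, rfl⟩ ⟨g, hg', rfl⟩
    · exact Set.disjoint_left.mp hr ⟨a, ha, rfl⟩ ⟨b, hb, e.symm⟩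
  src_injOn := by
    refine (injOn_union ?_).mpr ⟨hU.src_injOn, hV.src_injOn, fun a ha b hb e => ?_⟩
    · exact Set.disjoint_left.mpr fun g hg hg' =>
        Set.disjoint_left.mp hs ⟨g, hg, rfl⟩ ⟨g, hg', rfl⟩
    · exact Set.disjoint_left.mp hs ⟨a, ha, rfl⟩ ⟨b, hb, e.symm⟩

end IsBisection

@[simp] theorem src_image_preimage_inv (U : Set G.Arr) :
    G.src '' (G.inv ⁻¹' U) = G.rng '' U := by
  ext x
  constructor
  · rintro ⟨g, hg, rfl⟩
    exact ⟨_, hg, G.rng_inv g⟩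
  · rintro ⟨g, hg, rfl⟩
    exact ⟨G.inv g, by simpa using hg, G.src_inv g⟩

@[simp] theorem rng_image_preimage_inv (U : Set G.Arr) :
    G.rng '' (G.inv ⁻¹' U) = G.src '' U := by
  ext x
  constructor
  · rintro ⟨g, hg, rfl⟩
    exact ⟨_, hg, G.src_inv g⟩
  · rintro ⟨g, hg, rfl⟩
    exact ⟨G.inv g, by simpa using hg, G.rng_inv g⟩

@[simp] theorem src_image_unit (C : Set G.Obj) : G.src '' (G.unit '' C) = C := by
  rw [image_image]
  simp

@[simp] theorem rng_image_unit (C : Set G.Obj) : G.rng '' (G.unit '' C) = C := by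
  rw [image_image]
  simp

/-- The product of two sets of arrows. -/
def setMul (U V : Set G.Arr) : Set G.Arr :=
  {k | ∃ g ∈ U, ∃ h ∈ V, G.src g = G.rng h ∧ k = g ⬝ h}

theorem isOpen_setMul {U V : Set G.Arr} (hU : IsOpen U) (hV : IsOpen V) :
    IsOpen (setMul U V) := by
  have : setMul U V = (fun p : {p : G.Arr × G.Arr // G.src p.1 = G.rng p.2} =>
      G.mul p.1.1 p.1.2 p.2) '' (Subtype.val ⁻¹' (U ×ˢ V)) := by
    ext k
    constructor
    · rintro ⟨g, hg, h, hh, H, rfl⟩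
      exact ⟨⟨(g, h), H⟩, ⟨hg, hh⟩, (gmul_eq H).symm⟩
    · rintro ⟨⟨⟨g, h⟩, H⟩, ⟨hg, hh⟩, rfl⟩
      exact ⟨g, hg, h, hh, H, (gmul_eq H).symm⟩
  rw [this]
  exact G.isLocalHomeomorph_mul.isOpenMap _ ((hU.prod hV).preimage continuous_subtype_val)

theorem isCompact_setMul {U V : Set G.Arr} (hU : IsCompact U) (hV : IsCompact V) :
    IsCompact (setMul U V) := by
  have : setMul U V = (fun p : {p : G.Arr × G.Arr // G.src p.1 = G.rng p.2} =>
      G.mul p.1.1 p.1.2 p.2) '' (Subtype.val ⁻¹' (U ×ˢ V)) := by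
    ext k
    constructor
    · rintro ⟨g, hg, h, hh, H, rfl⟩
      exact ⟨⟨(g, h), H⟩, ⟨hg, hh⟩, (gmul_eq H).symm⟩
    · rintro ⟨⟨⟨g, h⟩, H⟩, ⟨hg, hh⟩, rfl⟩
      exact ⟨g, hg, h, hh, H, (gmul_eq H).symm⟩
  rw [this]
  have hcl : IsClosed {p : G.Arr × G.Arr | G.src p.1 = G.rng p.2} :=
    isClosed_eq (G.continuous_src.comp continuous_fst) (G.continuous_rng.comp continuous_snd)
  exact (hcl.isClosedEmbedding_subtypeVal.isCompact_preimage (hU.prod hV)).image G.continuous_mul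

theorem IsBisection.setMul {U V : Set G.Arr} (hU : IsBisection U) (hV : IsBisection V) :
    IsBisection (setMul U V) where
  isCompact := isCompact_setMul hU.isCompact hV.isCompact
  isOpen := isOpen_setMul hU.isOpen hV.isOpen
  rng_injOn := by
    rintro _ ⟨g, hg, h, hh, H, rfl⟩ _ ⟨g', hg', h', hh', H', rfl⟩ e
    simp only [rng_gmul] at e
    obtain rfl := hU.rng_injOn hg hg' e
    rw [hV.rng_injOn hh hh' (H.symm.trans H')]
  src_injOn := by
    rintro _ ⟨g, hg, h, hh, H, rfl⟩ _ ⟨g', hg', h', hh', H', rfl⟩ e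
    rw [src_gmul H, src_gmul H'] at e
    obtain rfl := hV.src_injOn hh hh' e
    rw [hU.src_injOn hg hg' (H.trans H'.symm)]

theorem src_image_setMul {U V : Set G.Arr} :
    G.src '' (setMul U V) = G.src '' (V ∩ G.rng ⁻¹' (G.src '' U)) := by
  ext x
  constructor
  · rintro ⟨_, ⟨g, hg, h, hh, H, rfl⟩, rfl⟩
    exact ⟨h, ⟨hh, g, hg, H⟩, (src_gmul H).symm⟩
  · rintro ⟨h, ⟨hh, g, hg, H⟩, rfl⟩
    exact ⟨_, ⟨g, hg, h, hh, H, rfl⟩, src_gmul H⟩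

theorem rng_image_setMul {U V : Set G.Arr} :
    G.rng '' (setMul U V) = G.rng '' (U ∩ G.src ⁻¹' (G.rng '' V)) := by
  ext x
  constructor
  · rintro ⟨_, ⟨g, hg, h, hh, H, rfl⟩, rfl⟩
    exact ⟨g, ⟨hg, h, hh, H.symm⟩, (rng_gmul _ _).symm⟩
  · rintro ⟨g, ⟨hg, h, hh, H⟩, rfl⟩
    exact ⟨_, ⟨g, hg, h, hh, H.symm, rfl⟩, rng_gmul _ _⟩

/-! ### Ampleness -/

/-- The range map is constant on a connected set of arrows. Being locally injective, it then forces
the identity of that set to be constant as well. -/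
instance [TotallyDisconnectedSpace G.Obj] : TotallyDisconnectedSpace G.Arr := by
  refine ⟨fun C _ hC g hg h hh => ?_⟩
  have h1 : (G.rng '' C).Subsingleton :=
    (hC.image G.rng G.continuous_rng.continuousOn).subsingleton
  exact IsSeparatedMap.constOn_of_comp (p := G.rng) (g := id)
    (T2Space.isSeparatedMap _) G.isLocalHomeomorph_rng.isLocallyInjective hC continuousOn_id
    (fun a ha b hb => h1 ⟨a, ha, rfl⟩ ⟨b, hb, rfl⟩) hg hh

/-- Range and source are both injective near any arrow, and a locally compact totally disconnected
Hausdorff space has a basis of clopen sets. A clopen set inside a small compact neighbourhood does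
the job. -/
theorem exists_bisection_subset [TotallyDisconnectedSpace G.Obj] {O : Set G.Arr}
    (hO : IsOpen O) {g : G.Arr} (hg : g ∈ O) : ∃ U, IsBisection U ∧ g ∈ U ∧ U ⊆ O := by
  obtain ⟨A, hA, hgA, hA'⟩ := G.isLocalHomeomorph_rng.exists_injOn g
  obtain ⟨B, hB, hgB, hB'⟩ := G.isLocalHomeomorph_src.exists_injOn g
  obtain ⟨K, hK, hgK, hKs⟩ := exists_compact_subset ((hO.inter hA).inter hB) ⟨⟨hg, hgA⟩, hgB⟩
  obtain ⟨W, hW, hgW, hWs⟩ := loc_compact_Haus_tot_disc_of_zero_dim.exists_subset_of_mem_open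
    hgK isOpen_interior
  have hWK : W ⊆ K := hWs.trans interior_subset
  exact ⟨W, ⟨hK.of_isClosed_subset hW.isClosed hWK, hW.isOpen,
    hA'.mono fun x hx => (hKs (hWK hx)).1.2, hB'.mono fun x hx => (hKs (hWK hx)).2⟩, hgW,
    fun x hx => (hKs (hWK hx)).1.1⟩

theorem isTopologicalBasis_bisection [TotallyDisconnectedSpace G.Obj] :
    TopologicalSpace.IsTopologicalBasis {U : Set G.Arr | IsBisection U} :=
  TopologicalSpace.isTopologicalBasis_of_isOpen_of_nhds (fun _ hU => hU.isOpen)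
    fun _ _ hg hO => by
      obtain ⟨U, h1, h2, h3⟩ := exists_bisection_subset hO hg
      exact ⟨U, h1, h2, h3⟩

end Bisection

end EtaleGroupoid

/-! ### Integer valued functions on totally disconnected spaces -/

section Chi

variable {Y : Type*} [TopologicalSpace Y]

theorem isOpen_fiber {Z : Type*} [TopologicalSpace Z] [DiscreteTopology Z] {f : Y → Z}
    (hf : Continuous f) (k : Z) : IsOpen {y | f y = k} :=
  (isOpen_discrete {k}).preimage hf

theorem isClopen_fiber {Z : Type*} [TopologicalSpace Z] [DiscreteTopology Z] {f : Y → Z}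
    (hf : Continuous f) (k : Z) : IsClopen {y | f y = k} :=
  (isClopen_discrete {k}).preimage hf

theorem finite_range (f : C_c(Y, ℤ)) : (Set.range f).Finite := by
  have h1 : (f '' tsupport f).Finite :=
    (f.hasCompactSupport.isCompact.image f.continuous).finite_of_discrete
  refine (h1.insert 0).subset ?_
  rintro _ ⟨y, rfl⟩
  by_cases h : f y = 0
  · exact Or.inl h
  · exact Or.inr ⟨y, subset_tsupport _ h, rfl⟩

theorem isCompact_fiber (f : C_c(Y, ℤ)) {k : ℤ} (hk : k ≠ 0) : IsCompact {y | f y = k} := by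
  refine f.hasCompactSupport.of_isClosed_subset (isClopen_fiber f.continuous k).isClosed ?_
  intro y hy
  exact subset_tsupport _ (by rw [Function.mem_support, show f y = k from hy]; exact hk)

variable [T2Space Y]

open Classical in
/-- The characteristic function of `A` if `A` is compact and open, and zero otherwise. -/
noncomputable def chi (A : Set Y) : C_c(Y, ℤ) :=
  if h : IsCompact A ∧ IsOpen A then charFn ℤ ⟨⟨A, h.1⟩, h.2⟩ else 0

theorem chi_eq {A : Set Y} (hc : IsCompact A) (ho : IsOpen A) :
    chi A = charFn ℤ ⟨⟨A, hc⟩, ho⟩ := dif_pos ⟨hc, ho⟩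

theorem charFn_eq_chi (A : TopologicalSpace.CompactOpens Y) : charFn ℤ A = chi (A : Set Y) :=
  (chi_eq A.isCompact A.isOpen).symm

theorem coe_chi {A : Set Y} (hc : IsCompact A) (ho : IsOpen A) :
    (chi A : Y → ℤ) = A.indicator 1 := by
  rw [chi_eq hc ho]
  rfl

theorem chi_coe {A : Set Y} [CompactSpace Y] (hA : IsClopen A) :
    (chi A : Y → ℤ) = A.indicator 1 := coe_chi hA.isClosed.isCompact hA.isOpen

@[simp] theorem chi_empty : chi (∅ : Set Y) = 0 := by
  ext y
  rw [coe_chi isCompact_empty isOpen_empty]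
  simp

theorem chi_union {A B : Set Y} [CompactSpace Y] (hA : IsClopen A) (hB : IsClopen B)
    (hAB : Disjoint A B) : chi (A ∪ B) = chi A + chi B := by
  ext y
  rw [CompactlySupportedContinuousMap.add_apply, chi_coe (hA.union hB), chi_coe hA, chi_coe hB,
    Set.indicator_union_of_disjoint hAB]

theorem chi_diff {A B : Set Y} [CompactSpace Y] (hA : IsClopen A) (hB : IsClopen B)
    (hBA : B ⊆ A) : chi (A \ B) = chi A - chi B := by
  rw [eq_sub_iff_add_eq, ← chi_union (hA.diff hB) hB disjoint_sdiff_left,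
    sdiff_union_of_subset hBA]

/-- The value `0` is left out because its level set need not be compact. All other level sets are
compact open, so `chi` is their genuine characteristic function. -/
theorem eq_sum_chi (f : C_c(Y, ℤ)) :
    f = ∑ k ∈ (finite_range f).toFinset.erase 0, k • chi {y | f y = k} := by
  ext y
  rw [CompactlySupportedContinuousMap.sum_apply]
  simp only [CompactlySupportedContinuousMap.smul_apply, smul_eq_mul]
  rw [Finset.sum_congr rfl (g := fun k => if k = f y then k else 0)]
  · rw [Finset.sum_ite_eq']
    split_ifs with h
    · rfl
    · by_contra h0
      exact h (by simp [h0])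
  · intro k hk
    rw [coe_chi (isCompact_fiber f (Finset.ne_of_mem_erase hk)) (isOpen_fiber f.continuous k)]
    by_cases h : f y = k
    · simp [h]
    · have h' : ¬ k = f y := fun e => h e.symm
      simp [h, h']

/-- If `𝓑` is a basis of compact open sets that is closed under intersections, then the
characteristic functions of the members of `𝓑` generate `C_c(Y, ℤ)`. -/
theorem closure_chi_eq_top {𝓑 : Set (Set Y)} (hb : TopologicalSpace.IsTopologicalBasis 𝓑)
    (hc : ∀ U ∈ 𝓑, IsCompact U) (hi : ∀ U ∈ 𝓑, ∀ V ∈ 𝓑, U ∩ V ∈ 𝓑) :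
    AddSubgroup.closure (chi '' 𝓑) = ⊤ := by
  have ho : ∀ U ∈ 𝓑, IsOpen U := fun U hU => hb.isOpen hU
  set M := AddSubgroup.closure (chi '' 𝓑) with hM
  -- Stability of `𝓑` under intersections makes `M` stable under multiplication by generators, which
  -- is what inclusion–exclusion needs below.
  have hmul : ∀ U ∈ 𝓑, ∀ f ∈ M, chi U * f ∈ M := by
    intro U hU f hf
    induction hf using AddSubgroup.closure_induction with
    | mem f hf =>
      obtain ⟨V, hV, rfl⟩ := hf
      have : chi U * chi V = chi (U ∩ V) := by
        ext y
        rw [CompactlySupportedContinuousMap.mul_apply, coe_chi (hc U hU) (ho U hU),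
          coe_chi (hc V hV) (ho V hV), coe_chi (hc _ (hi U hU V hV)) (ho _ (hi U hU V hV)),
          Set.inter_indicator_one]
        rfl
      rw [this]
      exact AddSubgroup.subset_closure ⟨_, hi U hU V hV, rfl⟩
    | zero => rw [mul_zero]; exact M.zero_mem
    | add f g _ _ hf hg => rw [mul_add]; exact M.add_mem hf hg
    | neg f _ hf => 
      have : chi U * -f = -(chi U * f) := by
        ext y
        simp
      rw [this]
      exact M.neg_mem hf
  have hunion : ∀ s : Finset (Set Y), (↑s ⊆ 𝓑) → chi (⋃ U ∈ s, U) ∈ M := by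
    classical
    intro s
    induction s using Finset.induction_on with
    | empty => intro; simp [M.zero_mem]
    | insert U s _ ih =>
      intro hs
      have hU : U ∈ 𝓑 := hs (by simp)
      have hs' : ↑s ⊆ 𝓑 := fun V hV => hs (by simp [Finset.mem_coe.mp hV])
      have h1 : IsCompact (⋃ V ∈ s, V) := s.isCompact_biUnion fun V hV => hc V (hs' hV)
      have h2 : IsOpen (⋃ V ∈ s, V) := isOpen_biUnion fun V hV => ho V (hs' hV)
      -- Inclusion–exclusion for a union of two sets.
      have : chi (⋃ V ∈ insert U s, V) =
          chi U + chi (⋃ V ∈ s, V) - chi U * chi (⋃ V ∈ s, V) := by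
        rw [Finset.set_biUnion_insert]
        ext y
        simp only [CompactlySupportedContinuousMap.sub_apply,
          CompactlySupportedContinuousMap.add_apply, CompactlySupportedContinuousMap.mul_apply]
        rw [coe_chi ((hc U hU).union h1) ((ho U hU).union h2), coe_chi (hc U hU) (ho U hU),
          coe_chi h1 h2]
        generalize (⋃ V ∈ s, V) = W
        by_cases a : y ∈ U <;> by_cases b : y ∈ W <;> simp [a, b]
      rw [this]
      have hUM : chi U ∈ M := AddSubgroup.subset_closure ⟨U, hU, rfl⟩
      exact M.sub_mem (M.add_mem hUM (ih hs')) (hmul U hU _ (ih hs'))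
  have hchi : ∀ K : Set Y, IsCompact K → IsOpen K → chi K ∈ M := by
    intro K hK hKo
    obtain ⟨s, hs, hs', hKs⟩ : ∃ s : Set (Set Y), s ⊆ 𝓑 ∧ s.Finite ∧ K = ⋃ U ∈ s, U := by
      obtain ⟨S, hS, hKS⟩ := hb.open_eq_sUnion hKo
      obtain ⟨t, ht, htf, hKt⟩ := hK.elim_finite_subcover_image (b := S) (c := id)
        (fun U hU => ho U (hS hU)) (by rw [hKS, sUnion_eq_biUnion]; rfl)
      refine ⟨t, ht.trans hS, htf, Set.Subset.antisymm hKt ?_⟩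
      rw [hKS]
      exact iUnion₂_subset fun U hU => subset_sUnion_of_mem (ht hU)
    have := hunion hs'.toFinset (by simpa using hs)
    rw [hKs]
    simpa using this
  rw [eq_top_iff]
  intro f _
  rw [eq_sum_chi f]
  refine M.sum_mem fun k hk => M.zsmul_mem (hchi _ ?_ (isOpen_fiber f.continuous k)) k
  exact isCompact_fiber f (Finset.ne_of_mem_erase hk)

theorem closure_chi_clopen [CompactSpace Y] [TotallyDisconnectedSpace Y] :
    AddSubgroup.closure (chi '' {A : Set Y | IsClopen A}) = ⊤ :=
  closure_chi_eq_top isTopologicalBasis_isClopen (fun _ h => h.isClosed.isCompact)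
    fun _ hU _ hV => hU.inter hV

end Chi

/-! ### Refinement of families of clopen sets -/

section Refinement

variable {X : Type*}

open Classical in
theorem sum_indicator_apply {ι : Type*} [Fintype ι] (A : ι → Set X) (x : X) :
    (∑ k, (A k).indicator (1 : X → ℤ)) x = (Finset.univ.filter fun k => x ∈ A k).card := by
  rw [Finset.sum_apply, ← Finset.sum_boole]
  rfl

/-- At each point the sum counts the sets of the family containing it. The count is at most `1`,
whence disjointness, and it is `1` exactly on `B`. -/
theorem sum_indicator_eq {ι : Type*} [Fintype ι] {A : ι → Set X} {B : Set X}
    (h : ∑ k, (A k).indicator (1 : X → ℤ) = B.indicator 1) :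
    (∀ k l x, x ∈ A k → x ∈ A l → k = l) ∧ ⋃ k, A k = B := by
  classical
  have h' := fun x => (sum_indicator_apply A x).symm.trans (congrFun h x)
  constructor
  · intro k l x hk hl
    suffices h1 : (Finset.univ.filter fun k => x ∈ A k).card ≤ 1 from
      Finset.card_le_one.mp h1 k (by simpa using hk) l (by simpa using hl)
    have := h' x
    by_cases hx : x ∈ B
    · rw [indicator_of_mem hx, Pi.one_apply] at this
      exact_mod_cast this.le
    · rw [indicator_of_notMem hx] at this
      have h0 : (Finset.univ.filter fun k => x ∈ A k).card = 0 := by exact_mod_cast this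
      omega
  · ext x
    have := h' x
    rw [mem_iUnion]
    by_cases hx : x ∈ B
    · rw [indicator_of_mem hx, Pi.one_apply] at this
      refine iff_of_true ?_ hx
      have h0 : 0 < (Finset.univ.filter fun k => x ∈ A k).card := by omega
      obtain ⟨k, hk⟩ := Finset.card_pos.mp h0
      exact ⟨k, by simpa using hk⟩
    · rw [indicator_of_notMem hx] at this
      refine iff_of_false ?_ hx
      rintro ⟨k, hk⟩
      have h0 : (Finset.univ.filter fun k => x ∈ A k).card = 0 := by exact_mod_cast this
      rw [Finset.card_eq_zero] at h0
      exact Finset.notMem_empty k (h0 ▸ by simpa using hk)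

theorem sum_indicator_of_disjoint {ι : Type*} [Fintype ι] {A : ι → Set X} {B : Set X}
    (h : ∀ k l x, x ∈ A k → x ∈ A l → k = l) (hB : ⋃ k, A k = B) :
    ∑ k, (A k).indicator (1 : X → ℤ) = B.indicator 1 := by
  classical
  subst hB
  funext x
  rw [Finset.sum_apply]
  by_cases hx : x ∈ ⋃ k, A k
  · rw [indicator_of_mem hx]
    obtain ⟨k, hk⟩ := mem_iUnion.mp hx
    rw [Finset.sum_eq_single k]
    · simp [hk]
    · exact fun l _ hl => indicator_of_notMem (fun hxl => hl (h l k x hxl hk)) _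
    · simp
  · rw [indicator_of_notMem hx]
    exact Finset.sum_eq_zero fun k _ => indicator_of_notMem (fun hk => hx (mem_iUnion.mpr ⟨k, hk⟩)) _

/-- Two finite families of clopen sets with the same sum of characteristic functions have a
common refinement. -/
theorem exists_refinement [TopologicalSpace X] {K L : Type} [Fintype K] [Fintype L]
    {A : K → Set X} {B : L → Set X} (hA : ∀ k, IsClopen (A k)) (hB : ∀ l, IsClopen (B l))
    (h : ∑ k, (A k).indicator (1 : X → ℤ) = ∑ l, (B l).indicator 1) :
    ∃ C : K → L → Set X, (∀ k l, IsClopen (C k l)) ∧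
      (∀ k, (∀ l l' x, x ∈ C k l → x ∈ C k l' → l = l') ∧ ⋃ l, C k l = A k) ∧
      ∀ l, (∀ k k' x, x ∈ C k l → x ∈ C k' l → k = k') ∧ ⋃ k, C k l = B l := by
  classical
  -- The membership pattern of a point. It takes values in a finite discrete space and is
  -- continuous, so anything defined through it is clopen.
  let q : X → (K → Bool) × (L → Bool) :=
    fun x => (fun k => (A k).boolIndicator x, fun l => (B l).boolIndicator x)
  have hq : Continuous q := by
    refine (continuous_pi fun k => ?_).prodMk (continuous_pi fun l => ?_)
    · exact (continuous_boolIndicator_iff_isClopen _).mpr (hA k)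
    · exact (continuous_boolIndicator_iff_isClopen _).mpr (hB l)
  -- At every point equally many sets of both families occur, and a bijection between them is fixed
  -- once for each pattern. The set `C k l` consists of the points where it matches `k` with `l`.
  let e : ∀ (s : K → Bool) (t : L → Bool)
      (_ : Fintype.card {k // s k = true} = Fintype.card {l // t l = true}),
      {k // s k = true} ≃ {l // t l = true} := fun s t => Fintype.equivOfCardEq
  have hcard : ∀ x, Fintype.card {k // (q x).1 k = true} =
      Fintype.card {l // (q x).2 l = true} := by
    intro x
    have h1 := congrFun h x
    rw [sum_indicator_apply, sum_indicator_apply] at h1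
    rw [Fintype.card_subtype, Fintype.card_subtype]
    have h2 : ∀ k, (q x).1 k = true ↔ x ∈ A k := fun k => ((A k).mem_iff_boolIndicator x).symm
    have h3 : ∀ l, (q x).2 l = true ↔ x ∈ B l := fun l => ((B l).mem_iff_boolIndicator x).symm
    simp only [h2, h3]
    exact_mod_cast h1
  have hAx : ∀ k x, x ∈ A k ↔ (q x).1 k = true := fun k x => (A k).mem_iff_boolIndicator x
  have hBx : ∀ l x, x ∈ B l ↔ (q x).2 l = true := fun l x => (B l).mem_iff_boolIndicator x
  refine ⟨fun k l => q ⁻¹' {p | ∃ (hc : _) (hk : p.1 k = true), (e p.1 p.2 hc ⟨k, hk⟩).1 = l},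
    fun k l => (isClopen_discrete _).preimage hq, fun k => ⟨?_, ?_⟩, fun l => ⟨?_, ?_⟩⟩
  · rintro l l' x ⟨hc, hk, rfl⟩ ⟨_, _, rfl⟩
    rfl
  · ext x
    simp only [mem_iUnion, hAx]
    constructor
    · rintro ⟨l, hc, hk, -⟩
      exact hk
    · intro hk
      exact ⟨_, hcard x, hk, rfl⟩
  · rintro k k' x ⟨hc, hk, h1⟩ ⟨_, hk', h2⟩
    have := (e (q x).1 (q x).2 hc).injective (Subtype.ext (h1.trans h2.symm))
    exact congrArg Subtype.val this
  · ext x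
    simp only [mem_iUnion, hBx]
    constructor
    · rintro ⟨k, hc, hk, rfl⟩
      exact (e (q x).1 (q x).2 hc ⟨k, hk⟩).2
    · intro hl
      refine ⟨((e (q x).1 (q x).2 (hcard x)).symm ⟨l, hl⟩).1, hcard x,
        ((e (q x).1 (q x).2 (hcard x)).symm ⟨l, hl⟩).2, ?_⟩
      simp

end Refinement

namespace EtaleGroupoid

variable {G : EtaleGroupoid.{u}}

/-! ### Generators of the boundaries -/

theorem finite_support_fiber {p : G.Arr → G.Obj} (hp : IsLocalHomeomorph p) (f : C_c(G.Arr, ℤ))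
    (y : G.Obj) : (Function.support fun g : p ⁻¹' {y} => f g).Finite := by
  obtain ⟨N, hN⟩ := hp.exists_encard_fiber_le f.hasCompactSupport
  have h1 : (tsupport f ∩ p ⁻¹' {y}).Finite := Set.finite_of_encard_le_coe (hN y)
  refine Set.Finite.of_finite_image (f := Subtype.val) (h1.subset ?_)
    Subtype.val_injective.injOn
  rintro _ ⟨g, hg, rfl⟩
  exact ⟨subset_tsupport _ hg, g.2⟩

theorem finsum_chi {p : G.Arr → G.Obj} {U : Set G.Arr} (hc : IsCompact U) (ho : IsOpen U)
    (hp : InjOn p U) (y : G.Obj) :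
    ∑ᶠ g : p ⁻¹' {y}, (chi U : G.Arr → ℤ) g = (p '' U).indicator 1 y := by
  rw [coe_chi hc ho]
  by_cases hy : y ∈ p '' U
  · rw [indicator_of_mem hy]
    obtain ⟨g, hg, rfl⟩ := hy
    rw [finsum_eq_single _ ⟨g, rfl⟩]
    · simp [hg]
    · rintro ⟨g', hg'⟩ hne
      refine indicator_of_notMem (fun hgU => hne (Subtype.ext (hp hgU hg hg'))) _
  · rw [indicator_of_notMem hy]
    refine finsum_eq_zero_of_forall_eq_zero ?_
    rintro ⟨g, hg⟩
    exact indicator_of_notMem (fun hgU => hy ⟨g, hgU, hg⟩) _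

theorem IsBisection.sub_mem_boundaries {U : Set G.Arr} (hU : IsBisection U) :
    chi (G.src '' U) - chi (G.rng '' U) ∈ G.boundaries := by
  refine ⟨chi U, fun y => ?_⟩
  rw [finsum_chi hU.isCompact hU.isOpen hU.src_injOn, finsum_chi hU.isCompact hU.isOpen
    hU.rng_injOn, CompactlySupportedContinuousMap.sub_apply,
    coe_chi (hU.isCompact.image G.continuous_src) (G.isLocalHomeomorph_src.isOpenMap _ hU.isOpen),
    coe_chi (hU.isCompact.image G.continuous_rng) (G.isLocalHomeomorph_rng.isOpenMap _ hU.isOpen)]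

/-- The boundary map is additive and the characteristic functions of the members of `𝓑` generate its
domain. The choice of basis is left free so that boxes of bisections can be used in a product
groupoid. -/
theorem boundaries_eq_of_basis {𝓑 : Set (Set G.Arr)}
    (hb : TopologicalSpace.IsTopologicalBasis 𝓑) (h𝓑 : ∀ U ∈ 𝓑, IsBisection U)
    (hi : ∀ U ∈ 𝓑, ∀ V ∈ 𝓑, U ∩ V ∈ 𝓑) : G.boundaries =
    AddSubgroup.closure ((fun U => chi (G.src '' U) - chi (G.rng '' U)) '' 𝓑) := by
  refine le_antisymm ?_ ((AddSubgroup.closure_le _).mpr ?_)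
  · set M := AddSubgroup.closure ((fun U => chi (G.src '' U) - chi (G.rng '' U)) '' 𝓑) with hM
    have key : ∀ f : C_c(G.Arr, ℤ), ∃ a ∈ M, ∀ y,
        a y = (∑ᶠ g : G.src ⁻¹' {y}, f g) - ∑ᶠ g : G.rng ⁻¹' {y}, f g := by
      intro f
      have hf : f ∈ AddSubgroup.closure (chi '' 𝓑) := by
        rw [closure_chi_eq_top hb (fun U hU => (h𝓑 U hU).isCompact) hi]
        trivial
      induction hf using AddSubgroup.closure_induction with
      | mem f hf =>
        obtain ⟨U, hU, rfl⟩ := hf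
        refine ⟨_, AddSubgroup.subset_closure ⟨U, hU, rfl⟩, fun y => ?_⟩
        replace hU := h𝓑 U hU
        rw [finsum_chi hU.isCompact hU.isOpen hU.src_injOn, finsum_chi hU.isCompact hU.isOpen
          hU.rng_injOn]
        change chi _ y - chi _ y = _
        rw [coe_chi (hU.isCompact.image G.continuous_src)
            (G.isLocalHomeomorph_src.isOpenMap _ hU.isOpen),
          coe_chi (hU.isCompact.image G.continuous_rng)
            (G.isLocalHomeomorph_rng.isOpenMap _ hU.isOpen)]
      | zero => exact ⟨0, M.zero_mem, fun y => by simp⟩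
      | add f g _ _ hf hg =>
        obtain ⟨a, ha, ha'⟩ := hf
        obtain ⟨b, hb, hb'⟩ := hg
        refine ⟨a + b, M.add_mem ha hb, fun y => ?_⟩
        simp only [CompactlySupportedContinuousMap.add_apply, ha' y, hb' y]
        rw [finsum_add_distrib (finite_support_fiber G.isLocalHomeomorph_src f y)
            (finite_support_fiber G.isLocalHomeomorph_src g y),
          finsum_add_distrib (finite_support_fiber G.isLocalHomeomorph_rng f y)
            (finite_support_fiber G.isLocalHomeomorph_rng g y)]
        ring
      | neg f _ hf =>
        obtain ⟨a, ha, ha'⟩ := hf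
        refine ⟨-a, M.neg_mem ha, fun y => ?_⟩
        simp only [CompactlySupportedContinuousMap.coe_neg, Pi.neg_apply, ha' y,
          finsum_neg_distrib]
        ring
    rintro a ⟨f, hf⟩
    obtain ⟨b, hb, hb'⟩ := key f
    have : a = b := by
      ext y
      rw [hf y, hb' y]
    rwa [this]
  · rintro _ ⟨U, hU, rfl⟩
    exact (h𝓑 U hU).sub_mem_boundaries

theorem boundaries_eq [TotallyDisconnectedSpace G.Obj] : G.boundaries =
    AddSubgroup.closure ((fun U => chi (G.src '' U) - chi (G.rng '' U)) ''
      {U : Set G.Arr | IsBisection U}) :=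
  boundaries_eq_of_basis isTopologicalBasis_bisection (fun _ h => h)
    fun _ hU _ hV => IsBisection.inter hU hV

/-! ### Classes of clopen sets in `H₀` -/

variable (G) in
/-- The quotient map onto `H₀`, as a homomorphism. -/
noncomputable def toH0Hom : C_c(G.Obj, ℤ) →+ G.H0 := QuotientAddGroup.mk' G.boundaries

theorem toH0_surjective : Function.Surjective G.toH0 := QuotientAddGroup.mk_surjective

theorem toH0_eq_iff {f f' : C_c(G.Obj, ℤ)} : G.toH0 f = G.toH0 f' ↔ f - f' ∈ G.boundaries :=
  QuotientAddGroup.eq_iff_sub_mem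

/-- The class in `H₀` of a compact open set of units. -/
noncomputable def cls (A : Set G.Obj) : G.H0 := G.toH0 (chi A)

theorem IsBisection.cls_eq {U : Set G.Arr} (hU : IsBisection U) :
    cls (G.src '' U) = cls (G.rng '' U) := toH0_eq_iff.mpr hU.sub_mem_boundaries

@[simp] theorem cls_empty : cls (∅ : Set G.Obj) = 0 := by
  rw [cls, chi_empty]
  exact G.toH0Hom.map_zero

theorem cls_union [CompactSpace G.Obj] {A B : Set G.Obj} (hA : IsClopen A) (hB : IsClopen B)
    (hAB : Disjoint A B) : cls (A ∪ B) = cls A + cls B := by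
  rw [cls, chi_union hA hB hAB]
  exact G.toH0Hom.map_add _ _

theorem cls_diff [CompactSpace G.Obj] {A B : Set G.Obj} (hA : IsClopen A) (hB : IsClopen B)
    (hBA : B ⊆ A) : cls (A \ B) = cls A - cls B := by
  rw [cls, chi_diff hA hB hBA]
  exact G.toH0Hom.map_sub _ _

theorem sum_cls [CompactSpace G.Obj] {J : Type*} (s : Finset J) {A : J → Set G.Obj}
    (hA : ∀ j, IsClopen (A j)) (hd : ∀ i j, i ≠ j → Disjoint (A i) (A j)) :
    ∑ j ∈ s, cls (A j) = cls (⋃ j ∈ s, A j) := by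
  classical
  induction s using Finset.induction_on with
  | empty => simp
  | insert j s hj ih =>
    rw [Finset.sum_insert hj, ih, Finset.set_biUnion_insert, cls_union (hA j)
      (isClopen_biUnion_finset fun i _ => hA i)]
    refine Set.disjoint_iUnion₂_right.mpr fun i hi => hd _ _ ?_
    rintro rfl
    exact hj hi

/-! ### Equidecomposability -/

/-- `a` and `b` are the sums of the characteristic functions of the sources and of the ranges of
a finite family of compact open bisections. -/
def Equidec (a b : G.Obj → ℤ) : Prop :=
  ∃ (ι : Type) (_ : Fintype ι) (U : ι → Set G.Arr), (∀ k, IsBisection (U k)) ∧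
    a = ∑ k, (G.src '' U k).indicator 1 ∧ b = ∑ k, (G.rng '' U k).indicator 1

theorem IsBisection.equidec {U : Set G.Arr} (hU : IsBisection U) :
    Equidec ((G.src '' U).indicator (1 : G.Obj → ℤ)) ((G.rng '' U).indicator 1) :=
  ⟨Unit, inferInstance, fun _ => U, fun _ => hU, by simp, by simp⟩

namespace Equidec

variable {a b c d : G.Obj → ℤ}

theorem symm (h : Equidec a b) : Equidec b a := by
  obtain ⟨ι, hι, U, hU, rfl, rfl⟩ := h
  exact ⟨ι, hι, fun k => G.inv ⁻¹' U k, fun k => (hU k).preimage_inv, by simp, by simp⟩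

theorem zero : Equidec (0 : G.Obj → ℤ) 0 :=
  ⟨Empty, inferInstance, Empty.elim, fun k => k.elim, by simp, by simp⟩

theorem add (h : Equidec a b) (h' : Equidec c d) : Equidec (a + c) (b + d) := by
  obtain ⟨ι, _, U, hU, rfl, rfl⟩ := h
  obtain ⟨κ, _, V, hV, rfl, rfl⟩ := h'
  refine ⟨ι ⊕ κ, inferInstance, Sum.elim U V, ?_, ?_, ?_⟩
  · rintro (k | k)
    exacts [hU k, hV k]
  · simp
  · simp

theorem refl_indicator [CompactSpace G.Obj] {A : Set G.Obj} (hA : IsClopen A) :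
    Equidec (A.indicator (1 : G.Obj → ℤ)) (A.indicator 1) := by
  simpa using (IsBisection.image_unit hA.isClosed.isCompact hA.isOpen).equidec

/-- The middle function is a sum of indicators in two ways, by ranges of the `U k` and by sources of
the `V l`. A common refinement `C k l` cuts the bisections into matching pieces, and the products of
these pieces decompose `a` and `c`. -/
theorem trans (h : Equidec a b) (h' : Equidec b c) : Equidec a c := by
  obtain ⟨K, _, U, hU, rfl, rfl⟩ := h
  obtain ⟨L, _, V, hV, hb, rfl⟩ := h'
  obtain ⟨C, hC, hCU, hCV⟩ := exists_refinement (fun k => (hU k).isClopen_rng)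
    (fun l => (hV l).isClopen_src) hb
  let W : K × L → Set G.Arr := fun p => setMul (V p.2) (U p.1 ∩ G.rng ⁻¹' C p.1 p.2)
  have hsrc : ∀ p, G.src '' W p = G.src '' (U p.1 ∩ G.rng ⁻¹' C p.1 p.2) := by
    intro p
    rw [src_image_setMul, inter_assoc, ← preimage_inter]
    congr 3
    exact inter_eq_left.mpr ((subset_iUnion (fun k => C k p.2) p.1).trans (hCV p.2).2.subset)
  have hrng : ∀ p, G.rng '' W p = G.rng '' (V p.2 ∩ G.src ⁻¹' C p.1 p.2) := by
    intro p
    rw [rng_image_setMul]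
    have : G.rng '' (U p.1 ∩ G.rng ⁻¹' C p.1 p.2) = C p.1 p.2 := by
      rw [image_inter_preimage]
      exact inter_eq_right.mpr ((subset_iUnion (C p.1) p.2).trans (hCU p.1).2.subset)
    rw [this]
  refine ⟨K × L, inferInstance, W, fun p => (hV _).setMul ((hU _).inter_rng (hC _ _)), ?_, ?_⟩
  · rw [Fintype.sum_prod_type]
    refine Finset.sum_congr rfl fun k _ => (sum_indicator_of_disjoint ?_ ?_).symm
    · intro l l' x hx hx'
      rw [hsrc] at hx hx'
      obtain ⟨g, hg, rfl⟩ := hx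
      obtain ⟨g', hg', e⟩ := hx'
      obtain rfl := (hU k).src_injOn hg'.1 hg.1 e
      exact (hCU k).1 l l' _ hg.2 hg'.2
    · simp only [hsrc]
      rw [← image_iUnion, ← inter_iUnion, ← preimage_iUnion, (hCU k).2]
      congr 1
      exact inter_eq_left.mpr (subset_preimage_image _ _)
  · rw [Fintype.sum_prod_type_right]
    refine Finset.sum_congr rfl fun l _ => (sum_indicator_of_disjoint ?_ ?_).symm
    · intro k k' x hx hx'
      rw [hrng] at hx hx'
      obtain ⟨g, hg, rfl⟩ := hx
      obtain ⟨g', hg', e⟩ := hx'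
      obtain rfl := (hV l).rng_injOn hg'.1 hg.1 e
      exact (hCV l).1 k k' _ hg.2 hg'.2
    · simp only [hrng]
      rw [← image_iUnion, ← inter_iUnion, ← preimage_iUnion, (hCV l).2]
      congr 1
      exact inter_eq_left.mpr (subset_preimage_image _ _)

/-- When both sums are indicators, the pieces have disjoint sources and disjoint ranges, so their
union is again a bisection. -/
theorem exists_bisection {A B : Set G.Obj}
    (h : Equidec (A.indicator (1 : G.Obj → ℤ)) (B.indicator 1)) :
    ∃ U : Set G.Arr, IsBisection U ∧ G.src '' U = A ∧ G.rng '' U = B := by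
  obtain ⟨K, _, U, hU, hA, hB⟩ := h
  obtain ⟨hs, hs'⟩ := sum_indicator_eq hA.symm
  obtain ⟨hr, hr'⟩ := sum_indicator_eq hB.symm
  refine ⟨⋃ k, U k, ⟨isCompact_iUnion fun k => (hU k).isCompact, isOpen_iUnion fun k =>
    (hU k).isOpen, ?_, ?_⟩, by rw [image_iUnion, hs'], by rw [image_iUnion, hr']⟩
  · intro g hg g' hg' e
    obtain ⟨k, hk⟩ := mem_iUnion.mp hg
    obtain ⟨k', hk'⟩ := mem_iUnion.mp hg'
    obtain rfl := hr k k' (G.rng g) ⟨g, hk, rfl⟩ ⟨g', hk', e.symm⟩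
    exact (hU k).rng_injOn hk hk' e
  · intro g hg g' hg' e
    obtain ⟨k, hk⟩ := mem_iUnion.mp hg
    obtain ⟨k', hk'⟩ := mem_iUnion.mp hg'
    obtain rfl := hs k k' (G.src g) ⟨g, hk, rfl⟩ ⟨g', hk', e.symm⟩
    exact (hU k).src_injOn hk hk' e

/-- Reflexivity is not automatic: the relation only involves functions that are finite sums of
indicators of clopen sets. -/
theorem refl_left [CompactSpace G.Obj] (h : Equidec a b) : Equidec a a := h.trans h.symm

end Equidec

end EtaleGroupoid

namespace EtaleGroupoid

variable {G : EtaleGroupoid.{u}}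

/-! ### Minimal purely infinite groupoids -/

section PurelyInfinite

theorem IsPurelyInfinite.exists_bisections (hp : G.IsPurelyInfinite) {A : Set G.Obj}
    (hA : IsClopen A) : ∃ U V : Set G.Arr, IsBisection U ∧ IsBisection V ∧ G.src '' U = A ∧
      G.src '' V = A ∧ G.rng '' U ⊆ A ∧ G.rng '' V ⊆ A ∧ Disjoint (G.rng '' U) (G.rng '' V) := by
  obtain ⟨U, V, hU, hV, h1, h2, h3, h4⟩ := hp A hA
  exact ⟨U, V, .of_compactOpens U hU, .of_compactOpens V hV, h1, h2,
    subset_union_left.trans h3, subset_union_right.trans h3, h4⟩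

theorem indicator_diff_add {A B : Set G.Obj} (h : B ⊆ A) :
    (B.indicator 1 : G.Obj → ℤ) + (A \ B).indicator 1 = A.indicator 1 := by
  have hd : Disjoint B (A \ B) := disjoint_sdiff_right
  have := indicator_union_of_disjoint hd (1 : G.Obj → ℤ)
  rw [union_sdiff_cancel h] at this
  exact this.symm

/-- An embedding of `A` into `B` makes `A` a summand of `B` in the type semigroup; the complement is
what the range of `U` leaves free. -/
theorem equidec_indicator_of_bisection [CompactSpace G.Obj] {U : Set G.Arr} (hU : IsBisection U) {A B : Set G.Obj}
    (hA : G.src '' U = A) (hB : IsClopen B) (h : G.rng '' U ⊆ B) :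
    Equidec (A.indicator 1 + (B \ G.rng '' U).indicator 1 : G.Obj → ℤ) (B.indicator 1) := by
  have := hU.equidec.add (Equidec.refl_indicator (hB.diff hU.isClopen_rng))
  rwa [hA, indicator_diff_add h] at this

/-- This is the passage from homology to the type semigroup: signs of generators are absorbed by
exchanging sources and ranges. -/
theorem exists_equidec_of_mem_boundaries [TotallyDisconnectedSpace G.Obj] {a : C_c(G.Obj, ℤ)} (ha : a ∈ G.boundaries) :
    ∃ c d : G.Obj → ℤ, Equidec c d ∧ (a : G.Obj → ℤ) = c - d := by
  rw [boundaries_eq] at ha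
  induction ha using AddSubgroup.closure_induction with
  | mem a ha =>
    obtain ⟨U, hU, rfl⟩ := ha
    refine ⟨_, _, hU.equidec, ?_⟩
    rw [← coe_chi (hU.isCompact.image G.continuous_src)
        (G.isLocalHomeomorph_src.isOpenMap _ hU.isOpen),
      ← coe_chi (hU.isCompact.image G.continuous_rng)
        (G.isLocalHomeomorph_rng.isOpenMap _ hU.isOpen)]
    rfl
  | zero => exact ⟨0, 0, Equidec.zero, by simp⟩
  | add a b _ _ ha hb =>
    obtain ⟨c, d, h, e⟩ := ha
    obtain ⟨c', d', h', e'⟩ := hb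
    refine ⟨_, _, h.add h', ?_⟩
    rw [CompactlySupportedContinuousMap.coe_add, e, e']
    abel
  | neg a _ ha =>
    obtain ⟨c, d, h, e⟩ := ha
    refine ⟨_, _, h.symm, ?_⟩
    rw [CompactlySupportedContinuousMap.coe_neg, e]
    abel

variable [CompactSpace G.Obj] [TotallyDisconnectedSpace G.Obj]

/-- Minimality carries a clopen neighbourhood of each point of `A` into `B`, and compactness leaves
finitely many neighbourhoods to assemble. Two of them are joined by first making the second disjoint
from the first, and then pushing their images into the two disjoint copies of `B` inside `B`
supplied by pure infiniteness. -/
theorem exists_bisection_into (hm : G.IsMinimal) (hp : G.IsPurelyInfinite) {A B : Set G.Obj}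
    (hA : IsClopen A) (hB : IsClopen B) (hBn : B.Nonempty) :
    ∃ U : Set G.Arr, IsBisection U ∧ G.src '' U = A ∧ G.rng '' U ⊆ B := by
  obtain ⟨V₁, V₂, hV₁, hV₂, hs₁, hs₂, hr₁, hr₂, hd⟩ := hp.exists_bisections hB
  have key : ∃ K, IsClopen K ∧ A ⊆ K ∧
      ∃ U : Set G.Arr, IsBisection U ∧ G.src '' U = K ∧ G.rng '' U ⊆ B := by
    refine hA.isClosed.isCompact.induction_on (p := fun S => ∃ K, IsClopen K ∧ S ⊆ K ∧
      ∃ U : Set G.Arr, IsBisection U ∧ G.src '' U = K ∧ G.rng '' U ⊆ B) ?_ ?_ ?_ ?_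
    · exact ⟨∅, isClopen_empty, Subset.rfl, ∅, IsBisection.empty, by simp, by simp⟩
    · rintro s t hst ⟨K, hK, htK, h⟩
      exact ⟨K, hK, hst.trans htK, h⟩
    · rintro s t ⟨K, hK, hsK, U, hU, rfl, hUB⟩ ⟨L, hL, htL, V, hV, rfl, hVB⟩
      have hV' := hV.inter_src hU.isClopen_src.compl
      refine ⟨G.src '' U ∪ G.src '' V, hK.union hL, union_subset_union hsK htL,
        setMul V₁ U ∪ setMul V₂ (V ∩ G.src ⁻¹' (G.src '' U)ᶜ),
        (hV₁.setMul hU).union (hV₂.setMul hV') ?_ ?_, ?_, ?_⟩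
      · rw [src_image_setMul, src_image_setMul]
        refine Disjoint.mono (image_mono inter_subset_left) (image_mono inter_subset_left) ?_
        rw [image_inter_preimage]
        exact disjoint_compl_right.mono_right inter_subset_right
      · rw [rng_image_setMul, rng_image_setMul]
        exact Disjoint.mono (image_mono inter_subset_left) (image_mono inter_subset_left) hd
      · rw [image_union, src_image_setMul, src_image_setMul, hs₁, hs₂,
          inter_eq_left.mpr (image_subset_iff.mp hUB), inter_eq_left.mpr
            (inter_subset_left.trans (image_subset_iff.mp hVB)), image_inter_preimage]
        rw [← sdiff_eq, union_sdiff_self]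
      · rw [image_union, rng_image_setMul, rng_image_setMul]
        exact union_subset ((image_mono inter_subset_left).trans hr₁)
          ((image_mono inter_subset_left).trans hr₂)
    · intro x _
      obtain ⟨y, hyB, g, rfl, rfl⟩ := (hm x).inter_open_nonempty B hB.isOpen hBn
      obtain ⟨U, hU, hgU, hUB⟩ := exists_bisection_subset (hB.isOpen.preimage G.continuous_rng)
        (g := g) hyB
      exact ⟨G.src '' U, mem_nhdsWithin_of_mem_nhds
        (hU.isClopen_src.isOpen.mem_nhds ⟨g, hgU, rfl⟩), _, hU.isClopen_src, Subset.rfl, U, hU,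
        rfl, image_subset_iff.mpr hUB⟩
  obtain ⟨K, hK, hAK, U, hU, rfl, hUB⟩ := key
  refine ⟨U ∩ G.src ⁻¹' A, hU.inter_src hA, ?_, (image_mono inter_subset_left).trans hUB⟩
  rw [image_inter_preimage]
  exact inter_eq_right.mpr hAK

/-- Embed `A` into one of two disjoint copies of `B` inside `B`; the other copy stays uncovered. -/
theorem exists_bisection_into_proper (hm : G.IsMinimal) (hp : G.IsPurelyInfinite)
    {A B : Set G.Obj} (hA : IsClopen A) (hB : IsClopen B) (hBn : B.Nonempty) :
    ∃ U : Set G.Arr, IsBisection U ∧ G.src '' U = A ∧ G.rng '' U ⊆ B ∧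
      (B \ G.rng '' U).Nonempty := by
  obtain ⟨V₁, V₂, hV₁, hV₂, hs₁, hs₂, hr₁, hr₂, hd⟩ := hp.exists_bisections hB
  have hn : (G.rng '' V₁).Nonempty := by
    rw [image_nonempty, ← image_nonempty (f := G.src), hs₁]
    exact hBn
  obtain ⟨U, hU, hUA, hUB⟩ := exists_bisection_into hm hp hA hV₁.isClopen_rng hn
  refine ⟨U, hU, hUA, hUB.trans hr₁, ?_⟩
  have hn₂ : (G.rng '' V₂).Nonempty := by
    rw [image_nonempty, ← image_nonempty (f := G.src), hs₂]
    exact hBn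
  obtain ⟨y, hy⟩ := hn₂
  exact ⟨y, hr₂ hy, fun h => Set.disjoint_left.mp hd (hUB h) hy⟩

/-- Cancellation in the type semigroup of a minimal purely infinite groupoid. -/
theorem equidec_cancel (hm : G.IsMinimal) (hp : G.IsPurelyInfinite) {A B : Set G.Obj}
    (hA : IsClopen A) (hB : IsClopen B) (hAn : A.Nonempty) (hBn : B.Nonempty) {c : G.Obj → ℤ}
    (hc : Equidec c c)
    (h : Equidec (A.indicator 1 + c : G.Obj → ℤ) (B.indicator 1 + c)) :
    Equidec (A.indicator 1 : G.Obj → ℤ) (B.indicator 1) := by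
  obtain ⟨x, -⟩ := id hAn
  obtain ⟨U, hU, hUs, hUr, hUn⟩ := exists_bisection_into_proper hm hp isClopen_univ isClopen_univ
    ⟨x, mem_univ x⟩
  -- `E` is what a proper copy of the unit space leaves over, so adding `E` to the unit space
  -- changes nothing in the type semigroup.
  set E := univ \ G.rng '' U with hE
  have hEc : IsClopen E := isClopen_univ.diff hU.isClopen_rng
  have hE0 := equidec_indicator_of_bisection hU hUs isClopen_univ hUr
  -- Every nonempty clopen `B` contains a copy of the whole unit space, and that copy absorbs `E`.
  have hneutral : ∀ {B : Set G.Obj}, IsClopen B → B.Nonempty →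
      Equidec (B.indicator 1 + E.indicator 1 : G.Obj → ℤ) (B.indicator 1) := by
    intro B hB hBn
    obtain ⟨V, hV, hVs, hVr, -⟩ := exists_bisection_into_proper hm hp isClopen_univ hB hBn
    have h1 := equidec_indicator_of_bisection hV hVs hB hVr
    have hQ := Equidec.refl_indicator (hB.diff hV.isClopen_rng)
    have h2 := (h1.symm.add (Equidec.refl_indicator hEc))
    rw [add_right_comm] at h2
    exact h2.trans ((hE0.add hQ).trans h1)
  have hneutral' : ∀ {B : Set G.Obj}, IsClopen B → B.Nonempty → ∀ m : ℕ,
      Equidec (B.indicator 1 + m • E.indicator 1 : G.Obj → ℤ) (B.indicator 1) := by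
    intro B hB hBn m
    induction m with
    | zero => simpa using Equidec.refl_indicator hB
    | succ m ih =>
      rw [add_smul, one_smul, ← add_assoc]
      exact (ih.add (Equidec.refl_indicator hEc)).trans (hneutral hB hBn)
  -- Each clopen set occurring in `c` embeds into `E`, so `c` has a complement `d` in a multiple of
  -- `E`. Then `B + c + d` is equivalent to `B` for every nonempty clopen `B`, and adding `d` to the
  -- hypothesis finishes the proof.
  obtain ⟨d, m, hd, hdm⟩ : ∃ (d : G.Obj → ℤ) (m : ℕ), Equidec d d ∧
      Equidec (c + d) (m • E.indicator 1) := by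
    obtain ⟨ι, _, W, hW, rfl, -⟩ := hc
    have : ∀ k, ∃ d : G.Obj → ℤ, Equidec d d ∧
        Equidec ((G.src '' W k).indicator 1 + d) (E.indicator 1) := by
      intro k
      obtain ⟨V, hV, hVs, hVr, -⟩ := exists_bisection_into_proper hm hp (hW k).isClopen_src hEc hUn
      exact ⟨_, Equidec.refl_indicator (hEc.diff hV.isClopen_rng),
        equidec_indicator_of_bisection hV hVs hEc hVr⟩
    choose d hd hd' using this
    have hsum : ∀ (s : Finset ι) {a b : ι → G.Obj → ℤ}, (∀ k, Equidec (a k) (b k)) →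
        Equidec (∑ k ∈ s, a k) (∑ k ∈ s, b k) := by
      classical
      intro s a b hab
      induction s using Finset.induction_on with
      | empty => simpa using Equidec.zero
      | insert k s hk ih =>
        rw [Finset.sum_insert hk, Finset.sum_insert hk]
        exact (hab k).add ih
    refine ⟨∑ k, d k, Fintype.card ι, hsum _ hd, ?_⟩
    have := hsum Finset.univ hd'
    rwa [Finset.sum_add_distrib, Finset.sum_const, Finset.card_univ] at this
  have h1 : ∀ {B : Set G.Obj}, IsClopen B → B.Nonempty →
      Equidec (B.indicator 1 + c + d) (B.indicator 1) := by
    intro B hB hBn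
    rw [add_assoc]
    exact ((Equidec.refl_indicator hB).add hdm).trans (hneutral' hB hBn m)
  exact (h1 hA hAn).symm.trans ((h.add hd).trans (h1 hB hBn))

/-- In a minimal purely infinite groupoid, two nonempty clopen sets with the same class in `H₀`
are the source and the range of a compact open bisection. -/
theorem exists_bisection_of_cls_eq (hm : G.IsMinimal) (hp : G.IsPurelyInfinite) {A B : Set G.Obj}
    (hA : IsClopen A) (hB : IsClopen B) (hAn : A.Nonempty) (hBn : B.Nonempty)
    (h : cls A = cls B) : ∃ U : Set G.Arr, IsBisection U ∧ G.src '' U = A ∧ G.rng '' U = B := by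
  obtain ⟨c, d, hcd, e⟩ := exists_equidec_of_mem_boundaries (toH0_eq_iff.mp h)
  rw [CompactlySupportedContinuousMap.coe_sub, chi_coe hA, chi_coe hB, sub_eq_sub_iff_add_eq_add,
    ] at e
  -- The summand to cancel is `d`: by `e`, `A + d` equals `B + c`, which is equivalent to `B + d`.
  refine (equidec_cancel hm hp hA hB hAn hBn hcd.symm.refl_left ?_).exists_bisection
  rw [e, add_comm c]
  exact (Equidec.refl_indicator hB).add hcd

/-- Every class in `H₀` of a minimal purely infinite groupoid is represented by nonempty clopen
proper subsets of any given nonempty clopen set. -/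
theorem exists_clopen_cls_eq (hm : G.IsMinimal) (hp : G.IsPurelyInfinite) (c : G.H0)
    {A : Set G.Obj} (hA : IsClopen A) (hAn : A.Nonempty) :
    ∃ B ⊆ A, IsClopen B ∧ B.Nonempty ∧ (A \ B).Nonempty ∧ cls B = c := by
  -- The class zero is represented by the complement in `A` of a proper copy of `A`.
  have hzero : ∀ {A : Set G.Obj}, IsClopen A → A.Nonempty →
      ∃ B ⊆ A, IsClopen B ∧ B.Nonempty ∧ cls B = 0 := by
    intro A hA hAn
    obtain ⟨U, hU, hUs, hUr, hUn⟩ := exists_bisection_into_proper hm hp hA hA hAn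
    refine ⟨A \ G.rng '' U, sdiff_subset, hA.diff hU.isClopen_rng, hUn, ?_⟩
    rw [cls_diff hA hU.isClopen_rng hUr, ← hU.cls_eq, hUs, sub_self]
  have hsub : ∀ {A C : Set G.Obj}, IsClopen A → A.Nonempty → IsClopen C → C.Nonempty →
      ∃ B ⊆ A, IsClopen B ∧ B.Nonempty ∧ (A \ B).Nonempty ∧ cls B = cls C := by
    intro A C hA hAn hC hCn
    obtain ⟨U, hU, hUs, hUr, hUn⟩ := exists_bisection_into_proper hm hp hC hA hAn
    refine ⟨G.rng '' U, hUr, hU.isClopen_rng, ?_, hUn, ?_⟩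
    · rw [image_nonempty, ← image_nonempty (f := G.src), hUs]
      exact hCn
    · rw [← hU.cls_eq, hUs]
  obtain ⟨f, rfl⟩ := toH0_surjective c
  suffices h : ∃ C : Set G.Obj, IsClopen C ∧ C.Nonempty ∧ cls C = G.toH0 f by
    obtain ⟨C, hC, hCn, e⟩ := h
    rw [← e]
    exact hsub hA hAn hC hCn
  have hf : f ∈ AddSubgroup.closure (chi '' {A : Set G.Obj | IsClopen A}) := by
    rw [closure_chi_clopen]
    trivial
  have huniv : (univ : Set G.Obj).Nonempty := hAn.mono (subset_univ _)
  induction hf using AddSubgroup.closure_induction with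
  | mem f hf =>
    obtain ⟨C, hC, rfl⟩ := hf
    rcases C.eq_empty_or_nonempty with rfl | hCn
    · obtain ⟨B, -, h1, h2, h3⟩ := hzero hA hAn
      exact ⟨B, h1, h2, h3.trans cls_empty.symm⟩
    · exact ⟨C, hC, hCn, rfl⟩
  | zero =>
    obtain ⟨B, -, h1, h2, h3⟩ := hzero hA hAn
    exact ⟨B, h1, h2, h3⟩
  | add f g _ _ hf hg =>
    obtain ⟨C, hC, hCn, e⟩ := hf
    obtain ⟨D, hD, hDn, e'⟩ := hg
    obtain ⟨C', -, hC', hCn', hr, e1⟩ := hsub isClopen_univ huniv hC hCn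
    obtain ⟨D', hDs, hD', -, -, e2⟩ := hsub (isClopen_univ.diff hC') hr hD hDn
    refine ⟨C' ∪ D', hC'.union hD', hCn'.mono subset_union_left, ?_⟩
    rw [cls_union hC' hD' (Set.disjoint_left.mpr fun x hx hx' => (hDs hx').2 hx), e1, e2, e, e']
    exact (G.toH0Hom.map_add f g).symm
  -- Remove a proper copy of `C` from a clopen set of class zero.
  | neg f _ hf =>
    obtain ⟨C, hC, hCn, e⟩ := hf
    obtain ⟨E, -, hE, hEn, hE0⟩ := hzero hA hAn
    obtain ⟨D, hDE, hD, -, hn, e'⟩ := hsub hE hEn hC hCn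
    refine ⟨E \ D, hE.diff hD, hn, ?_⟩
    rw [cls_diff hE hD hDE, hE0, e', e, zero_sub]
    exact (G.toH0Hom.map_neg f).symm

/-- A nonempty clopen set can be partitioned into nonempty clopen sets with prescribed
classes. -/
theorem exists_partition_cls (hm : G.IsMinimal) (hp : G.IsPurelyInfinite) {J : Type*} [Finite J]
    {s : Set J} (hs : s.Nonempty) (c : J → G.H0) {A : Set G.Obj} (hA : IsClopen A)
    (hAn : A.Nonempty) (hc : ∑ᶠ j ∈ s, c j = cls A) :
    ∃ D : J → Set G.Obj, (∀ j ∈ s, IsClopen (D j) ∧ (D j).Nonempty ∧ cls (D j) = c j) ∧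
      (∀ i ∈ s, ∀ j ∈ s, ∀ x, x ∈ D i → x ∈ D j → i = j) ∧ ⋃ j ∈ s, D j = A := by
  classical
  obtain ⟨t, rfl⟩ := s.toFinite.exists_finset_coe
  rw [finsum_mem_coe_finset] at hc
  simp only [Finset.mem_coe]
  have ht : t.Nonempty := by exact_mod_cast hs
  clear hs
  induction ht using Finset.Nonempty.cons_induction generalizing A with
  -- The last index receives the whole remainder, whose class is forced by `hc`. This is why `s`
  -- must be nonempty.
  | singleton j =>
    refine ⟨fun _ => A, ?_, ?_, by simp⟩
    · intro i hi
      rw [Finset.mem_singleton] at hi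
      subst hi
      exact ⟨hA, hAn, by simpa using hc.symm⟩
    · intro i hi k hk _ _ _
      rw [Finset.mem_singleton] at hi hk
      rw [hi, hk]
  | cons j t hj _ ih =>
    obtain ⟨B, hBA, hB, hBn, hr, e⟩ := exists_clopen_cls_eq hm hp (c j) hA hAn
    rw [Finset.sum_cons] at hc
    obtain ⟨D, h1, h2, h3⟩ := ih (hA.diff hB) hr (by
      rw [cls_diff hA hB hBA, e, ← hc, add_sub_cancel_left])
    obtain ⟨D', hD'j, hDj⟩ : ∃ D' : J → Set G.Obj, D' j = B ∧ ∀ i ∈ t, D' i = D i :=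
      ⟨Function.update D j B, Function.update_self .., fun i hi =>
        Function.update_of_ne (by rintro rfl; exact hj hi) ..⟩
    have hdisj : ∀ i ∈ t, ∀ x, x ∈ B → x ∉ D i := by
      intro i hi x hx hx'
      have : x ∈ A \ B := h3 ▸ mem_biUnion hi hx'
      exact this.2 hx
    refine ⟨D', ?_, ?_, ?_⟩
    · intro i hi
      rw [Finset.mem_cons] at hi
      rcases hi with rfl | hi
      · rw [hD'j]
        exact ⟨hB, hBn, e⟩
      · rw [hDj i hi]
        exact h1 i hi
    · intro i hi k hk x hx hx'
      rw [Finset.mem_cons] at hi hk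
      rcases hi with rfl | hi <;> rcases hk with rfl | hk
      · rfl
      · rw [hD'j] at hx
        rw [hDj k hk] at hx'
        exact absurd hx' (hdisj k hk x hx)
      · rw [hD'j] at hx'
        rw [hDj i hi] at hx
        exact absurd hx (hdisj i hi x hx')
      · rw [hDj i hi] at hx
        rw [hDj k hk] at hx'
        exact h2 i hi k hk x hx hx'
    · rw [← Finset.set_biUnion_coe, Finset.coe_cons, biUnion_insert, hD'j,
        show (⋃ i ∈ (t : Set J), D' i) = ⋃ i ∈ t, D i from iUnion₂_congr hDj, h3,
        union_sdiff_cancel hBA]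

end PurelyInfinite

end EtaleGroupoid

/-! ### The Künneth formula for `H₀` -/

theorem isTopologicalBasis_univ_pi {ι : Type*} [Finite ι] {X : ι → Type*}
    [∀ i, TopologicalSpace (X i)] {T : ∀ i, Set (Set (X i))}
    (h : ∀ i, TopologicalSpace.IsTopologicalBasis (T i)) :
    TopologicalSpace.IsTopologicalBasis {S : Set (∀ i, X i) | ∃ U : ∀ i, Set (X i),
      (∀ i, U i ∈ T i) ∧ S = univ.pi U} := by
  refine TopologicalSpace.isTopologicalBasis_of_isOpen_of_nhds ?_ ?_
  · rintro _ ⟨U, hU, rfl⟩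
    exact isOpen_set_pi finite_univ fun i _ => (h i).isOpen (hU i)
  · intro a O ha hO
    obtain ⟨u, hu, hs⟩ := isOpen_pi_iff'.mp hO a ha
    choose U hU haU hUu using fun i => (h i).exists_subset_of_mem_open (hu i).2 (hu i).1
    exact ⟨_, ⟨U, hU, rfl⟩, fun i _ => haU i, (pi_mono fun i _ => hUu i).trans hs⟩

theorem univ_pi_inter_mem {ι : Type*} {X : ι → Type*} {T : ∀ i, Set (Set (X i))}
    (h : ∀ i, ∀ U ∈ T i, ∀ V ∈ T i, U ∩ V ∈ T i) :
    ∀ U ∈ {S : Set (∀ i, X i) | ∃ U : ∀ i, Set (X i), (∀ i, U i ∈ T i) ∧ S = univ.pi U},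
    ∀ V ∈ {S : Set (∀ i, X i) | ∃ U : ∀ i, Set (X i), (∀ i, U i ∈ T i) ∧ S = univ.pi U},
    U ∩ V ∈ {S : Set (∀ i, X i) | ∃ U : ∀ i, Set (X i), (∀ i, U i ∈ T i) ∧ S = univ.pi U} := by
  rintro _ ⟨U, hU, rfl⟩ _ ⟨V, hV, rfl⟩
  exact ⟨fun i => U i ∩ V i, fun i => h i _ (hU i) _ (hV i), (pi_inter_distrib).symm⟩

/-- A multilinear map that sends tuples of generators into a subgroup sends everything there. -/
theorem MultilinearMap.mem_of_closure {ι : Type*} [Finite ι] {M : ι → Type*} {N : Type*}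
    [∀ i, AddCommGroup (M i)] [AddCommGroup N] [∀ i, Module ℤ (M i)] [Module ℤ N]
    (f : MultilinearMap ℤ M N) {S : ∀ i, Set (M i)} {K : AddSubgroup N}
    (h : ∀ a, (∀ i, a i ∈ S i) → f a ∈ K) (a : ∀ i, M i)
    (ha : ∀ i, a i ∈ AddSubgroup.closure (S i)) : f a ∈ K := by
  classical
  cases nonempty_fintype ι
  -- Enlarge one slot at a time the set `s` of slots in which arbitrary elements of the closure are
  -- allowed.
  suffices key : ∀ s : Finset ι, ∀ a : ∀ i, M i, (∀ i ∈ s, a i ∈ AddSubgroup.closure (S i)) →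
      (∀ i ∉ s, a i ∈ S i) → f a ∈ K from
    key Finset.univ a (fun i _ => ha i) fun i hi => absurd (Finset.mem_univ i) hi
  intro s
  induction s using Finset.induction_on with
  | empty => exact fun a _ ha => h a fun i => ha i (Finset.notMem_empty i)
  | insert j s hj ih =>
    intro a h1 h2
    suffices key : ∀ x ∈ AddSubgroup.closure (S j), f (Function.update a j x) ∈ K by
      simpa using key (a j) (h1 j (Finset.mem_insert_self j s))
    intro x hx
    induction hx using AddSubgroup.closure_induction with
    | mem x hx =>
      refine ih _ (fun i hi => ?_) fun i hi => ?_
      · rw [Function.update_of_ne (by rintro rfl; exact hj hi)]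
        exact h1 i (Finset.mem_insert_of_mem hi)
      · by_cases hij : i = j
        · subst hij
          simpa using hx
        · rw [Function.update_of_ne hij]
          exact h2 i (by simp [hij, hi])
    | zero => rw [f.map_update_zero]; exact K.zero_mem
    | add x y _ _ hx hy => rw [f.map_update_add]; exact K.add_mem hx hy
    | neg x _ hx => rw [f.map_update_neg]; exact K.neg_mem hx

/-- Finitely many integer valued functions on a compact space lie in the span of finitely many
functions, with coefficients that are values of the functions. -/
theorem exists_interpolation {X : Type*} [TopologicalSpace X] [T2Space X] [CompactSpace X]
    (F : Finset C_c(X, ℤ)) : ∃ (m : ℕ) (s : Fin m → X) (c : Fin m → C_c(X, ℤ)),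
      ∀ f ∈ F, f = ∑ k, f (s k) • c k := by
  classical
  -- The joint value map has finite range. The `c k` are the characteristic functions of its fibres
  -- and `s k` is a point of the `k`-th fibre.
  let q : X → F → ℤ := fun x f => f.1 x
  have hq : Continuous q := continuous_pi fun f => f.1.continuous
  have hfin : (range q).Finite := (isCompact_range hq).finite_of_discrete
  have : Finite (range q) := hfin
  obtain ⟨m, ⟨e⟩⟩ := Finite.exists_equiv_fin (range q)
  choose s hs using fun k : Fin m => (e.symm k).2
  refine ⟨m, s, fun k => chi {x | q x = (e.symm k).1}, fun f hf => ?_⟩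
  ext x
  rw [CompactlySupportedContinuousMap.sum_apply]
  simp only [CompactlySupportedContinuousMap.smul_apply, chi_coe (isClopen_fiber hq _)]
  rw [Finset.sum_eq_single (e ⟨q x, x, rfl⟩)]
  · have h1 := congrFun (hs (e ⟨q x, x, rfl⟩)) ⟨f, hf⟩
    simp only [Equiv.symm_apply_apply] at h1
    change f (s _) = f x at h1
    simp [h1]
  · intro k _ hk
    rw [indicator_of_notMem, smul_zero]
    intro h
    apply hk
    rw [← e.apply_symm_apply k]
    exact congrArg e (Subtype.ext h.symm)
  · simp

namespace EtaleGroupoid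

variable {n : ℕ} (G : Fin n → EtaleGroupoid.{u})

/-- A product of sets of units, as a set of units of the product groupoid. -/
def boxObj (A : ∀ i, Set (G i).Obj) : Set (pi G).Obj := univ.pi A

/-- A product of sets of arrows, as a set of arrows of the product groupoid. -/
def boxArr (W : ∀ i, Set (G i).Arr) : Set (pi G).Arr := univ.pi W

/-- A family of units, as a unit of the product groupoid. -/
def mkObj (x : ∀ i, (G i).Obj) : (pi G).Obj := x

theorem isCompact_boxObj {A : ∀ i, Set (G i).Obj} (h : ∀ i, IsCompact (A i)) :
    IsCompact (boxObj G A) := isCompact_univ_pi h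

theorem isOpen_boxObj {A : ∀ i, Set (G i).Obj} (h : ∀ i, IsOpen (A i)) :
    IsOpen (boxObj G A) := isOpen_set_pi finite_univ fun i _ => h i

theorem isOpen_boxArr {W : ∀ i, Set (G i).Arr} (h : ∀ i, IsOpen (W i)) :
    IsOpen (boxArr G W) := isOpen_set_pi finite_univ fun i _ => h i

theorem IsBisection.pi {W : ∀ i, Set (G i).Arr} (hW : ∀ i, IsBisection (W i)) :
    IsBisection (boxArr G W) where
  isCompact := isCompact_univ_pi fun i => (hW i).isCompact
  isOpen := isOpen_set_pi finite_univ fun i _ => (hW i).isOpen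
  rng_injOn := fun _ hg _ hh e =>
    funext fun i => (hW i).rng_injOn (hg i trivial) (hh i trivial) (congrFun e i)
  src_injOn := fun _ hg _ hh e =>
    funext fun i => (hW i).src_injOn (hg i trivial) (hh i trivial) (congrFun e i)

theorem src_image_pi (W : ∀ i, Set (G i).Arr) :
    (pi G).src '' (boxArr G W) = boxObj G fun i => (G i).src '' W i := by
  ext x
  constructor
  · rintro ⟨g, hg, rfl⟩ i -
    exact ⟨g i, hg i trivial, rfl⟩
  · intro hx
    choose g hg e using fun i => hx i trivial
    exact ⟨g, fun i _ => hg i, funext e⟩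

theorem rng_image_pi (W : ∀ i, Set (G i).Arr) :
    (pi G).rng '' (boxArr G W) = boxObj G fun i => (G i).rng '' W i := by
  ext x
  constructor
  · rintro ⟨g, hg, rfl⟩ i -
    exact ⟨g i, hg i trivial, rfl⟩
  · intro hx
    choose g hg e using fun i => hx i trivial
    exact ⟨g, fun i _ => hg i, funext e⟩

/-- The external product as a multilinear map. -/
noncomputable def extProdMulti :
    MultilinearMap ℤ (fun i => C_c((G i).Obj, ℤ)) C_c((pi G).Obj, ℤ) where
  toFun := extProd G
  map_update_add' := by
    intro _ f i a b
    ext x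
    let ev : ∀ j, C_c((G j).Obj, ℤ) →ₗ[ℤ] ℤ := fun j =>
      ⟨⟨fun f => f (x j), fun _ _ => rfl⟩, fun _ _ => rfl⟩
    exact ((MultilinearMap.mkPiAlgebra ℤ (Fin n) ℤ).compLinearMap ev).map_update_add f i a b
  map_update_smul' := by
    intro _ f i c a
    ext x
    let ev : ∀ j, C_c((G j).Obj, ℤ) →ₗ[ℤ] ℤ := fun j =>
      ⟨⟨fun f => f (x j), fun _ _ => rfl⟩, fun _ _ => rfl⟩
    exact ((MultilinearMap.mkPiAlgebra ℤ (Fin n) ℤ).compLinearMap ev).map_update_smul f i c a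

@[simp] theorem extProdMulti_apply (f : ∀ i, C_c((G i).Obj, ℤ)) :
    extProdMulti G f = extProd G f := rfl

theorem extProd_apply (f : ∀ i, C_c((G i).Obj, ℤ)) (x : (pi G).Obj) :
    extProd G f x = ∏ i, f i (x i) := rfl

theorem extProd_chi {A : ∀ i, Set (G i).Obj} (hc : ∀ i, IsCompact (A i))
    (ho : ∀ i, IsOpen (A i)) : extProd G (fun i => chi (A i)) = chi (boxObj G A) := by
  ext x
  rw [extProd_apply, coe_chi (isCompact_boxObj G hc) (isOpen_boxObj G ho)]
  simp only [coe_chi (hc _) (ho _)]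
  by_cases hx : x ∈ boxObj G A
  · rw [indicator_of_mem hx]
    refine Finset.prod_eq_one fun i _ => ?_
    rw [indicator_of_mem (hx i trivial)]
    rfl
  · rw [indicator_of_notMem hx]
    obtain ⟨i, hi⟩ : ∃ i, x i ∉ A i := by
      by_contra! h
      exact hx fun i _ => h i
    exact Finset.prod_eq_zero (Finset.mem_univ i) (indicator_of_notMem hi _)

/-- A representative of a class in `H₀`. -/
noncomputable def rep {G : EtaleGroupoid.{u}} (c : G.H0) : C_c(G.Obj, ℤ) := Quotient.out c

@[simp] theorem toH0_rep {G : EtaleGroupoid.{u}} (c : G.H0) : G.toH0 (rep c) = c :=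
  QuotientAddGroup.out_eq' c

/-- The linear map from the tensor product induced by the external product. -/
noncomputable def extProdLift : (⨂[ℤ] i, C_c((G i).Obj, ℤ)) →ₗ[ℤ] C_c((pi G).Obj, ℤ) :=
  PiTensorProduct.lift (extProdMulti G)

@[simp] theorem extProdLift_tprod (f : ∀ i, C_c((G i).Obj, ℤ)) :
    extProdLift G (PiTensorProduct.tprod ℤ f) = extProd G f := PiTensorProduct.lift.tprod _

/-- A tensor `t` involves finitely many functions in each slot, and these are fixed by an
interpolation operator `e i` that only uses values at finitely many points. The tensor product of
the `e i` therefore fixes `t`, while it depends only on the values of the product function on a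
finite grid. If that function vanishes, so does `t`. -/
theorem extProdLift_injective [∀ i, CompactSpace (G i).Obj] : Function.Injective (extProdLift G) := by
  classical
  rw [injective_iff_map_eq_zero]
  intro t ht
  have key : ∀ t : ⨂[ℤ] i, C_c((G i).Obj, ℤ), ∃ F : ∀ i, Finset C_c((G i).Obj, ℤ),
      ∀ e : ∀ i, C_c((G i).Obj, ℤ) →ₗ[ℤ] C_c((G i).Obj, ℤ), (∀ i, ∀ f ∈ F i, e i f = f) →
        PiTensorProduct.map e t = t := by
    intro t
    induction t using PiTensorProduct.induction_on with
    | smul_tprod r f =>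
      refine ⟨fun i => {f i}, fun e he => ?_⟩
      rw [map_smul, PiTensorProduct.map_tprod]
      congr 2
      exact funext fun i => he i (f i) (by simp)
    | add x y hx hy =>
      obtain ⟨F, hF⟩ := hx
      obtain ⟨F', hF'⟩ := hy
      refine ⟨fun i => F i ∪ F' i, fun e he => ?_⟩
      rw [map_add, hF e fun i f hf => he i f (Finset.mem_union_left _ hf),
        hF' e fun i f hf => he i f (Finset.mem_union_right _ hf)]
  obtain ⟨F, hF⟩ := key t
  choose m s c hc using fun i => exists_interpolation (F i)
  let e : ∀ i, C_c((G i).Obj, ℤ) →ₗ[ℤ] C_c((G i).Obj, ℤ) := fun i =>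
    { toFun := fun f => ∑ k, f (s i k) • c i k
      map_add' := fun f g => by
        simp only [CompactlySupportedContinuousMap.add_apply, add_smul, Finset.sum_add_distrib]
      map_smul' := fun r f => by
        simp only [CompactlySupportedContinuousMap.smul_apply, smul_assoc, Finset.smul_sum,
          RingHom.id_apply] }
  have hmap : ∀ t, PiTensorProduct.map e t = ∑ κ : ∀ i, Fin (m i),
      extProdLift G t (mkObj G fun i => s i (κ i)) •
        PiTensorProduct.tprod ℤ fun i => c i (κ i) := by
    intro t
    induction t using PiTensorProduct.induction_on with
    | smul_tprod r f =>
      rw [map_smul, map_smul, PiTensorProduct.map_tprod, extProdLift_tprod]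
      change r • PiTensorProduct.tprod ℤ (fun i => ∑ k, f i (s i k) • c i k) = _
      rw [MultilinearMap.map_sum, Finset.smul_sum]
      refine Finset.sum_congr rfl fun κ _ => ?_
      rw [MultilinearMap.map_smul_univ, CompactlySupportedContinuousMap.smul_apply, smul_assoc]
      rfl
    | add x y hx hy =>
      rw [map_add, hx, hy, map_add, ← Finset.sum_add_distrib]
      refine Finset.sum_congr rfl fun κ _ => ?_
      rw [CompactlySupportedContinuousMap.add_apply, add_smul]
  rw [← hF e fun i f hf => (hc i f hf).symm, hmap, ht]
  exact Finset.sum_eq_zero fun κ _ => zero_smul ℤ _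

variable [∀ i, CompactSpace (G i).Obj] [∀ i, TotallyDisconnectedSpace (G i).Obj]

instance : TotallyDisconnectedSpace (pi G).Obj :=
  inferInstanceAs (TotallyDisconnectedSpace (∀ i, (G i).Obj))

theorem closure_range_extProd : AddSubgroup.closure (range (extProd G)) = ⊤ := by
  have h := closure_chi_eq_top (Y := (pi G).Obj)
    (isTopologicalBasis_univ_pi fun i => isTopologicalBasis_isClopen (X := (G i).Obj))
    ?_ (univ_pi_inter_mem fun i U hU V hV => IsClopen.inter hU hV)
  · rw [eq_top_iff, ← h]
    refine AddSubgroup.closure_mono ?_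
    rintro _ ⟨_, ⟨A, hA, rfl⟩, rfl⟩
    exact ⟨_, extProd_chi G (fun i => (hA i).isClosed.isCompact) fun i => (hA i).isOpen⟩
  · rintro _ ⟨A, hA, rfl⟩
    exact isCompact_univ_pi fun i => (hA i).isClosed.isCompact

theorem extProdLift_surjective : Function.Surjective (extProdLift G) := by
  rw [← LinearMap.range_eq_top, ← Submodule.toAddSubgroup_inj]
  rw [Submodule.top_toAddSubgroup, eq_top_iff, ← closure_range_extProd, AddSubgroup.closure_le]
  rintro _ ⟨f, rfl⟩
  exact ⟨_, extProdLift_tprod G f⟩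

/-- The identification of the functions on a product with a tensor product. -/
noncomputable def extProdEquiv : (⨂[ℤ] i, C_c((G i).Obj, ℤ)) ≃ₗ[ℤ] C_c((pi G).Obj, ℤ) :=
  LinearEquiv.ofBijective (extProdLift G) ⟨extProdLift_injective G, extProdLift_surjective G⟩

theorem extProdEquiv_symm_extProd (f : ∀ i, C_c((G i).Obj, ℤ)) :
    (extProdEquiv G).symm (extProd G f) = PiTensorProduct.tprod ℤ f := by
  rw [LinearEquiv.symm_apply_eq]
  exact (extProdLift_tprod G f).symm

/-- By multilinearity slot `i` may be taken to be the boundary of a bisection `U`, and the other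
slots to be characteristic functions of clopen sets. The product is then the boundary of the box
with side `U` in slot `i` and unit bisections elsewhere. -/
theorem extProd_mem_boundaries (f : ∀ i, C_c((G i).Obj, ℤ)) (i : Fin n)
    (hi : f i ∈ (G i).boundaries) : extProd G f ∈ (pi G).boundaries := by
  classical
  let S : ∀ j, Set C_c((G j).Obj, ℤ) := Function.update
    (fun j => chi '' {A : Set (G j).Obj | IsClopen A}) i
    ((fun U => chi ((G i).src '' U) - chi ((G i).rng '' U)) '' {U | IsBisection U})
  refine (extProdMulti G).mem_of_closure (S := S) (K := (pi G).boundaries) ?_ f ?_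
  · intro a ha
    have hai : a i ∈ S i := ha i
    simp only [S, Function.update_self] at hai
    obtain ⟨U, hU, e⟩ := hai
    have hA : ∀ j, ∃ A : Set (G j).Obj, IsClopen A ∧ (j ≠ i → a j = chi A) := by
      intro j
      by_cases hj : j = i
      · exact ⟨∅, isClopen_empty, fun h => absurd hj h⟩
      · have := ha j
        simp only [S, Function.update_of_ne hj] at this
        obtain ⟨A, hA, e⟩ := this
        exact ⟨A, hA, fun _ => e.symm⟩
    choose A hAc hA using hA
    have key : ∀ B : Set (G i).Obj, IsClopen B → extProdMulti G (Function.update a i (chi B)) =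
        chi (boxObj G (Function.update A i B)) := by
      intro B hB
      have hcl : ∀ j, IsClopen (Function.update A i B j) := by
        intro j
        by_cases hj : j = i
        · subst hj
          simpa using hB
        · rw [Function.update_of_ne hj]
          exact hAc j
      rw [← extProd_chi G (fun j => (hcl j).isClosed.isCompact) fun j => (hcl j).isOpen,
        extProdMulti_apply]
      congr 1
      funext j
      by_cases hj : j = i
      · subst hj
        simp
      · rw [Function.update_of_ne hj, Function.update_of_ne hj, hA j hj]
    rw [← Function.update_eq_self i a, ← e, MultilinearMap.map_update_sub,
      key _ (IsBisection.isClopen_src hU), key _ (IsBisection.isClopen_rng hU)]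
    let W : ∀ j, Set (G j).Arr := Function.update (fun j => (G j).unit '' A j) i U
    have hW : ∀ j, IsBisection (W j) := by
      intro j
      by_cases hj : j = i
      · subst hj
        simpa [W] using hU
      · simp only [W, Function.update_of_ne hj]
        exact IsBisection.image_unit (hAc j).isClosed.isCompact (hAc j).isOpen
    have hs : Function.update A i ((G i).src '' U) = fun j => (G j).src '' W j := by
      funext j
      by_cases hj : j = i
      · subst hj
        simp [W]
      · simp [W, Function.update_of_ne hj]
    have hr : Function.update A i ((G i).rng '' U) = fun j => (G j).rng '' W j := by
      funext j
      by_cases hj : j = i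
      · subst hj
        simp [W]
      · simp [W, Function.update_of_ne hj]
    rw [hs, hr, ← src_image_pi, ← rng_image_pi]
    exact (IsBisection.pi G hW).sub_mem_boundaries
  · intro j
    by_cases hj : j = i
    · subst hj
      simp only [S, Function.update_self]
      rwa [← boundaries_eq]
    · simp only [S, Function.update_of_ne hj, closure_chi_clopen]
      trivial

theorem toH0_extProd_congr {f f' : ∀ i, C_c((G i).Obj, ℤ)}
    (h : ∀ i, (G i).toH0 (f i) = (G i).toH0 (f' i)) :
    (pi G).toH0 (extProd G f) = (pi G).toH0 (extProd G f') := by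
  classical
  -- Replace one slot at a time; each replacement changes the product by a boundary.
  suffices key : ∀ s : Finset (Fin n), (pi G).toH0 (extProd G (s.piecewise f f')) =
      (pi G).toH0 (extProd G f') by simpa using key Finset.univ
  intro s
  induction s using Finset.induction_on with
  | empty => simp
  | insert j s hj ih =>
    rw [← ih, toH0_eq_iff, Finset.piecewise_insert]
    have h1 := (extProdMulti G).map_update_sub (s.piecewise f f') j (f j) (f' j)
    have h2 : Function.update (s.piecewise f f') j (f' j) = s.piecewise f f' := by
      rw [Function.update_eq_self_iff, Finset.piecewise_eq_of_notMem _ _ _ hj]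
    rw [h2] at h1
    simp only [extProdMulti_apply] at h1
    rw [← h1]
    refine extProd_mem_boundaries G _ j ?_
    rw [Function.update_self]
    exact toH0_eq_iff.mp (h j)

theorem toH0_extProd_rep_update [DecidableEq (Fin n)] (f : ∀ i, C_c((G i).Obj, ℤ)) (i : Fin n)
    (d : C_c((G i).Obj, ℤ)) : (pi G).toH0 (extProd G fun j =>
        rep (Function.update (fun j => (G j).toH0 (f j)) i ((G i).toH0 d) j)) =
      (pi G).toH0 (extProdMulti G (Function.update f i d)) := by
  refine toH0_extProd_congr G fun j => ?_
  rw [toH0_rep]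
  by_cases hj : j = i
  · subst hj
    simp
  · rw [Function.update_of_ne hj, Function.update_of_ne hj]

/-- The external product on the level of `H₀`. -/
noncomputable def H0Multi : MultilinearMap ℤ (fun i => (G i).H0) (pi G).H0 where
  toFun := fun c => (pi G).toH0 (extProd G fun i => rep (c i))
  map_update_add' := by
    intro _ c i a b
    obtain ⟨a, rfl⟩ := toH0_surjective a
    obtain ⟨b, rfl⟩ := toH0_surjective b
    choose f hf using fun j => toH0_surjective (c j)
    obtain rfl : (fun j => (G j).toH0 (f j)) = c := funext hf
    have key := toH0_extProd_rep_update G f i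
    have hab : (G i).toH0 a + (G i).toH0 b = (G i).toH0 (a + b) :=
      ((G i).toH0Hom.map_add a b).symm
    rw [hab, key, key, key, MultilinearMap.map_update_add]
    exact (pi G).toH0Hom.map_add _ _
  map_update_smul' := by
    intro _ c i r a
    obtain ⟨a, rfl⟩ := toH0_surjective a
    choose f hf using fun j => toH0_surjective (c j)
    obtain rfl : (fun j => (G j).toH0 (f j)) = c := funext hf
    have key := toH0_extProd_rep_update G f i
    have hab : r • (G i).toH0 a = (G i).toH0 (r • a) := ((G i).toH0Hom.map_zsmul r a).symm
    rw [hab, key, key, MultilinearMap.map_update_smul]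
    exact (pi G).toH0Hom.map_zsmul _ _

theorem H0Multi_toH0 (f : ∀ i, C_c((G i).Obj, ℤ)) :
    H0Multi G (fun i => (G i).toH0 (f i)) = (pi G).toH0 (extProd G f) :=
  toH0_extProd_congr G fun _ => toH0_rep _

/-- The quotient map of the functions on the product onto the tensor product of the `H₀`. -/
noncomputable def toTensorH0 : C_c((pi G).Obj, ℤ) →+ ⨂[ℤ] i, (G i).H0 :=
  ((PiTensorProduct.map fun i => (G i).toH0Hom.toIntLinearMap) ∘ₗ
    (extProdEquiv G).symm.toLinearMap).toAddMonoidHom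

theorem toTensorH0_extProd (f : ∀ i, C_c((G i).Obj, ℤ)) :
    toTensorH0 G (extProd G f) = PiTensorProduct.tprod ℤ fun i => (G i).toH0 (f i) := by
  change PiTensorProduct.map _ ((extProdEquiv G).symm (extProd G f)) = _
  rw [extProdEquiv_symm_extProd, PiTensorProduct.map_tprod]
  rfl

/-- Boxes of bisections form a basis stable under intersections, so their boundaries generate.
Source and range of a box are boxes whose sides have the same classes slot by slot, hence give the
same pure tensor. -/
theorem boundaries_le_ker_toTensorH0 : (pi G).boundaries ≤ (toTensorH0 G).ker := by
  rw [boundaries_eq_of_basis (G := pi G) (isTopologicalBasis_univ_pi fun i =>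
    isTopologicalBasis_bisection (G := G i)) ?_
    (univ_pi_inter_mem fun i U hU V hV => IsBisection.inter hU hV), AddSubgroup.closure_le]
  · rintro _ ⟨_, ⟨W, hW, rfl⟩, rfl⟩
    have hW' : ∀ i, IsBisection (W i) := hW
    change toTensorH0 G (chi ((pi G).src '' boxArr G W) - chi ((pi G).rng '' boxArr G W)) = 0
    rw [src_image_pi, rng_image_pi,
      ← extProd_chi G (fun i => (hW' i).isClopen_src.isClosed.isCompact)
        (fun i => (hW' i).isClopen_src.isOpen),
      ← extProd_chi G (fun i => (hW' i).isClopen_rng.isClosed.isCompact)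
        (fun i => (hW' i).isClopen_rng.isOpen), map_sub, toTensorH0_extProd, toTensorH0_extProd,
      sub_eq_zero]
    congr 1
    exact funext fun i => (hW' i).cls_eq
  · rintro _ ⟨W, hW, rfl⟩
    exact IsBisection.pi G hW

/-- The Künneth isomorphism for `H₀`. -/
noncomputable def kunneth : (⨂[ℤ] i, (G i).H0) ≃ₗ[ℤ] (pi G).H0 :=
  LinearEquiv.ofLinearMap (PiTensorProduct.lift (H0Multi G))
    (QuotientAddGroup.lift _ (toTensorH0 G) (boundaries_le_ker_toTensorH0 G)).toIntLinearMap
    (by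
      ext c
      obtain ⟨F, rfl⟩ := toH0_surjective c
      change PiTensorProduct.lift (H0Multi G) (toTensorH0 G F) = (pi G).toH0 F
      obtain ⟨t, rfl⟩ := extProdLift_surjective G F
      induction t using PiTensorProduct.induction_on with
      | smul_tprod r f =>
        rw [map_smul, extProdLift_tprod, map_zsmul, toTensorH0_extProd, map_zsmul,
          PiTensorProduct.lift.tprod, H0Multi_toH0]
        exact ((pi G).toH0Hom.map_zsmul _ _).symm
      | add x y hx hy =>
        rw [map_add, map_add, map_add, hx, hy]
        exact ((pi G).toH0Hom.map_add _ _).symm)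
    (by
      ext c
      choose f hf using fun j => toH0_surjective (c j)
      obtain rfl : (fun j => (G j).toH0 (f j)) = c := funext hf
      simp only [LinearMap.compMultilinearMap_apply, LinearMap.comp_apply,
        PiTensorProduct.lift.tprod, H0Multi_toH0, LinearMap.id_apply]
      exact toTensorH0_extProd G f)

theorem kunneth_tprod (f : ∀ i, C_c((G i).Obj, ℤ)) :
    kunneth G (PiTensorProduct.tprod ℤ fun i => (G i).toH0 (f i)) =
      (pi G).toH0 (extProd G f) := by
  change PiTensorProduct.lift (H0Multi G) _ = _
  rw [PiTensorProduct.lift.tprod, H0Multi_toH0]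

theorem kunneth_symm_toH0_extProd (f : ∀ i, C_c((G i).Obj, ℤ)) :
    (kunneth G).symm ((pi G).toH0 (extProd G f)) =
      PiTensorProduct.tprod ℤ fun i => (G i).toH0 (f i) := by
  rw [LinearEquiv.symm_apply_eq, kunneth_tprod]

end EtaleGroupoid

namespace EtaleGroupoid

universe v

/-! ### Correspondences -/

/-- An action of the groupoid `G` on the unit space of `H` with anchor map `p`, together with a
homomorphism from the action groupoid to `H` that is the identity on units. `R g h` says that `h`
is the image of `(g, s(h))`. -/
structure Corr (G : EtaleGroupoid.{v}) (H : EtaleGroupoid.{u}) where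
  p : H.Obj → G.Obj
  continuous_p : Continuous p
  R : G.Arr → H.Arr → Prop
  src_eq : ∀ {g h}, R g h → G.src g = p (H.src h)
  rng_eq : ∀ {g h}, R g h → G.rng g = p (H.rng h)
  unit : ∀ y, R (G.unit (p y)) (H.unit y)
  inv : ∀ {g h}, R g h → R (G.inv g) (H.inv h)
  mul : ∀ {g h g' h'}, R g h → R g' h' → H.src h = H.rng h' → R (g ⬝ g') (h ⬝ h')
  exists_lift : ∀ g y, G.src g = p y → ∃ h, R g h ∧ H.src h = y
  unique : ∀ {g h h'}, R g h → R g h' → H.src h = H.src h' → h = h'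
  exists_nhds : ∀ g₀, ∃ U V, IsOpen U ∧ g₀ ∈ U ∧ IsOpen V ∧ InjOn H.src V ∧
    ∀ g ∈ U, ∀ h, R g h → h ∈ V

theorem pi_gmul {n : ℕ} {G : Fin n → EtaleGroupoid.{u}} {g h : (pi G).Arr}
    (H : (pi G).src g = (pi G).rng h) (i : Fin n) : (g ⬝ h) i = g i ⬝ h i := by
  rw [gmul_eq H, gmul_eq (congrFun H i)]
  rfl

namespace Corr

/-- The product of correspondences. -/
def pi {n : ℕ} {G : Fin n → EtaleGroupoid.{v}} {H : Fin n → EtaleGroupoid.{u}}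
    (T : ∀ i, Corr (G i) (H i)) : Corr (EtaleGroupoid.pi G) (EtaleGroupoid.pi H) where
  p y i := (T i).p (y i)
  continuous_p := continuous_pi fun i => (T i).continuous_p.comp (continuous_apply i)
  R g h := ∀ i, (T i).R (g i) (h i)
  src_eq h := funext fun i => (T i).src_eq (h i)
  rng_eq h := funext fun i => (T i).rng_eq (h i)
  unit y i := (T i).unit (y i)
  inv h i := (T i).inv (h i)
  mul {g h g' h'} hr hr' H i := by
    rw [pi_gmul H, pi_gmul]
    · exact (T i).mul (hr i) (hr' i) (congrFun H i)
    · refine funext fun i => ?_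
      have h1 := (T i).src_eq (hr i)
      have h2 := (T i).rng_eq (hr' i)
      exact h1.trans ((congrArg (T i).p (congrFun H i)).trans h2.symm)
  exists_lift g y hgy := by
    choose h hR hs using fun i => (T i).exists_lift (g i) (y i) (congrFun hgy i)
    exact ⟨h, hR, funext hs⟩
  unique h h' e := funext fun i => (T i).unique (h i) (h' i) (congrFun e i)
  exists_nhds g₀ := by
    choose U V hU hg hV hi hR using fun i => (T i).exists_nhds (g₀ i)
    refine ⟨boxArr G U, boxArr H V, isOpen_boxArr G hU, fun i _ => hg i, isOpen_boxArr H hV, ?_,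
      fun g hg h hr i _ => hR i (g i) (hg i trivial) (h i) (hr i)⟩
    intro a ha b hb e
    exact funext fun i => hi i (ha i trivial) (hb i trivial) (congrFun e i)

variable {G : EtaleGroupoid.{v}} {H : EtaleGroupoid.{u}} (T : Corr G H)

/-- The set of arrows of `H` given by a set of arrows of `G`. -/
def image (U : Set G.Arr) : Set H.Arr := {h | ∃ g ∈ U, T.R g h}

theorem src_image_image (U : Set G.Arr) : H.src '' T.image U = T.p ⁻¹' (G.src '' U) := by
  ext y
  constructor
  · rintro ⟨h, ⟨g, hg, hr⟩, rfl⟩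
    exact ⟨g, hg, T.src_eq hr⟩
  · rintro ⟨g, hg, e⟩
    obtain ⟨h, hr, rfl⟩ := T.exists_lift g y e
    exact ⟨h, ⟨g, hg, hr⟩, rfl⟩

theorem image_preimage_inv (U : Set G.Arr) : T.image (G.inv ⁻¹' U) = H.inv ⁻¹' T.image U := by
  ext h
  constructor
  · rintro ⟨g, hg, hr⟩
    exact ⟨_, hg, T.inv hr⟩
  · rintro ⟨g, hg, hr⟩
    refine ⟨G.inv g, by simpa using hg, ?_⟩
    simpa using T.inv hr

theorem rng_image_image (U : Set G.Arr) : H.rng '' T.image U = T.p ⁻¹' (G.rng '' U) := by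
  have := T.src_image_image (G.inv ⁻¹' U)
  rwa [image_preimage_inv, src_image_preimage_inv, src_image_preimage_inv] at this

theorem eq_unit {x : G.Obj} {h : H.Arr} (hr : T.R (G.unit x) h) :
    h = H.unit (H.src h) ∧ x = T.p (H.src h) := by
  have hx : x = T.p (H.src h) := by simpa using T.src_eq hr
  subst hx
  exact ⟨T.unique hr (T.unit _) (by simp), rfl⟩

theorem image_unit (C : Set G.Obj) : T.image (G.unit '' C) = H.unit '' (T.p ⁻¹' C) := by
  ext h
  constructor
  · rintro ⟨_, ⟨x, hx, rfl⟩, hr⟩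
    obtain ⟨h1, h2⟩ := T.eq_unit hr
    exact ⟨_, (by rwa [mem_preimage, ← h2]), h1.symm⟩
  · rintro ⟨y, hy, rfl⟩
    exact ⟨_, ⟨_, hy, rfl⟩, T.unit y⟩

theorem src_injOn_image {U : Set G.Arr} (hU : InjOn G.src U) : InjOn H.src (T.image U) := by
  rintro h ⟨g, hg, hr⟩ h' ⟨g', hg', hr'⟩ e
  obtain rfl := hU hg hg' (by rw [T.src_eq hr, T.src_eq hr', e])
  exact T.unique hr hr' e

/-- The image is the range of the section of the source map that lifts the arrows of `U` over the
clopen set `D`. The field `exists_nhds` confines the lifts of nearby arrows to one sheet of the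
source map, which makes this section continuous. A continuous section of a local homeomorphism over
an open set is open. Injectivity of the range map follows by inversion. -/
theorem isBisection_image [CompactSpace H.Obj] {U : Set G.Arr} (hU : IsBisection U) :
    IsBisection (T.image U) := by
  let D : Set H.Obj := T.p ⁻¹' (G.src '' U)
  have hD : IsClopen D := hU.isClopen_src.preimage T.continuous_p
  have hD' : ∀ y ∈ D, ∃ h ∈ T.image U, H.src h = y := by
    intro y hy
    have : y ∈ H.src '' T.image U := by rwa [src_image_image]
    exact this
  choose c hcU hcs using fun y : D => hD' y y.2
  have hc : Continuous c := by
    rw [continuous_iff_continuousAt]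
    intro y₀
    obtain ⟨g₀, hg₀, hr₀⟩ := hcU y₀
    obtain ⟨U₀, V₀, hU₀, hgU₀, hV₀, hinj, hR⟩ := T.exists_nhds g₀
    rw [ContinuousAt, tendsto_nhds]
    intro O hO hyO
    have h1 : IsOpen (G.src '' (U ∩ U₀)) :=
      G.isLocalHomeomorph_src.isOpenMap _ (hU.isOpen.inter hU₀)
    have h2 : IsOpen (H.src '' (O ∩ V₀)) := H.isLocalHomeomorph_src.isOpenMap _ (hO.inter hV₀)
    have h3 : IsOpen ((fun y : D => (y : H.Obj)) ⁻¹'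
        (T.p ⁻¹' (G.src '' (U ∩ U₀)) ∩ H.src '' (O ∩ V₀))) :=
      ((h1.preimage T.continuous_p).inter h2).preimage continuous_subtype_val
    refine Filter.mem_of_superset (h3.mem_nhds ⟨⟨g₀, ⟨hg₀, hgU₀⟩, ?_⟩, ⟨c y₀, ⟨hyO, ?_⟩, hcs y₀⟩⟩) ?_
    · rw [T.src_eq hr₀, hcs]
    · exact hR _ hgU₀ _ hr₀
    · rintro y ⟨⟨g, ⟨hg, hgU₀⟩, e⟩, h, ⟨hhO, hhV⟩, e'⟩
      obtain ⟨g', hg', hr'⟩ := hcU y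
      obtain rfl : g' = g := hU.src_injOn hg' hg (by rw [T.src_eq hr', e, hcs])
      have : c y = h := hinj (hR _ hgU₀ _ hr') hhV (by rw [hcs, e'])
      rw [mem_preimage, this]
      exact hhO
  have hrange : range c = T.image U := by
    refine Subset.antisymm (range_subset_iff.mpr hcU) fun h hh => ?_
    have hy : H.src h ∈ D := by
      rw [← show H.src '' T.image U = D from T.src_image_image U]
      exact ⟨h, hh, rfl⟩
    exact ⟨⟨_, hy⟩, T.src_injOn_image hU.src_injOn (hcU _) hh (hcs _)⟩
  have hcomp : CompactSpace D := isCompact_iff_compactSpace.mp hD.isClosed.isCompact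
  refine ⟨hrange ▸ isCompact_range hc, ?_, ?_, T.src_injOn_image hU.src_injOn⟩
  · rw [← hrange]
    refine (IsLocalHomeomorph.of_comp ?_ H.isLocalHomeomorph_src hc).isOpenMap.isOpen_range
    rw [show H.src ∘ c = Subtype.val from funext hcs]
    exact hD.isOpen.isOpenEmbedding_subtypeVal.isLocalHomeomorph
  · have := T.src_injOn_image hU.preimage_inv.src_injOn
    rw [image_preimage_inv] at this
    intro a ha b hb e
    refine inv_injective (this ?_ ?_ ?_) <;> simpa

/-- `F` is the function on `H` that corresponds to the function `f` on `G`, which is supported in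
the bisection `U`. -/
structure IsTransfer (U : Set G.Arr) (f : C_c(G.Arr, ℂ)) (F : C_c(H.Arr, ℂ)) : Prop where
  isBisection : IsBisection U
  eq_zero : ∀ g, g ∉ U → f g = 0
  apply_eq : ∀ g ∈ U, ∀ h, T.R g h → F h = f g
  apply_eq_zero : ∀ h, (∀ g ∈ U, ¬ T.R g h) → F h = 0

/-- At most one arrow of `U` lies below a given arrow of `H`, since its source is prescribed; `F`
takes the value of `f` there. The image of `U` is clopen, so extension by zero stays continuous. -/
theorem exists_transfer [CompactSpace H.Obj] {U : Set G.Arr} (hU : IsBisection U)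
    {f : C_c(G.Arr, ℂ)} (hf : ∀ g, g ∉ U → f g = 0) : ∃ F, T.IsTransfer U f F := by
  classical
  have hV := T.isBisection_image hU
  have huniq : ∀ {g g' h}, g ∈ U → g' ∈ U → T.R g h → T.R g' h → g = g' := fun hg hg' hr hr' =>
    hU.src_injOn hg hg' ((T.src_eq hr).trans (T.src_eq hr').symm)
  let F : H.Arr → ℂ := fun h => if hh : ∃ g ∈ U, T.R g h then f hh.choose else 0
  have hF : ∀ g ∈ U, ∀ h, T.R g h → F h = f g := by
    intro g hg h hr
    have hh : ∃ g ∈ U, T.R g h := ⟨g, hg, hr⟩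
    simp only [F, dif_pos hh]
    exact congrArg f (huniq hh.choose_spec.1 hg hh.choose_spec.2 hr)
  have hF0 : ∀ h, (∀ g ∈ U, ¬ T.R g h) → F h = 0 := by
    intro h hh
    simp only [F]
    rw [dif_neg]
    rintro ⟨g, hg, hr⟩
    exact hh g hg hr
  have hFc : Continuous F := by
    rw [continuous_iff_continuousAt]
    intro h₀
    by_cases hh : h₀ ∈ T.image U
    · obtain ⟨g₀, hg₀, hr₀⟩ := hh
      rw [ContinuousAt, tendsto_nhds]
      intro W hW hFW
      rw [hF g₀ hg₀ h₀ hr₀] at hFW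
      have hO : IsOpen (U ∩ f ⁻¹' W) := hU.isOpen.inter (hW.preimage f.continuous)
      have h1 : IsOpen (T.image U ∩ (T.p ∘ H.src) ⁻¹' (G.src '' (U ∩ f ⁻¹' W))) :=
        hV.isOpen.inter ((G.isLocalHomeomorph_src.isOpenMap _ hO).preimage
          (T.continuous_p.comp H.continuous_src))
      refine Filter.mem_of_superset (h1.mem_nhds ⟨⟨g₀, hg₀, hr₀⟩, g₀, ⟨hg₀, hFW⟩, T.src_eq hr₀⟩) ?_
      rintro h ⟨⟨g, hg, hr⟩, g', ⟨hg', hW'⟩, e⟩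
      obtain rfl : g = g' := hU.src_injOn hg hg' ((T.src_eq hr).trans e.symm)
      rw [mem_preimage, hF g hg h hr]
      exact hW'
    · have : F =ᶠ[𝓝 h₀] fun _ => 0 := by
        filter_upwards [hV.isClopen.compl.isOpen.mem_nhds hh] with h hh'
        exact hF0 h fun g hg hr => hh' ⟨g, hg, hr⟩
      exact continuousAt_const.congr this.symm
  exact ⟨⟨⟨F, hFc⟩, HasCompactSupport.intro hV.isCompact fun h hh => hF0 h fun g hg hr =>
    hh ⟨g, hg, hr⟩⟩, hU, hf, hF, hF0⟩

theorem isTransfer_charFn [CompactSpace H.Obj] {U : Set G.Arr} (hU : IsBisection U) :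
    T.IsTransfer U (charFn ℂ hU.toCompactOpens)
      (charFn ℂ (T.isBisection_image hU).toCompactOpens) where
  isBisection := hU
  eq_zero g hg := indicator_of_notMem hg _
  apply_eq g hg h hr := by
    have h1 : charFn ℂ hU.toCompactOpens g = 1 := indicator_of_mem hg _
    have hh : h ∈ T.image U := ⟨g, hg, hr⟩
    rw [h1]
    exact indicator_of_mem hh _
  apply_eq_zero h hh := by
    have hn : h ∉ T.image U := fun ⟨g, hg, hr⟩ => hh g hg hr
    exact indicator_of_notMem hn _

end Corr

/-! ### Topological full groups -/

section FullGroup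

variable {G : EtaleGroupoid.{v}} {H : EtaleGroupoid.{u}}

theorem IsTheta.isBisection {U : TopologicalSpace.CompactOpens G.Arr} {α : G.Obj ≃ₜ G.Obj}
    (h : G.IsTheta U α) : IsBisection (U : Set G.Arr) := .of_compactOpens U h.isGSet

theorem exists_isTheta {V : Set G.Arr} (hV : IsBisection V) (hs : G.src '' V = univ)
    (hr : G.rng '' V = univ) : ∃ β, G.IsTheta hV.toCompactOpens β := by
  have : CompactSpace V := isCompact_iff_compactSpace.mp hV.isCompact
  let es : V ≃ₜ G.Obj := (G.continuous_src.comp continuous_subtype_val).homeoOfEquivCompactToT2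
    (f := Equiv.ofBijective (fun g : V => G.src g) ⟨injOn_iff_injective.mp hV.src_injOn,
      fun x => by
        obtain ⟨g, hg, e⟩ := hs.symm ▸ mem_univ x
        exact ⟨⟨g, hg⟩, e⟩⟩)
  let er : V ≃ₜ G.Obj := (G.continuous_rng.comp continuous_subtype_val).homeoOfEquivCompactToT2
    (f := Equiv.ofBijective (fun g : V => G.rng g) ⟨injOn_iff_injective.mp hV.rng_injOn,
      fun x => by
        obtain ⟨g, hg, e⟩ := hr.symm ▸ mem_univ x
        exact ⟨⟨g, hg⟩, e⟩⟩)
  refine ⟨es.symm.trans er, hV.isGSet, hs, hr, fun g hg => ?_⟩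
  have : es.symm (G.src g) = ⟨g, hg⟩ := es.symm_apply_apply ⟨g, hg⟩
  rw [Homeomorph.trans_apply, this]
  rfl

/-- In an essentially principal groupoid, an element of the full group comes from a unique
bisection. -/
theorem IsTheta.subset (hG : G.IsEssentiallyPrincipal) {U U' : TopologicalSpace.CompactOpens G.Arr}
    {α : G.Obj ≃ₜ G.Obj} (h : G.IsTheta U α) (h' : G.IsTheta U' α) :
    (U : Set G.Arr) ⊆ U' := by
  intro g hg
  -- The product of the inverse of `U'` with `U` is open, and it consists of isotropy because both
  -- bisections induce `α`. By essential principality it consists of units, so `g` equals the arrow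
  -- of `U'` with the same range.
  have hW : IsOpen (setMul (G.inv ⁻¹' (U' : Set G.Arr)) U) :=
    isOpen_setMul (U'.isOpen.preimage G.continuous_inv) U.isOpen
  have hiso : setMul (G.inv ⁻¹' (U' : Set G.Arr)) U ⊆ {g | G.rng g = G.src g} := by
    rintro _ ⟨a, ha, b, hb, e, rfl⟩
    change G.rng _ = G.src _
    rw [rng_gmul, src_gmul e]
    have h1 := h'.apply_src _ ha
    have h2 := h.apply_src _ hb
    rw [rng_inv, e, ← h2] at h1
    rw [src_inv] at h1
    exact α.injective h1
  have hunit : setMul (G.inv ⁻¹' (U' : Set G.Arr)) U ⊆ range G.unit := by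
    rw [← hG]
    exact interior_maximal hiso hW
  obtain ⟨g', hg', e⟩ : G.rng g ∈ G.rng '' U' := h'.rng_image.symm ▸ mem_univ _
  obtain ⟨x, hx⟩ := hunit ⟨G.inv g', by simpa using hg', g, hg, by simpa using e, rfl⟩
  have h1 : x = G.src g := by
    have := congrArg G.src hx
    rwa [src_unit, src_gmul (by simpa using e)] at this
  have h2 := gmul_inv_gmul e
  rw [← hx] at h2
  have h3 : G.src g' = x := by
    have := congrArg G.rng hx
    rw [rng_unit, rng_gmul, rng_inv] at this
    exact this.symm
  rw [gmul_unit h3] at h2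
  rwa [← h2]

theorem IsTheta.unique_bisection (hG : G.IsEssentiallyPrincipal)
    {U U' : TopologicalSpace.CompactOpens G.Arr} {α : G.Obj ≃ₜ G.Obj} (h : G.IsTheta U α)
    (h' : G.IsTheta U' α) : U = U' :=
  SetLike.coe_injective (Subset.antisymm (h.subset hG h') (h'.subset hG h))

theorem IsTheta.mul {U V : TopologicalSpace.CompactOpens G.Arr} {α β : G.Obj ≃ₜ G.Obj}
    (h : G.IsTheta U α) (h' : G.IsTheta V β) :
    G.IsTheta (h.isBisection.setMul h'.isBisection).toCompactOpens (α * β) where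
  isGSet := (h.isBisection.setMul h'.isBisection).isGSet
  src_image := by
    change G.src '' setMul (U : Set G.Arr) V = univ
    rw [src_image_setMul, h.src_image, preimage_univ, inter_univ, h'.src_image]
  rng_image := by
    change G.rng '' setMul (U : Set G.Arr) V = univ
    rw [rng_image_setMul, h'.rng_image, preimage_univ, inter_univ, h.rng_image]
  apply_src := by
    rintro _ ⟨a, ha, b, hb, e, rfl⟩
    rw [src_gmul e, rng_gmul]
    change α (β _) = _
    rw [h'.apply_src b hb, ← e, h.apply_src a ha]

variable [CompactSpace H.Obj]

theorem Corr.isTheta_image (T : Corr G H) {U : TopologicalSpace.CompactOpens G.Arr}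
    {α : G.Obj ≃ₜ G.Obj} (h : G.IsTheta U α) :
    ∃ β, H.IsTheta (T.isBisection_image h.isBisection).toCompactOpens β :=
  exists_isTheta _ (by rw [T.src_image_image, h.src_image, preimage_univ])
    (by rw [T.rng_image_image, h.rng_image, preimage_univ])

/-- The homomorphism of topological full groups induced by a correspondence. -/
theorem Corr.exists_fullGroupHom [CompactSpace G.Obj] (T : Corr G H) (hG : G.IsEssentiallyPrincipal) :
    ∃ ι : G.topologicalFullGroup →* H.topologicalFullGroup,
      (Function.Surjective T.p → Function.Injective ι) ∧
      ∀ (α : G.topologicalFullGroup) (U : TopologicalSpace.CompactOpens G.Arr)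
        (h : G.IsTheta U α), H.IsTheta (T.isBisection_image h.isBisection).toCompactOpens
          (ι α : H.Obj ≃ₜ H.Obj) := by
  choose U hU using fun α : G.topologicalFullGroup => α.2
  choose f hf using fun α => T.isTheta_image (hU α)
  -- Uniqueness of the bisection of `α` makes `f α` independent of the choice of `U α`, so products
  -- may be computed with the product bisection.
  have hfU : ∀ (α : G.topologicalFullGroup) (U : TopologicalSpace.CompactOpens G.Arr)
      (h : G.IsTheta U α), H.IsTheta (T.isBisection_image h.isBisection).toCompactOpens (f α) := by
    intro α U' h
    obtain rfl := (hU α).unique_bisection hG h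
    exact hf α
  have hfa : ∀ (α : G.topologicalFullGroup) (U : TopologicalSpace.CompactOpens G.Arr),
      G.IsTheta U α → ∀ h ∈ T.image (U : Set G.Arr), f α (H.src h) = H.rng h :=
    fun α U' h k hk => (hfU α U' h).apply_src k hk
  have hmul : ∀ α β, f (α * β) = f α * f β := by
    intro α β
    ext y
    obtain ⟨h, ⟨g, hg, hr⟩, rfl⟩ : y ∈ H.src '' T.image (U β : Set G.Arr) := by
      rw [T.src_image_image, (hU β).src_image]
      trivial
    obtain ⟨h', ⟨g', hg', hr'⟩, e⟩ : H.rng h ∈ H.src '' T.image (U α : Set G.Arr) := by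
      rw [T.src_image_image, (hU α).src_image]
      trivial
    have e' : G.src g' = G.rng g := by rw [T.src_eq hr', e, T.rng_eq hr]
    have h1 := hfa (α * β) _ ((hU α).mul (hU β)) (h' ⬝ h)
      ⟨g' ⬝ g, ⟨g', hg', g, hg, e', rfl⟩, T.mul hr' hr e⟩
    rw [src_gmul e, rng_gmul] at h1
    rw [h1]
    change _ = f α (f β _)
    rw [hfa β _ (hU β) h ⟨g, hg, hr⟩, ← e, hfa α _ (hU α) h' ⟨g', hg', hr'⟩]
  let ι : G.topologicalFullGroup →* H.topologicalFullGroup :=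
    MonoidHom.mk' (fun α => ⟨f α, _, hf α⟩) fun α β => Subtype.ext (hmul α β)
  refine ⟨ι, fun hp => ?_, hfU⟩
  -- If `f α` is trivial, the lift of an arrow of `U α` has equal source and range, so `α` fixes
  -- every point in the image of `T.p`.
  rw [injective_iff_map_eq_one]
  intro α hα
  have hfα : f α = 1 := congrArg Subtype.val hα
  refine Subtype.ext (Homeomorph.ext fun x => ?_)
  obtain ⟨y, rfl⟩ := hp x
  obtain ⟨h, ⟨g, hg, hr⟩, rfl⟩ : y ∈ H.src '' T.image (U α : Set G.Arr) := by
    rw [T.src_image_image, (hU α).src_image]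
    trivial
  have h1 := hfa α _ (hU α) h ⟨g, hg, hr⟩
  rw [hfα] at h1
  change H.src h = _ at h1
  rw [← T.src_eq hr, (hU α).apply_src g hg, T.rng_eq hr, ← h1, ← T.src_eq hr]
  rfl

end FullGroup

end EtaleGroupoid

/-! ### Operators on sequence spaces -/

section SequenceSpace

open Filter

/-- Finitely supported vectors are dense, since every vector is the sum of its coordinates in norm.
-/
theorem lp.mem_of_forall_single {α : Type*} {E : α → Type*} [DecidableEq α]
    [∀ i, NormedAddCommGroup (E i)] (S : AddSubmonoid (lp E 2)) (hS : IsClosed (S : Set (lp E 2)))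
    (h : ∀ i x, lp.single 2 i x ∈ S) (ξ : lp E 2) : ξ ∈ S :=
  hS.mem_of_tendsto (lp.hasSum_single (by norm_num) ξ)
    (Eventually.of_forall fun s => sum_mem fun i _ => h i _)

theorem lp.clm_ext {α X : Type*} [DecidableEq α] [NormedAddCommGroup X] [NormedSpace ℂ X]
    {A B : ℓ²(α, ℂ) →L[ℂ] X} (h : ∀ i, A (lp.single 2 i 1) = B (lp.single 2 i 1)) : A = B := by
  ext1 ξ
  refine lp.mem_of_forall_single (LinearMap.eqLocus A.toLinearMap B.toLinearMap).toAddSubmonoid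
    (isClosed_eq A.continuous B.continuous) (fun i x => ?_) ξ
  have hx : lp.single 2 i x = x • (lp.single 2 i (1 : ℂ) : ℓ²(α, ℂ)) := by
    rw [← lp.single_smul, smul_eq_mul, mul_one]
  change A _ = B _
  rw [hx, map_smul, map_smul, h]

/-- A uniformly bounded sequence of operators on a sequence space converges strongly to zero if it
does so on the standard basis. -/
theorem lp.tendsto_zero_of_single {α X : Type*} [DecidableEq α] [NormedAddCommGroup X]
    [NormedSpace ℂ X] {D : ℕ → ℓ²(α, ℂ) →L[ℂ] X} {K : ℝ} (hK : ∀ N, ‖D N‖ ≤ K)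
    (h : ∀ i, Tendsto (fun N => D N (lp.single 2 i 1)) atTop (𝓝 0)) (ξ : ℓ²(α, ℂ)) :
    Tendsto (fun N => D N ξ) atTop (𝓝 0) := by
  let S : AddSubmonoid ℓ²(α, ℂ) :=
    { carrier := {ξ | Tendsto (fun N => D N ξ) atTop (𝓝 0)}
      zero_mem' := by simp
      add_mem' := fun {a b} ha hb => by simpa using Tendsto.add ha hb }
  refine lp.mem_of_forall_single S ?_ (fun i x => ?_) ξ
  · refine isClosed_of_closure_subset fun ξ hξ => ?_
    change Tendsto _ _ _
    rw [Metric.tendsto_atTop]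
    intro ε hε
    have hK' : 0 ≤ K := (norm_nonneg _).trans (hK 0)
    obtain ⟨η, hη, hd⟩ := Metric.mem_closure_iff.mp hξ (ε / (2 * (K + 1))) (by positivity)
    obtain ⟨N₀, hN₀⟩ := Metric.tendsto_atTop.mp (show Tendsto _ _ _ from hη) (ε / 2) (by positivity)
    refine ⟨N₀, fun N hN => ?_⟩
    have h1 := hN₀ N hN
    rw [dist_zero_right] at h1 ⊢
    have h2 : D N ξ = D N (ξ - η) + D N η := by rw [map_sub, sub_add_cancel]
    have h3 : ‖D N (ξ - η)‖ ≤ K * ‖ξ - η‖ := (D N).le_of_opNorm_le (hK N) _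
    rw [dist_eq_norm] at hd
    have h4 : K * ‖ξ - η‖ ≤ ε / 2 := by
      calc K * ‖ξ - η‖ ≤ (K + 1) * (ε / (2 * (K + 1))) := by gcongr; linarith
        _ = ε / 2 := by field_simp
    rw [h2]
    exact (norm_add_le _ _).trans_lt (by linarith)
  · have hx : lp.single 2 i x = x • (lp.single 2 i (1 : ℂ) : ℓ²(α, ℂ)) := by
      rw [← lp.single_smul, smul_eq_mul, mul_one]
    change Tendsto _ _ _
    simp only [hx, map_smul]
    simpa using (h i).const_smul x

/-- The amplification `1 ⊗ a` of an operator `a`. -/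
noncomputable def amplify (β : Type*) {X : Type*} [NormedAddCommGroup X] [NormedSpace ℂ X]
    (a : X →L[ℂ] X) : lp (fun _ : β => X) 2 →L[ℂ] lp (fun _ : β => X) 2 :=
  lp.mapCLM 2 (fun _ => a) (norm_nonneg a) fun _ => le_rfl

theorem amplify_apply {β X : Type*} [NormedAddCommGroup X] [NormedSpace ℂ X] (a : X →L[ℂ] X)
    (ξ : lp (fun _ : β => X) 2) (i : β) : amplify β a ξ i = a (ξ i) := rfl

theorem norm_amplify_le {β X : Type*} [NormedAddCommGroup X] [NormedSpace ℂ X] (a : X →L[ℂ] X) :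
    ‖amplify β a‖ ≤ ‖a‖ := lp.norm_mapCLM_le _ _ _ _

theorem amplify_single {β X : Type*} [DecidableEq β] [NormedAddCommGroup X] [NormedSpace ℂ X]
    (a : X →L[ℂ] X) (i : β) (x : X) :
    amplify β a (lp.single 2 i x) = lp.single 2 i (a x) := by
  ext j
  rw [amplify_apply]
  by_cases h : j = i
  · subst h
    simp [lp.single_apply]
  · simp [lp.single_apply, h]

/-! ### Normalised sums over finite subsets of an orthonormal family -/

section Orthonormal

variable {I X : Type*} [NormedAddCommGroup X] [InnerProductSpace ℂ X] {e : I → X}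

theorem Orthonormal.inner_sum_sum [DecidableEq I] (he : Orthonormal ℂ e) (A B : Finset I) :
    inner ℂ (∑ i ∈ A, e i) (∑ i ∈ B, e i) = ((A ∩ B).card : ℂ) := by
  simp only [sum_inner, inner_sum, orthonormal_iff_ite.mp he]
  simp [Finset.inter_comm]

theorem Orthonormal.norm_sum_sub_sum_sq [DecidableEq I] (he : Orthonormal ℂ e) {A B : Finset I}
    {c : ℕ} (hA : A.card = c) (hB : B.card = c) :
    ‖∑ i ∈ A, e i - ∑ i ∈ B, e i‖ ^ 2 = 2 * ((c : ℝ) - (A ∩ B).card) := by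
  rw [@norm_sub_sq ℂ, he.inner_sum_sum, ← @inner_self_eq_norm_sq ℂ, ← @inner_self_eq_norm_sq ℂ,
    he.inner_sum_sum, he.inner_sum_sum, Finset.inter_self, Finset.inter_self, hA, hB]
  simp
  ring

theorem Orthonormal.normalized_sums {J : Type*} (he : Orthonormal ℂ e) {A : J → Finset I} {c : ℕ}
    (hc : 0 < c) (hA : ∀ j, (A j).card = c) (hd : ∀ j k i, i ∈ A j → i ∈ A k → j = k) :
    Orthonormal ℂ fun j => ((Real.sqrt c)⁻¹ : ℂ) • ∑ i ∈ A j, e i := by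
  classical
  rw [orthonormal_iff_ite]
  intro j k
  have hc' : (0 : ℝ) < c := by exact_mod_cast hc
  rw [inner_smul_left, inner_smul_right, he.inner_sum_sum]
  split_ifs with h
  · subst h
    rw [Finset.inter_self, hA]
    simp only [map_inv₀, Complex.conj_ofReal]
    have : ((Real.sqrt c : ℝ) : ℂ) * (Real.sqrt c : ℝ) = c := by
      rw [← Complex.ofReal_mul, Real.mul_self_sqrt hc'.le]
      simp
    rw [← mul_assoc, ← mul_inv, this, inv_mul_cancel₀]
    exact_mod_cast hc.ne'
  · rw [Finset.card_eq_zero.mpr]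
    · simp
    · refine Finset.eq_empty_of_forall_notMem fun i hi => ?_
      rw [Finset.mem_inter] at hi
      exact h (hd _ _ i hi.1 hi.2)

end Orthonormal

/-- The standard basis of `ℓ²(β) ⊗ ℓ²(α)`. -/
noncomputable def doubleSingle {β α : Type*} [DecidableEq β] [DecidableEq α] (q : β × α) :
    lp (fun _ : β => ℓ²(α, ℂ)) 2 := lp.single 2 q.1 (lp.single 2 q.2 1)

theorem orthonormal_doubleSingle {β α : Type*} [DecidableEq β] [DecidableEq α] :
    Orthonormal ℂ (doubleSingle (β := β) (α := α)) := by
  rw [orthonormal_iff_ite]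
  rintro ⟨b, a⟩ ⟨b', a'⟩
  rw [doubleSingle, doubleSingle, lp.inner_single_left]
  by_cases hb : b = b'
  · subst hb
    by_cases ha : a = a'
    · subst ha
      simp [lp.single_apply]
    · simp [lp.single_apply, lp.inner_single_left, ha]
  · simp [lp.single_apply, hb]

end SequenceSpace

namespace EtaleGroupoid

universe v

/-! ### The regular representation -/

section Regular

open Filter

open Classical in
theorem regMatrix_eq {G : EtaleGroupoid.{u}} (f : C_c(G.Arr, ℂ)) (g h : G.Arr) :
    G.regMatrix f g h = if G.src g = G.src h then f (g ⬝ G.inv h) else 0 := by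
  unfold regMatrix
  split_ifs with H
  · rw [gmul_eq]
  · rfl

variable {G : EtaleGroupoid.{u}}

theorem leftReg_single_apply [DecidableEq G.Arr] (f : C_c(G.Arr, ℂ)) (g h : G.Arr) :
    G.leftReg f (lp.single 2 h 1) g = G.regMatrix f g h := by
  rw [leftReg_apply, tsum_eq_single h]
  · simp
  · intro b hb
    simp [hb]

/-- Applying `λ(f)` to the basis vector at the unit `s(g)` and reading the coordinate `g` recovers
`f g`. -/
theorem leftReg_injective : Function.Injective G.leftReg := by
  classical
  intro f f' h
  ext g
  have := congrArg (fun A => A (lp.single 2 (G.unit (G.src g)) 1) g) h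
  simpa [leftReg_single_apply, regMatrix_eq, inv_unit, gmul_unit] using this

theorem ofCc_injective [CompactSpace G.Obj] : Function.Injective G.ofCc :=
  fun _ _ h => leftReg_injective (congrArg Subtype.val h)

theorem leftReg_add (f f' : C_c(G.Arr, ℂ)) : G.leftReg (f + f') = G.leftReg f + G.leftReg f' := by
  classical
  refine lp.clm_ext fun h => ?_
  ext g
  simp only [add_apply, lp.coeFn_add, Pi.add_apply, leftReg_single_apply,
    regMatrix_eq]
  split_ifs <;> simp

theorem leftReg_zero : G.leftReg 0 = 0 := by
  simpa using G.leftReg_add 0 0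

/-- The adjoint `f^*(g) = \overline{f(g⁻¹)}`. -/
noncomputable def starFn (f : C_c(G.Arr, ℂ)) : C_c(G.Arr, ℂ) where
  toFun g := star (f (G.inv g))
  continuous_toFun := (f.continuous.comp G.continuous_inv).star
  hasCompactSupport' := by
    refine HasCompactSupport.intro (f.hasCompactSupport.image G.continuous_inv) fun g hg => ?_
    rw [image_eq_zero_of_notMem_tsupport (f := f) fun h => hg ⟨_, h, inv_inv g⟩, star_zero]

theorem starFn_apply (f : C_c(G.Arr, ℂ)) (g : G.Arr) : starFn f g = star (f (G.inv g)) := rfl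

theorem star_leftReg (f : C_c(G.Arr, ℂ)) : star (G.leftReg f) = G.leftReg (starFn f) := by
  classical
  refine lp.clm_ext fun h => ?_
  ext g
  have h1 : star (G.leftReg f) (lp.single 2 h 1) g = star (G.leftReg f (lp.single 2 g 1) h) := by
    have := ContinuousLinearMap.adjoint_inner_right (G.leftReg f) (lp.single 2 g (1 : ℂ))
      (lp.single 2 h (1 : ℂ))
    rw [lp.inner_single_left, lp.inner_single_right] at this
    simpa [ContinuousLinearMap.star_eq_adjoint] using this
  rw [h1, leftReg_single_apply, leftReg_single_apply, regMatrix_eq, regMatrix_eq]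
  by_cases H : G.src g = G.src h
  · rw [if_pos H, if_pos H.symm, starFn_apply, inv_gmul (by simpa using H), inv_inv]
  · rw [if_neg H, if_neg (Ne.symm H), star_zero]

/-- Over a bisection at most one arrow is composable with `g` on the left, so the operator permutes
basis vectors partially, up to scalars. -/
theorem leftReg_single_of_mem [DecidableEq G.Arr] {U : Set G.Arr} (hU : IsBisection U)
    {f : C_c(G.Arr, ℂ)} (hf : ∀ g, g ∉ U → f g = 0) {k g : G.Arr} (hk : k ∈ U)
    (H : G.src k = G.rng g) :
    G.leftReg f (lp.single 2 g 1) = f k • lp.single 2 (k ⬝ g) 1 := by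
  ext g'
  rw [leftReg_single_apply, regMatrix_eq, lp.coeFn_smul, Pi.smul_apply, lp.single_apply]
  by_cases hg : g' = k ⬝ g
  · subst hg
    rw [if_pos (src_gmul H), gmul_gmul_inv H]
    simp
  · rw [Pi.single_eq_of_ne hg, smul_zero]
    split_ifs with hs
    · refine hf _ fun hm => hg ?_
      have : g' ⬝ G.inv g = k := hU.src_injOn hm hk (by rw [src_gmul (by simpa), src_inv, H])
      rw [← this, gmul_inv_gmul' hs]
    · rfl

theorem leftReg_single_eq_zero [DecidableEq G.Arr] {U : Set G.Arr}
    {f : C_c(G.Arr, ℂ)} (hf : ∀ g, g ∉ U → f g = 0) {g : G.Arr}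
    (hg : ∀ k ∈ U, G.src k ≠ G.rng g) : G.leftReg f (lp.single 2 g 1) = 0 := by
  ext g'
  rw [leftReg_single_apply, regMatrix_eq]
  split_ifs with hs
  · exact hf _ fun hm => hg _ hm (by rw [src_gmul (by simpa), src_inv])
  · rfl

/-- The restriction of a function to a clopen set. -/
noncomputable def restrictFn {U : Set G.Arr} (hU : IsClopen U) (f : C_c(G.Arr, ℂ)) :
    C_c(G.Arr, ℂ) where
  toFun := U.indicator f
  continuous_toFun := hU.continuous_indicator f.continuous
  hasCompactSupport' := f.hasCompactSupport.mono fun g hg => by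
    rw [Function.mem_support] at hg ⊢
    exact fun h => hg (by simp [h])

/-- The compact support is covered by finitely many compact open bisections. As these are clopen,
the function can be cut along them one after another. -/
theorem mem_of_forall_bisection [TotallyDisconnectedSpace G.Obj] (S : AddSubmonoid C_c(G.Arr, ℂ))
    (hS : ∀ U f, IsBisection U → (∀ g, g ∉ U → f g = 0) → f ∈ S) (f : C_c(G.Arr, ℂ)) : f ∈ S := by
  classical
  obtain ⟨t, ht, htf⟩ : ∃ t : Finset (Set G.Arr), (∀ U ∈ t, IsBisection U) ∧
      tsupport f ⊆ ⋃ U ∈ t, U := by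
    have hb : ∀ g : G.Arr, ∃ U : Set G.Arr, IsBisection U ∧ g ∈ U := fun g => by
      obtain ⟨U, hU, hg, -⟩ := exists_bisection_subset isOpen_univ (mem_univ g)
      exact ⟨U, hU, hg⟩
    choose U hU hg using hb
    obtain ⟨s, hs⟩ := f.hasCompactSupport.elim_finite_subcover U (fun g => (hU g).isOpen)
      fun g _ => mem_iUnion.mpr ⟨g, hg g⟩
    refine ⟨s.image U, fun V hV => ?_, hs.trans ?_⟩
    · obtain ⟨g, -, rfl⟩ := Finset.mem_image.mp hV
      exact hU g
    · intro g hg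
      simp only [mem_iUnion] at hg ⊢
      obtain ⟨i, hi, hg⟩ := hg
      exact ⟨U i, Finset.mem_image_of_mem _ hi, hg⟩
  have hf : ∀ g, (∀ U ∈ t, g ∉ U) → f g = 0 := fun g hg =>
    image_eq_zero_of_notMem_tsupport fun h =>
      let ⟨U, hU, h⟩ := mem_iUnion₂.mp (htf h)
      hg U hU h
  clear htf
  induction t using Finset.induction_on generalizing f with
  | empty =>
    have : f = 0 := by
      ext g
      simpa using hf g (by simp)
    rw [this]
    exact S.zero_mem
  | insert U t hUt ih =>
    have hU := ht U (Finset.mem_insert_self _ _)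
    have hsum : f = restrictFn hU.isClopen f + restrictFn hU.isClopen.compl f := by
      ext g
      exact congrFun (indicator_self_add_compl U f).symm g
    rw [hsum]
    refine S.add_mem (hS U _ hU fun g hg => indicator_of_notMem hg _)
      (ih _ (fun V hV => ht V (Finset.mem_insert_of_mem hV)) fun g hg => ?_)
    by_cases hgU : g ∈ U
    · exact indicator_of_notMem (s := Uᶜ) (fun h => h hgU) _
    · refine (indicator_of_mem (show g ∈ Uᶜ from hgU) _).trans (hf g fun V hV => ?_)
      rcases Finset.mem_insert.mp hV with rfl | hV
      · exact hgU
      · exact hg V hV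

end Regular

end EtaleGroupoid

namespace EtaleGroupoid

universe v

/-! ### Amenability -/

section Amenable

open Filter

open Classical in
/-- A sequence of finite sets of arrows with range `x`, for every unit `x`, that is asymptotically
invariant under left translation. -/
structure Folner (G : EtaleGroupoid.{v}) where
  S : ℕ → G.Obj → Finset G.Arr
  c : ℕ → ℕ
  pos : ∀ N, 0 < c N
  card_eq : ∀ N x, (S N x).card = c N
  rng_eq : ∀ {N x g}, g ∈ S N x → G.rng g = x
  tendsto : ∀ k, Tendsto (fun N => (((S N (G.src k)).filter fun g =>
    k ⬝ g ∈ S N (G.rng k)).card : ℝ) / c N) atTop (𝓝 1)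

/-- The product of finite sets of arrows. -/
def boxFinset {n : ℕ} {G : Fin n → EtaleGroupoid.{v}} (s : ∀ i, Finset (G i).Arr) :
    Finset (EtaleGroupoid.pi G).Arr := Fintype.piFinset s

theorem mem_boxFinset {n : ℕ} {G : Fin n → EtaleGroupoid.{v}} {s : ∀ i, Finset (G i).Arr}
    {g : (EtaleGroupoid.pi G).Arr} : g ∈ boxFinset s ↔ ∀ i, g i ∈ s i := Fintype.mem_piFinset

theorem card_boxFinset {n : ℕ} {G : Fin n → EtaleGroupoid.{v}} (s : ∀ i, Finset (G i).Arr) :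
    (boxFinset s).card = ∏ i, (s i).card := Fintype.card_piFinset s

/-- The product of Følner sequences. -/
noncomputable def Folner.pi {n : ℕ} {G : Fin n → EtaleGroupoid.{v}} (F : ∀ i, Folner (G i)) :
    Folner (EtaleGroupoid.pi G) where
  S N x := boxFinset fun i => (F i).S N (x i)
  c N := ∏ i, (F i).c N
  pos N := Finset.prod_pos fun i _ => (F i).pos N
  card_eq N x := (card_boxFinset _).trans (Finset.prod_congr rfl fun i _ => (F i).card_eq N _)
  rng_eq h := funext fun i => (F i).rng_eq (mem_boxFinset.mp h i)
  tendsto k := by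
    classical
    have h := tendsto_finsetProd Finset.univ fun i _ => (F i).tendsto (k i)
    simp only [Finset.prod_const_one] at h
    refine h.congr fun N => ?_
    rw [Finset.prod_div_distrib, Nat.cast_prod, ← Nat.cast_prod, ← card_boxFinset]
    congr 2
    refine congrArg Finset.card (Finset.ext fun g => ?_)
    rw [mem_boxFinset, Finset.mem_filter, mem_boxFinset, mem_boxFinset]
    simp only [Finset.mem_filter, forall_and]
    refine and_congr_right fun hg => forall_congr' fun i => ?_
    rw [pi_gmul (funext fun i => ((F i).rng_eq (hg i)).symm) i]
    rfl

end Amenable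

/-! ### The homomorphism of reduced C⋆-algebras given by a correspondence -/

namespace Corr

section CStar

open Filter

variable {G : EtaleGroupoid.{v}} {H : EtaleGroupoid.{u}} (T : Corr G H)

theorem unique_rng {g : G.Arr} {h h' : H.Arr} (hr : T.R g h) (hr' : T.R g h')
    (e : H.rng h = H.rng h') : h = h' :=
  inv_injective (T.unique (T.inv hr) (T.inv hr') (by simpa))

open Classical in
/-- The lift of `g` to an arrow with source `y`. -/
noncomputable def lift (g : G.Arr) (y : H.Obj) : H.Arr :=
  if h : G.src g = T.p y then (T.exists_lift g y h).choose else H.unit y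

variable {T}

theorem R_lift {g : G.Arr} {y : H.Obj} (h : G.src g = T.p y) : T.R g (T.lift g y) := by
  rw [lift, dif_pos h]
  exact (T.exists_lift g y h).choose_spec.1

theorem src_lift {g : G.Arr} {y : H.Obj} (h : G.src g = T.p y) : H.src (T.lift g y) = y := by
  rw [lift, dif_pos h]
  exact (T.exists_lift g y h).choose_spec.2

theorem lift_eq {g : G.Arr} {h : H.Arr} (hr : T.R g h) : T.lift g (H.src h) = h :=
  T.unique (R_lift (T.src_eq hr)) hr (src_lift (T.src_eq hr))

theorem IsTransfer.starFn {U : Set G.Arr} {f : C_c(G.Arr, ℂ)} {F : C_c(H.Arr, ℂ)}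
    (h : T.IsTransfer U f F) :
    T.IsTransfer (G.inv ⁻¹' U) (EtaleGroupoid.starFn f) (EtaleGroupoid.starFn F) where
  isBisection := h.isBisection.preimage_inv
  eq_zero g hg := by rw [starFn_apply, h.eq_zero _ hg, star_zero]
  apply_eq g hg k hr := by rw [starFn_apply, starFn_apply, h.apply_eq _ hg _ (T.inv hr)]
  apply_eq_zero k hk := by
    rw [starFn_apply, h.apply_eq_zero _ fun g hg hr => hk (G.inv g) (by simpa) ?_, star_zero]
    simpa using T.inv hr

variable (T) (F : Folner G)

open Classical in
/-- The finite set of basis vectors of `ℓ²(H) ⊗ ℓ²(G)` over which the image of the basis vector at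
`h` is spread out. -/
noncomputable def spread (N : ℕ) (h : H.Arr) : Finset (H.Arr × G.Arr) :=
  (F.S N (T.p (H.rng h))).image fun g => (T.lift (G.inv g) (H.rng h) ⬝ h, g)

variable {T F}

theorem card_spread (N : ℕ) (h : H.Arr) : (T.spread F N h).card = F.c N := by
  classical
  rw [spread, Finset.card_image_of_injective _ fun a b e => (Prod.ext_iff.mp e).2, F.card_eq]

theorem src_inv_of_mem {N : ℕ} {y : H.Obj} {g : G.Arr} (hg : g ∈ F.S N (T.p y)) :
    G.src (G.inv g) = T.p y := by
  rw [src_inv, F.rng_eq hg]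

/-- The second coordinate of `q` is `g`, and the range of the first coordinate determines the lift
of `g⁻¹`, because lifts are unique for a given range. Cancelling the lift from the first coordinate
leaves `h`. -/
theorem spread_disjoint {N : ℕ} {h h' : H.Arr} {q : H.Arr × G.Arr} (hq : q ∈ T.spread F N h)
    (hq' : q ∈ T.spread F N h') : h = h' := by
  classical
  obtain ⟨g, hg, rfl⟩ := Finset.mem_image.mp hq
  obtain ⟨g', hg', e⟩ := Finset.mem_image.mp hq'
  obtain ⟨e1, rfl⟩ := Prod.ext_iff.mp e
  have s1 := src_inv_of_mem hg
  have s2 := src_inv_of_mem hg'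
  have hl : T.lift (G.inv g') (H.rng h') = T.lift (G.inv g') (H.rng h) := by
    refine T.unique_rng (R_lift s2) (R_lift s1) ?_
    have := congrArg H.rng e1
    rwa [rng_gmul, rng_gmul] at this
  dsimp only at e1
  rw [hl] at e1
  have hr : H.rng h' = H.rng h := by
    have := congrArg H.src hl
    rwa [src_lift s2, src_lift s1] at this
  exact (gmul_left_cancel ((src_lift s1).trans hr.symm) (src_lift s1) e1).symm

open Classical in
theorem orthonormal_spread (N : ℕ) : Orthonormal ℂ fun h : H.Arr =>
    ((Real.sqrt (F.c N))⁻¹ : ℂ) • ∑ q ∈ T.spread F N h, doubleSingle q :=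
  orthonormal_doubleSingle.normalized_sums (F.pos N) (card_spread N) fun _ _ _ => spread_disjoint

variable (T F)

/-- The isometry `ℓ²(H) → ℓ²(H) ⊗ ℓ²(G)` given by the Følner sequence. -/
noncomputable def isometry (N : ℕ) :
    ℓ²(H.Arr, ℂ) →ₗᵢ[ℂ] lp (fun _ : H.Arr => ℓ²(G.Arr, ℂ)) 2 :=
  (orthonormal_spread (T := T) (F := F) N).orthogonalFamily.linearIsometry

variable {T F}

open Classical in
theorem isometry_single (N : ℕ) (h : H.Arr) : T.isometry F N (lp.single 2 h 1) =
    ((Real.sqrt (F.c N))⁻¹ : ℂ) • ∑ q ∈ T.spread F N h, doubleSingle q := by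
  rw [isometry, OrthogonalFamily.linearIsometry_apply_single]
  simp

variable (T F)

/-- The difference `(1 ⊗ a) W - W b`, where `W` is the isometry. -/
noncomputable def defect (N : ℕ) (a : ℓ²(G.Arr, ℂ) →L[ℂ] ℓ²(G.Arr, ℂ))
    (b : ℓ²(H.Arr, ℂ) →L[ℂ] ℓ²(H.Arr, ℂ)) :
    ℓ²(H.Arr, ℂ) →L[ℂ] lp (fun _ : H.Arr => ℓ²(G.Arr, ℂ)) 2 :=
  (amplify H.Arr a).comp (T.isometry F N).toContinuousLinearMap -
    (T.isometry F N).toContinuousLinearMap.comp b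

variable {T F}

theorem defect_apply (N : ℕ) (a : ℓ²(G.Arr, ℂ) →L[ℂ] ℓ²(G.Arr, ℂ))
    (b : ℓ²(H.Arr, ℂ) →L[ℂ] ℓ²(H.Arr, ℂ)) (ξ : ℓ²(H.Arr, ℂ)) :
    T.defect F N a b ξ = amplify H.Arr a (T.isometry F N ξ) - T.isometry F N (b ξ) := rfl

theorem norm_defect_le (N : ℕ) (a : ℓ²(G.Arr, ℂ) →L[ℂ] ℓ²(G.Arr, ℂ))
    (b : ℓ²(H.Arr, ℂ) →L[ℂ] ℓ²(H.Arr, ℂ)) : ‖T.defect F N a b‖ ≤ ‖a‖ + ‖b‖ := by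
  refine ContinuousLinearMap.opNorm_le_bound _ (by positivity) fun ξ => ?_
  rw [defect_apply, add_mul]
  refine (norm_sub_le _ _).trans (add_le_add ?_ ?_)
  · refine ((amplify H.Arr a).le_of_opNorm_le (norm_amplify_le a) _).trans ?_
    rw [LinearIsometry.norm_map]
  · rw [LinearIsometry.norm_map]
    exact b.le_opNorm ξ

/-- In terms of the action this is `(kg)⁻¹(kh) = g⁻¹h`: translating by `k` leaves the first
coordinate of the spread unchanged and only moves the second from `g` to `kg`. -/
theorem lift_inv_gmul_gmul {k g : G.Arr} {h h' : H.Arr} (hr : T.R k h') (e : H.src h' = H.rng h)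
    (hg : G.rng g = G.src k) : T.lift (G.inv (k ⬝ g)) (H.rng (h' ⬝ h)) ⬝ (h' ⬝ h) =
      T.lift (G.inv g) (H.rng h) ⬝ h := by
  have s1 : G.src (G.inv g) = T.p (H.rng h) := by rw [src_inv, hg, T.src_eq hr, e]
  set l := T.lift (G.inv g) (H.rng h) with hl
  have hsl : H.src l = H.rng h := src_lift s1
  have hsl' : H.src l = H.rng (H.inv h') := by rw [rng_inv, hsl, e]
  have hR := T.mul (R_lift s1) (T.inv hr) hsl'
  rw [← inv_gmul hg.symm] at hR
  have h1 := lift_eq hR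
  rw [src_gmul hsl', src_inv] at h1
  rw [rng_gmul, h1, gmul_assoc hsl' (by simp), inv_gmul_gmul e]

variable [CompactSpace H.Obj]

/-- The defects are uniformly bounded, so basis vectors suffice. If no arrow of `U` starts at the
unit below `h`, both terms vanish. Otherwise there is a single such `k`, with lift `h'`, and both
terms are `f k` times normalised sums over sets of `c N` basis vectors. These sets share at least
the elements `g` of the Følner set with `kg` again in the Følner set, so the squared norm of the
defect is at most `2 ‖f k‖²` times a quantity tending to `0`. -/
theorem tendsto_defect_transfer {U : Set G.Arr} {f : C_c(G.Arr, ℂ)} {f' : C_c(H.Arr, ℂ)}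
    (hf : T.IsTransfer U f f') (ξ : ℓ²(H.Arr, ℂ)) :
    Tendsto (fun N => T.defect F N (G.leftReg f) (H.leftReg f') ξ) atTop (𝓝 0) := by
  classical
  have hf0 : ∀ h, h ∉ T.image U → f' h = 0 := fun h hh =>
    hf.apply_eq_zero h fun g hg hr => hh ⟨g, hg, hr⟩
  refine lp.tendsto_zero_of_single (fun N => norm_defect_le N _ _) (fun h => ?_) ξ
  by_cases hk : ∃ k ∈ U, G.src k = T.p (H.rng h)
  · obtain ⟨k, hkU, hks⟩ := hk
    obtain ⟨h', hr, hs⟩ := T.exists_lift k _ hks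
    have hp : T.p (H.rng (h' ⬝ h)) = G.rng k := by rw [rng_gmul, T.rng_eq hr]
    let j : G.Arr → H.Arr × G.Arr := fun g => (T.lift (G.inv g) (H.rng h) ⬝ h, g)
    let j' : G.Arr → H.Arr × G.Arr := fun g => (T.lift (G.inv g) (H.rng h) ⬝ h, k ⬝ g)
    -- `B N` indexes the basis vectors obtained by applying `1 ⊗ λ(f)` to the spread of `h`; the
    -- other term is indexed by the spread of `h' ⬝ h`.
    let B : ℕ → Finset (H.Arr × G.Arr) := fun N => (F.S N (G.src k)).image j'
    have hj' : ∀ N, InjOn j' (F.S N (G.src k)) := fun N a ha b hb e =>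
      gmul_left_cancel (F.rng_eq ha).symm (F.rng_eq hb).symm (Prod.ext_iff.mp e).2
    have hB : ∀ N, (B N).card = F.c N := fun N => by
      rw [Finset.card_image_of_injOn (hj' N), F.card_eq]
    have hdef : ∀ N, T.defect F N (G.leftReg f) (H.leftReg f') (lp.single 2 h 1) =
        ((Real.sqrt (F.c N))⁻¹ : ℂ) • f k •
          (∑ q ∈ B N, doubleSingle q - ∑ q ∈ T.spread F N (h' ⬝ h), doubleSingle q) := by
      intro N
      rw [defect_apply, leftReg_single_of_mem (T.isBisection_image hf.isBisection) hf0
        ⟨k, hkU, hr⟩ hs, map_smul, isometry_single, isometry_single, hf.apply_eq k hkU h' hr,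
        map_smul, map_sum, smul_comm (f k), smul_sub (f k), smul_sub]
      congr 2
      rw [spread, Finset.sum_image fun a _ b _ e => (Prod.ext_iff.mp e).2, ← hks,
        Finset.sum_image (hj' N), Finset.smul_sum]
      refine Finset.sum_congr rfl fun g hg => ?_
      rw [doubleSingle, amplify_single, leftReg_single_of_mem hf.isBisection hf.eq_zero hkU
        (F.rng_eq hg).symm, lp.single_smul]
      rfl
    have hcard : ∀ N, ((F.S N (G.src k)).filter fun g => k ⬝ g ∈ F.S N (G.rng k)).card ≤
        (B N ∩ T.spread F N (h' ⬝ h)).card := by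
      intro N
      rw [← Finset.card_image_of_injOn ((hj' N).mono (Finset.coe_subset.mpr (Finset.filter_subset _ _)))]
      refine Finset.card_le_card fun q hq => ?_
      obtain ⟨g, hg, rfl⟩ := Finset.mem_image.mp hq
      obtain ⟨hg, hkg⟩ := Finset.mem_filter.mp hg
      refine Finset.mem_inter.mpr ⟨Finset.mem_image_of_mem _ hg, ?_⟩
      refine Finset.mem_image.mpr ⟨k ⬝ g, by rwa [hp], ?_⟩
      rw [lift_inv_gmul_gmul hr hs (F.rng_eq hg)]
    have hlim : Tendsto (fun N => Real.sqrt (2 * ‖f k‖ ^ 2 * (1 -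
        (((F.S N (G.src k)).filter fun g => k ⬝ g ∈ F.S N (G.rng k)).card : ℝ) / F.c N)))
        atTop (𝓝 0) := by
      have := (((F.tendsto k).const_sub 1).const_mul (2 * ‖f k‖ ^ 2)).sqrt
      simpa using this
    refine squeeze_zero_norm (fun N => Real.le_sqrt_of_sq_le ?_) hlim
    have hc : (0 : ℝ) < F.c N := by exact_mod_cast F.pos N
    have hcard' : (((F.S N (G.src k)).filter fun g => k ⬝ g ∈ F.S N (G.rng k)).card : ℝ) ≤
        (B N ∩ T.spread F N (h' ⬝ h)).card := by exact_mod_cast hcard N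
    rw [hdef, norm_smul, norm_smul, mul_pow, mul_pow,
      orthonormal_doubleSingle.norm_sum_sub_sum_sq (hB N) (card_spread N _), norm_inv,
      Complex.norm_real, Real.norm_of_nonneg (Real.sqrt_nonneg _), inv_pow, Real.sq_sqrt hc.le]
    have h1 : 2 * ‖f k‖ ^ 2 * (1 -
        (((F.S N (G.src k)).filter fun g => k ⬝ g ∈ F.S N (G.rng k)).card : ℝ) / F.c N) =
        (F.c N : ℝ)⁻¹ * (‖f k‖ ^ 2 * (2 * (F.c N -
          ((F.S N (G.src k)).filter fun g => k ⬝ g ∈ F.S N (G.rng k)).card))) := by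
      field_simp
    rw [h1]
    gcongr
  · push Not at hk
    have hdef : ∀ N, T.defect F N (G.leftReg f) (H.leftReg f') (lp.single 2 h 1) = 0 := by
      intro N
      rw [defect_apply, leftReg_single_eq_zero hf0, map_zero, sub_zero, isometry_single, map_smul,
        map_sum, Finset.sum_eq_zero, smul_zero]
      · intro q hq
        obtain ⟨g, hg, rfl⟩ := Finset.mem_image.mp hq
        rw [doubleSingle, amplify_single, leftReg_single_eq_zero hf.eq_zero, lp.single_zero]
        intro k hkU
        rw [F.rng_eq hg]
        exact hk k hkU
      · rintro h' ⟨k, hkU, hr⟩ e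
        exact hk k hkU (by rw [← e, T.src_eq hr])
    simp only [hdef]
    exact tendsto_const_nhds

end CStar

end Corr

end EtaleGroupoid

/-! ### The graph of the ⋆-homomorphism -/

namespace EtaleGroupoid.Corr

universe v

section CStarHom

open Filter

variable {G : EtaleGroupoid.{v}} {H : EtaleGroupoid.{u}} (T : Corr G H) (F : Folner G)

/-- The pairs of operators that are asymptotically intertwined by the isometries. -/
def intertwined : Subalgebra ℂ
    ((ℓ²(G.Arr, ℂ) →L[ℂ] ℓ²(G.Arr, ℂ)) × (ℓ²(H.Arr, ℂ) →L[ℂ] ℓ²(H.Arr, ℂ))) where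
  carrier := {q | ∀ ξ, Tendsto (fun N => T.defect F N q.1 q.2 ξ) atTop (𝓝 0)}
  algebraMap_mem' r ξ := by
    have : ∀ N, T.defect F N (algebraMap ℂ _ r) (algebraMap ℂ _ r) ξ = 0 := by
      intro N
      rw [defect_apply, sub_eq_zero]
      refine lp.ext (funext fun i => ?_)
      simp [amplify_apply, Algebra.algebraMap_eq_smul_one]
    exact tendsto_const_nhds.congr fun N => (this N).symm
  add_mem' {q q'} hq hq' ξ := by
    have : ∀ N, T.defect F N (q + q').1 (q + q').2 ξ =
        T.defect F N q.1 q.2 ξ + T.defect F N q'.1 q'.2 ξ := by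
      intro N
      rw [defect_apply, defect_apply, defect_apply, sub_add_sub_comm, ← map_add]
      rfl
    simpa using ((hq ξ).add (hq' ξ)).congr fun N => (this N).symm
  mul_mem' {q q'} hq hq' ξ := by
    have h1 : ∀ N, T.defect F N (q * q').1 (q * q').2 ξ =
        amplify H.Arr q.1 (T.defect F N q'.1 q'.2 ξ) + T.defect F N q.1 q.2 (q'.2 ξ) := by
      intro N
      rw [defect_apply, defect_apply, defect_apply, map_sub, sub_add_sub_cancel]
      rfl
    have h2 := ((amplify H.Arr q.1).continuous.tendsto 0).comp (hq' ξ)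
    rw [map_zero] at h2
    simpa using (h2.add (hq (q'.2 ξ))).congr fun N => (h1 N).symm

variable {T F}

theorem mem_intertwined {a : ℓ²(G.Arr, ℂ) →L[ℂ] ℓ²(G.Arr, ℂ)}
    {b : ℓ²(H.Arr, ℂ) →L[ℂ] ℓ²(H.Arr, ℂ)} : (a, b) ∈ T.intertwined F ↔
      ∀ ξ, Tendsto (fun N => T.defect F N a b ξ) atTop (𝓝 0) := Iff.rfl

/-- The bound `norm_defect_le` is uniform in `N`, so strong convergence of the defects passes to
norm limits of pairs. -/
theorem isClosed_intertwined : IsClosed (T.intertwined F : Set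
    ((ℓ²(G.Arr, ℂ) →L[ℂ] ℓ²(G.Arr, ℂ)) × (ℓ²(H.Arr, ℂ) →L[ℂ] ℓ²(H.Arr, ℂ)))) := by
  refine isClosed_of_closure_subset fun q hq ξ => ?_
  rw [Metric.tendsto_atTop]
  intro ε hε
  obtain ⟨q', hq', hd⟩ := Metric.mem_closure_iff.mp hq (ε / (4 * (‖ξ‖ + 1))) (by positivity)
  obtain ⟨N₀, hN₀⟩ := Metric.tendsto_atTop.mp (hq' ξ) (ε / 2) (by positivity)
  refine ⟨N₀, fun N hN => ?_⟩
  have h1 := hN₀ N hN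
  rw [dist_zero_right] at h1 ⊢
  have h2 : T.defect F N q.1 q.2 ξ =
      T.defect F N (q - q').1 (q - q').2 ξ + T.defect F N q'.1 q'.2 ξ := by
    rw [defect_apply, defect_apply, defect_apply, sub_add_sub_comm, ← map_add]
    congr 2
    · change _ = amplify H.Arr (q.1 - q'.1) _ + _
      refine lp.ext (funext fun i => ?_)
      simp [amplify_apply]
    · change _ = (q.2 - q'.2) ξ + _
      simp
  have h3 := (T.defect F N (q - q').1 (q - q').2).le_of_opNorm_le (norm_defect_le _ _ _) ξ
  rw [dist_eq_norm] at hd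
  have h4 : (‖(q - q').1‖ + ‖(q - q').2‖) * ‖ξ‖ ≤ ε / 2 := by
    have := norm_fst_le (q - q')
    have := norm_snd_le (q - q')
    calc (‖(q - q').1‖ + ‖(q - q').2‖) * ‖ξ‖
        ≤ (ε / (4 * (‖ξ‖ + 1)) + ε / (4 * (‖ξ‖ + 1))) * (‖ξ‖ + 1) := by
          gcongr <;> linarith
      _ = ε / 2 := by field_simp; ring
  rw [h2]
  exact (norm_add_le _ _).trans_lt (by linarith)

/-- With `W` the isometries, `‖b ξ‖ = ‖W b ξ‖` differs from `‖(1 ⊗ a) W ξ‖ ≤ ‖a‖ ‖ξ‖` by at most the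
norm of the defect at `ξ`, which tends to zero. -/
theorem norm_snd_le_of_intertwined {a : ℓ²(G.Arr, ℂ) →L[ℂ] ℓ²(G.Arr, ℂ)}
    {b : ℓ²(H.Arr, ℂ) →L[ℂ] ℓ²(H.Arr, ℂ)} (h : (a, b) ∈ T.intertwined F) : ‖b‖ ≤ ‖a‖ := by
  refine ContinuousLinearMap.opNorm_le_bound _ (norm_nonneg _) fun ξ => ?_
  have h1 : ∀ N, ‖b ξ‖ ≤ ‖a‖ * ‖ξ‖ + ‖T.defect F N a b ξ‖ := by
    intro N
    rw [← (T.isometry F N).norm_map (b ξ), ← (T.isometry F N).norm_map ξ]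
    have h2 : T.isometry F N (b ξ) =
        amplify H.Arr a (T.isometry F N ξ) - T.defect F N a b ξ := by
      rw [defect_apply, sub_sub_cancel]
    rw [h2]
    exact (norm_sub_le _ _).trans (add_le_add_left
      ((amplify H.Arr a).le_of_opNorm_le (norm_amplify_le a) _) _)
  have h3 := ((mem_intertwined.mp h ξ).norm).const_add (‖a‖ * ‖ξ‖)
  rw [norm_zero, add_zero] at h3
  exact ge_of_tendsto' h3 h1

variable (T)

/-- The C⋆-algebra generated by the pairs `(λ(f), λ(F))`, where `F` is the transfer of `f`. -/
noncomputable def graphAlg : StarSubalgebra ℂ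
    ((ℓ²(G.Arr, ℂ) →L[ℂ] ℓ²(G.Arr, ℂ)) × (ℓ²(H.Arr, ℂ) →L[ℂ] ℓ²(H.Arr, ℂ))) :=
  (StarAlgebra.adjoin ℂ {q | ∃ U f f', T.IsTransfer U f f' ∧
    q = (G.leftReg f, H.leftReg f')}).topologicalClosure

variable {T}

theorem mem_graphAlg {U : Set G.Arr} {f : C_c(G.Arr, ℂ)} {f' : C_c(H.Arr, ℂ)}
    (h : T.IsTransfer U f f') : (G.leftReg f, H.leftReg f') ∈ T.graphAlg :=
  StarSubalgebra.le_topologicalClosure _ (StarAlgebra.subset_adjoin ℂ _ ⟨U, f, f', h, rfl⟩)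

variable [CompactSpace H.Obj]

/-- `intertwined` is only shown to be a closed subalgebra, not to be stable under adjoints. This
suffices because the set of generating pairs is stable under adjoints, so that the ⋆-algebra it
generates coincides with the algebra it generates. -/
theorem norm_snd_le_of_graphAlg (F : Folner G) {q} (hq : q ∈ T.graphAlg) : ‖q.2‖ ≤ ‖q.1‖ := by
  have h1 : ((StarAlgebra.adjoin ℂ {q | ∃ U f f', T.IsTransfer U f f' ∧
      q = (G.leftReg f, H.leftReg f')}).toSubalgebra : Set ((ℓ²(G.Arr, ℂ) →L[ℂ] ℓ²(G.Arr, ℂ)) ×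
        (ℓ²(H.Arr, ℂ) →L[ℂ] ℓ²(H.Arr, ℂ)))) ⊆ (T.intertwined F : Set _) := by
    rw [StarAlgebra.adjoin_toSubalgebra, union_eq_self_of_subset_right, SetLike.coe_subset_coe]
    · refine Algebra.adjoin_le ?_
      rintro _ ⟨U, f, f', h, rfl⟩
      exact tendsto_defect_transfer h
    · rintro ⟨a, b⟩ ⟨U, f, f', h, e⟩
      refine ⟨_, _, _, h.starFn, ?_⟩
      rw [← star_star (a, b), e, Prod.star_def, star_leftReg, star_leftReg]
  have h2 : q ∈ T.intertwined F := closure_minimal h1 isClosed_intertwined hq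
  exact norm_snd_le_of_intertwined h2

/-- By the norm estimate the first projection is isometric on the complete algebra `graphAlg`, so
its image is closed. The image contains `λ(f)` for `f` supported in a bisection, hence for all `f`,
hence the whole reduced algebra. -/
theorem exists_mem_graphAlg [CompactSpace G.Obj] [TotallyDisconnectedSpace G.Obj] (F : Folner G)
    {a} (ha : a ∈ G.reducedCStar) : ∃ b, (a, b) ∈ T.graphAlg := by
  let p : StarSubalgebra ℂ (ℓ²(G.Arr, ℂ) →L[ℂ] ℓ²(G.Arr, ℂ)) :=
    T.graphAlg.map (StarAlgHom.fst ℂ _ _)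
  have hp : ∀ a, a ∈ p ↔ ∃ b, (a, b) ∈ T.graphAlg := by
    intro a
    constructor
    · rintro ⟨⟨a, b⟩, h, rfl⟩
      exact ⟨b, h⟩
    · rintro ⟨b, h⟩
      exact ⟨(a, b), h, rfl⟩
  rw [← hp]
  have hcl : IsClosed (p : Set (ℓ²(G.Arr, ℂ) →L[ℂ] ℓ²(G.Arr, ℂ))) := by
    have hc : IsComplete (T.graphAlg : Set ((ℓ²(G.Arr, ℂ) →L[ℂ] ℓ²(G.Arr, ℂ)) ×
        (ℓ²(H.Arr, ℂ) →L[ℂ] ℓ²(H.Arr, ℂ)))) :=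
      (StarSubalgebra.isClosed_topologicalClosure _).isComplete
    have : CompleteSpace T.graphAlg := completeSpace_coe_iff_isComplete.mpr hc
    have hi : Isometry fun q : T.graphAlg => q.1.1 := by
      refine Isometry.of_dist_eq fun q q' => ?_
      rw [Subtype.dist_eq, dist_eq_norm, dist_eq_norm, Prod.norm_def]
      exact (max_eq_left (norm_snd_le_of_graphAlg F (sub_mem q.2 q'.2))).symm
    have hr : (p : Set (ℓ²(G.Arr, ℂ) →L[ℂ] ℓ²(G.Arr, ℂ))) =
        range fun q : T.graphAlg => q.1.1 := by
      ext a
      rw [SetLike.mem_coe, hp]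
      constructor
      · rintro ⟨b, h⟩
        exact ⟨⟨_, h⟩, rfl⟩
      · rintro ⟨⟨⟨a, b⟩, h⟩, rfl⟩
        exact ⟨b, h⟩
    rw [hr]
    exact hi.isClosedEmbedding.isClosed_range
  refine StarSubalgebra.topologicalClosure_minimal ?_ hcl ha
  rw [StarAlgebra.adjoin_le_iff]
  rintro _ ⟨f, rfl⟩
  let S : AddSubmonoid C_c(G.Arr, ℂ) :=
    { carrier := {f | G.leftReg f ∈ p}
      zero_mem' := by
        change _ ∈ p
        rw [leftReg_zero]
        exact p.zero_mem
      add_mem' := fun ha hb => by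
        change _ ∈ p
        rw [leftReg_add]
        exact p.add_mem ha hb }
  refine mem_of_forall_bisection S (fun U f hU hf => ?_) f
  obtain ⟨f', h⟩ := T.exists_transfer hU hf
  exact (hp _).mpr ⟨_, mem_graphAlg h⟩

theorem snd_mem_of_graphAlg {q} (hq : q ∈ T.graphAlg) : q.2 ∈ H.reducedCStar := by
  have h1 : T.graphAlg ≤ H.reducedCStar.comap (StarAlgHom.snd ℂ
      (ℓ²(G.Arr, ℂ) →L[ℂ] ℓ²(G.Arr, ℂ)) (ℓ²(H.Arr, ℂ) →L[ℂ] ℓ²(H.Arr, ℂ))) := by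
    refine StarSubalgebra.topologicalClosure_minimal ?_
      ((StarSubalgebra.isClosed_topologicalClosure _).preimage continuous_snd)
    rw [StarAlgebra.adjoin_le_iff]
    rintro _ ⟨U, f, f', h, rfl⟩
    exact (H.ofCc f').2
  exact h1 hq

/-- A correspondence from an amenable groupoid induces a homomorphism of reduced C⋆-algebras. -/
theorem exists_starAlgHom [CompactSpace G.Obj] [TotallyDisconnectedSpace G.Obj] (T : Corr G H) (F : Folner G) :
    ∃ π : G.reducedCStar →⋆ₐ[ℂ] H.reducedCStar,
      ∀ U f f', T.IsTransfer U f f' → π (G.ofCc f) = H.ofCc f' := by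
  choose b hb using fun a : G.reducedCStar => exists_mem_graphAlg (T := T) (F := F) a.2
  -- The norm estimate applied to a difference shows that the graph is single-valued. Every
  -- algebraic identity for the homomorphism reduces to this.
  have huniq : ∀ (a : G.reducedCStar) q, q ∈ T.graphAlg → q.1 = a → b a = q.2 := by
    intro a q hq e
    have h1 := norm_snd_le_of_graphAlg F (sub_mem (hb a) hq)
    rw [Prod.fst_sub, Prod.snd_sub, e, sub_self, norm_zero] at h1
    exact sub_eq_zero.mp (norm_le_zero_iff.mp h1)
  refine ⟨{ toFun := fun a => ⟨b a, snd_mem_of_graphAlg (hb a)⟩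
            map_one' := Subtype.ext (huniq _ _ (one_mem _) rfl)
            map_mul' := fun a a' => Subtype.ext (huniq _ _ (mul_mem (hb a) (hb a')) rfl)
            map_zero' := Subtype.ext (huniq _ _ (zero_mem _) rfl)
            map_add' := fun a a' => Subtype.ext (huniq _ _ (add_mem (hb a) (hb a')) rfl)
            commutes' := fun r => Subtype.ext (huniq _ _ (algebraMap_mem _ r) rfl)
            map_star' := fun a => Subtype.ext (huniq _ _ (star_mem (hb a)) rfl) }, ?_⟩
  intro U f f' h
  exact Subtype.ext (huniq _ _ (mem_graphAlg h) rfl)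

end CStarHom

end EtaleGroupoid.Corr

/-! ### Paths in irreducible graphs -/

namespace FiniteDigraph

variable {Γ : FiniteDigraph}

theorem adj_pos_iff {ξ η : Γ.V} : 0 < Γ.adj ξ η ↔ ∃ e, Γ.ini e = ξ ∧ Γ.ter e = η := by
  rw [adj, Matrix.of_apply, Nat.card_pos_iff]
  simp only [nonempty_subtype, and_iff_left_iff_imp]
  intro _
  infer_instance

theorem IsIrreducible.reflTransGen (h : Γ.IsIrreducible) (ξ η : Γ.V) :
    Relation.ReflTransGen (fun v w => ∃ e, Γ.ini e = v ∧ Γ.ter e = w) ξ η := by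
  obtain ⟨m, -, hm⟩ := h ξ η
  induction m generalizing η with
  | zero =>
    by_cases he : ξ = η
    · rw [he]
    · simp [he] at hm
  | succ m ih =>
    rw [pow_succ, Matrix.mul_apply, Finset.sum_pos_iff] at hm
    obtain ⟨ζ, -, hζ⟩ := hm
    exact (ih ζ (pos_of_mul_pos_left hζ (Nat.zero_le _))).tail
      (adj_pos_iff.mp (pos_of_mul_pos_right hζ (Nat.zero_le _)))

theorem IsIrreducible.exists_ini (h : Γ.IsIrreducible) (v : Γ.V) : ∃ e, Γ.ini e = v := by
  obtain ⟨m, h0, hm⟩ := h v v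
  obtain ⟨m, rfl⟩ := Nat.exists_eq_succ_of_ne_zero h0.ne'
  rw [Nat.succ_eq_add_one, pow_succ', Matrix.mul_apply, Finset.sum_pos_iff] at hm
  obtain ⟨ζ, -, hζ⟩ := hm
  obtain ⟨e, he, -⟩ := adj_pos_iff.mp (pos_of_mul_pos_left hζ (Nat.zero_le _))
  exact ⟨e, he⟩

theorem IsIrreducible.exists_ter (h : Γ.IsIrreducible) (v : Γ.V) : ∃ e, Γ.ter e = v := by
  obtain ⟨m, h0, hm⟩ := h v v
  obtain ⟨m, rfl⟩ := Nat.exists_eq_succ_of_ne_zero h0.ne'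
  rw [Nat.succ_eq_add_one, pow_succ, Matrix.mul_apply, Finset.sum_pos_iff] at hm
  obtain ⟨ζ, -, hζ⟩ := hm
  obtain ⟨e, -, he⟩ := adj_pos_iff.mp (pos_of_mul_pos_right hζ (Nat.zero_le _))
  exact ⟨e, he⟩

/-- Some vertex has two outgoing edges. -/
theorem IsIrreducible.exists_branch (h : Γ.IsIrreducible) (hp : ¬ Γ.IsPermutation) :
    ∃ e e', e ≠ e' ∧ Γ.ini e = Γ.ini e' := by
  -- If every vertex emitted just one edge, following it would be a surjection of the finite vertex
  -- set, that is, a permutation with matrix `Γ.adj`.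
  by_contra! hinj
  apply hp
  choose out hout using h.exists_ini
  have hini : ∀ {e e'}, Γ.ini e = Γ.ini e' → e = e' := fun {e e'} he => by
    by_contra hne
    exact hinj e e' hne he
  have hsurj : Function.Surjective fun v => Γ.ter (out v) := by
    intro v
    obtain ⟨e, rfl⟩ := h.exists_ter v
    exact ⟨Γ.ini e, congrArg Γ.ter (hini (hout _))⟩
  refine ⟨Equiv.ofBijective _ (Finite.surjective_iff_bijective.mp hsurj), ?_⟩
  ext ξ η
  rw [adj, Matrix.of_apply, Equiv.Perm.permMatrix, PEquiv.toMatrix_apply]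
  simp only [Equiv.toPEquiv_apply, Equiv.ofBijective_apply, Option.mem_some_iff]
  split_ifs with hη
  · rw [Nat.card_eq_one_iff_unique]
    refine ⟨⟨fun a b => Subtype.ext (hini (a.2.1.trans b.2.1.symm))⟩, ⟨out ξ, hout ξ, ?_⟩⟩
    exact hη
  · rw [Nat.card_eq_zero]
    left
    refine ⟨fun a => hη ?_⟩
    rw [← a.2.2]
    exact congrArg Γ.ter (hini ((hout ξ).trans a.2.1.symm))

/-- Every path passes through branching vertices infinitely often. -/
theorem IsIrreducible.exists_branch_of_path (h : Γ.IsIrreducible) (hp : ¬ Γ.IsPermutation)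
    (x : Γ.PathSpace) (K : ℕ) : ∃ j, K ≤ j ∧ ∃ e, e ≠ x.1 j ∧ Γ.ini e = Γ.ini (x.1 j) := by
  by_contra! hx
  obtain ⟨e, e', hne, hee⟩ := h.exists_branch hp
  -- If the path meets no branching after time `K`, it follows the only available edges, so every
  -- vertex reachable from it lies on it; by irreducibility these are all the vertices.
  have key : ∀ v, ∃ j, K ≤ j ∧ v = Γ.ini (x.1 j) := by
    intro v
    induction h.reflTransGen (Γ.ini (x.1 K)) v with
    | refl => exact ⟨K, le_rfl, rfl⟩
    | tail _ hbc ih =>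
      obtain ⟨j, hj, hb⟩ := ih
      obtain ⟨a, ha, rfl⟩ := hbc
      have : a = x.1 j := by
        by_contra hne
        exact hx j hj a hne (ha.trans hb)
      rw [this]
      exact ⟨j + 1, by omega, x.2 j⟩
  obtain ⟨j, hj, he⟩ := key (Γ.ini e)
  have h1 : e = x.1 j := by
    by_contra hne
    exact hx j hj e hne he
  have h2 : e' = x.1 j := by
    by_contra hne
    exact hx j hj e' hne (hee ▸ he)
  exact hne (h1.trans h2.symm)

/-! ### Extending and splicing paths -/

namespace PathSpace

theorem exists_of_ini (h : Γ.IsIrreducible) (v : Γ.V) : ∃ x : Γ.PathSpace, Γ.ini (x.1 0) = v := by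
  choose out hout using h.exists_ini
  refine ⟨⟨fun k => out ((Γ.ter ∘ out)^[k] v), fun k => ?_⟩, hout v⟩
  rw [hout, Function.iterate_succ_apply']
  rfl

theorem exists_cons {e : Γ.E} {x : Γ.PathSpace} (h : Γ.ter e = Γ.ini (x.1 0)) :
    ∃ y : Γ.PathSpace, y.1 0 = e ∧ shift y = x :=
  ⟨⟨fun k => Nat.casesOn k e x.1, fun k => by
    cases k with
    | zero => exact h
    | succ k => exact x.2 k⟩, rfl, rfl⟩

theorem exists_splice (x z : Γ.PathSpace) (m : ℕ) (h : Γ.ini (z.1 0) = Γ.ini (x.1 m)) :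
    ∃ w ∈ cyl x m, shift^[m] w = z := by
  induction m generalizing x with
  | zero => exact ⟨z, fun j hj => absurd hj (Nat.not_lt_zero j), rfl⟩
  | succ m ih =>
    obtain ⟨w, hw, e⟩ := ih (shift x) h
    have hw0 : Γ.ini (w.1 0) = Γ.ini (x.1 1) := by
      cases m with
      | zero =>
        change w = z at e
        rw [e, h]
      | succ m => rw [hw 0 (Nat.succ_pos m)]; rfl
    obtain ⟨y, hy, hs⟩ := exists_cons (e := x.1 0) (x := w) (by rw [hw0]; exact x.2 0)
    refine ⟨y, fun j hj => ?_, by rw [Function.iterate_succ_apply, hs, e]⟩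
    cases j with
    | zero => exact hy
    | succ j =>
      have := hw j (by omega)
      rw [← hs] at this
      exact this

theorem eq_of_mem_cyl {x y : Γ.PathSpace} {m : ℕ} (h : y ∈ cyl x m)
    (hs : shift^[m] y = shift^[m] x) : y = x := by
  refine Subtype.ext (funext fun j => ?_)
  by_cases hj : j < m
  · exact h j hj
  · have := congrArg (fun z => z.1 (j - m)) hs
    simp only [shift_iterate_apply] at this
    rwa [show j - m + m = j by omega] at this

theorem mem_cyl_of_le {x y : Γ.PathSpace} {m m' : ℕ} (h : y ∈ cyl x m) (hm : m' ≤ m) :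
    y ∈ cyl x m' := fun j hj => h j (hj.trans_le hm)

/-- No path is isolated. -/
theorem exists_ne_of_cyl (h : Γ.IsIrreducible) (hp : ¬ Γ.IsPermutation) (x : Γ.PathSpace) (M : ℕ) :
    ∃ z ∈ cyl x M, z ≠ x := by
  obtain ⟨j, hj, e, he, hi⟩ := h.exists_branch_of_path hp x M
  obtain ⟨y, hy⟩ := exists_of_ini h (Γ.ter e)
  obtain ⟨z, hz, rfl⟩ := exists_cons hy.symm
  obtain ⟨w, hw, hs⟩ := exists_splice x z j (by rw [hz, hi])
  refine ⟨w, mem_cyl_of_le hw hj, ?_⟩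
  rintro rfl
  apply he
  rw [← hz, ← hs, shift_iterate_apply, zero_add]

end PathSpace

instance : TotallyDisconnectedSpace Γ.PathSpace :=
  inferInstanceAs (TotallyDisconnectedSpace (Subtype _))

instance : TotallyDisconnectedSpace Γ.sftGroupoid.Obj :=
  inferInstanceAs (TotallyDisconnectedSpace Γ.PathSpace)

open PathSpace SFTArr

/-! ### The groupoid of a shift of finite type is essentially principal -/

/-- If `k ≠ l`, the path `x` satisfies `σᵏ(x) = σˡ(x)` and is eventually periodic. Choose `z ≠ x`
close to `x`, and `w` close to `x` with `σˡ(w) = σᵏ(z)`. The arrow `(z, k - l, w)` lies in `O`, so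
`z = w` obeys the same periodicity. Since `z` agrees with `x` for a long time, this gives `z = x`, a
contradiction. -/
theorem eq_unit_of_isotropy (h : Γ.IsIrreducible) (hp : ¬ Γ.IsPermutation) {O : Set Γ.SFTArr}
    (hO : IsOpen O) (hiso : ∀ g ∈ O, g.1.1 = g.1.2.2) {g : Γ.SFTArr} (hg : g ∈ O) :
    g ∈ range (SFTArr.unit (Γ := Γ)) := by
  obtain ⟨_, ⟨P, Q, k, l, hP, hQ, rfl⟩, ⟨h1, h2, h3, h4⟩, hsub⟩ :=
    isTopologicalBasis_basic.exists_subset_of_mem_open hg hO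
  have hgg := hiso g hg
  set x := g.1.1 with hx
  rw [← hgg] at h2 h4
  obtain ⟨m, hm⟩ := exists_cyl_subset hP h1
  obtain ⟨m', hm'⟩ := exists_cyl_subset hQ h2
  by_cases hkl : k = l
  · refine ⟨x, Subtype.ext (Prod.ext rfl (Prod.ext ?_ hgg))⟩
    rw [h3, hkl, sub_self]
    rfl
  exfalso
  -- The agreement must cover `m` letters to stay in `P`, enough letters for `w` to stay in `Q`, and
  -- the first `k + l` letters, from which the recursion below starts.
  obtain ⟨z, hz, hne⟩ := exists_ne_of_cyl h hp x (m + m' + k + l)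
  have hini : Γ.ini ((shift^[k] z).1 0) = Γ.ini (x.1 l) := by
    rw [shift_iterate_apply, zero_add]
    -- This fails only for `l = m = m' = 0`. Then the letter `z.1 k` is not controlled, but its
    -- initial vertex is the end of the previous edge, which is.
    by_cases hk : k < m + m' + k + l
    · rw [hz k hk]
      have := congrArg (fun z => z.1 0) h4
      simp only [shift_iterate_apply, zero_add] at this
      rw [this]
    · have : l = 0 ∧ m = 0 ∧ m' = 0 := by omega
      obtain ⟨rfl, rfl, rfl⟩ := this
      obtain ⟨k, rfl⟩ := Nat.exists_eq_succ_of_ne_zero hkl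
      have e := congrArg (fun z => z.1 0) h4
      simp only [shift_iterate_apply, zero_add] at e
      rw [← z.2 k, hz k (by omega), x.2 k, e]
  obtain ⟨w, hw, hws⟩ := exists_splice x (shift^[k] z) l hini
  have hwQ : w ∈ cyl x m' := by
    intro j hj
    by_cases hjl : j < l
    · exact hw j hjl
    · have e1 := congrArg (fun z => z.1 (j - l)) hws
      have e2 := congrArg (fun z => z.1 (j - l)) h4
      simp only [shift_iterate_apply] at e1 e2
      rw [show j - l + l = j by omega] at e1 e2
      rw [e1, ← e2, hz _ (by omega)]
  have hzw : z = w := hiso ⟨(z, (k : ℤ) - l, w), k, l, rfl, hws.symm⟩ (hsub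
    ⟨hm (mem_cyl_of_le hz (by omega)), hm' hwQ, rfl, hws.symm⟩)
  subst hzw
  apply hne
  refine Subtype.ext (funext fun j => ?_)
  -- From `k + l` on, the common periodicity relation expresses each letter of either path by an
  -- earlier one.
  induction j using Nat.strong_induction_on with
  | _ j ih =>
    by_cases hj : j < k + l
    · exact hz j (by omega)
    · have e1 := fun i => congrArg (fun z => z.1 i) hws
      have e2 := fun i => congrArg (fun z => z.1 i) h4
      simp only [shift_iterate_apply] at e1 e2
      rcases lt_or_gt_of_ne hkl with hlt | hlt
      · have a := e1 (j - l)
        have b := e2 (j - l)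
        rw [show j - l + l = j by omega] at a b
        rw [a, ← b]
        exact ih _ (by omega)
      · have a := e1 (j - k)
        have b := e2 (j - k)
        rw [show j - k + k = j by omega] at a b
        rw [← a, b]
        exact ih _ (by omega)

end FiniteDigraph

/-- Varying a single coordinate of an interior isotropy element gives an open set of isotropy in one
factor, so the statement for one factor applies to each coordinate. -/
theorem sftProduct_isEssentiallyPrincipal {n : ℕ} {Γ : Fin n → FiniteDigraph}
    (h : ∀ i, (Γ i).IsIrreducible) (hp : ∀ i, ¬ (Γ i).IsPermutation) :
    (sftProduct Γ).IsEssentiallyPrincipal := by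
  refine Subset.antisymm (fun g hg => ?_) (interior_maximal ?_ ?_)
  · have hg' : ∀ i, g i ∈ range (FiniteDigraph.SFTArr.unit (Γ := Γ i)) := by
      intro i
      let f : (Γ i).SFTArr → (sftProduct Γ).Arr := Function.update (β := fun i => (Γ i).SFTArr) g i
      have hc : Continuous f :=
        continuous_const.update (A := fun i => (Γ i).SFTArr) i continuous_id
      have hfg : f (g i) = g := Function.update_eq_self (β := fun i => (Γ i).SFTArr) i g
      have hfi : ∀ a, f a i = a := fun a => Function.update_self (β := fun i => (Γ i).SFTArr) i a g
      refine FiniteDigraph.eq_unit_of_isotropy (h i) (hp i)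
        (O := f ⁻¹' interior {g | (sftProduct Γ).rng g = (sftProduct Γ).src g})
        (isOpen_interior.preimage hc) (fun a ha => ?_) (g := g i) ?_
      · have h1 : f a ∈ {g | (sftProduct Γ).rng g = (sftProduct Γ).src g} := interior_subset ha
        have h2 : (f a i).1.1 = (f a i).1.2.2 := congrFun h1 i
        rwa [hfi] at h2
      · exact (congrArg (· ∈ interior {g | (sftProduct Γ).rng g = (sftProduct Γ).src g}) hfg).mpr hg
    choose x hx using hg'
    exact ⟨x, funext hx⟩
  · rintro _ ⟨x, rfl⟩
    exact ((sftProduct Γ).rng_unit x).trans ((sftProduct Γ).src_unit x).symm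
  · exact (sftProduct Γ).isOpenMap_unit.isOpen_range

/-! ### Amenability of the groupoid of a shift of finite type -/

namespace FiniteDigraph

open PathSpace Filter

variable {Γ : FiniteDigraph}

/-- The arrow `(x, j, σʲ(x))`. -/
def shiftArr (x : Γ.PathSpace) (j : ℕ) : Γ.sftGroupoid.Arr :=
  ⟨(x, j, shift^[j] x), j, 0, by simp, rfl⟩

theorem shiftArr_injective (x : Γ.PathSpace) : Function.Injective (shiftArr x) := fun a b h => by
  have : (a : ℤ) = b := congrArg (fun g : Γ.SFTArr => g.1.2.1) h
  exact_mod_cast this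

open Classical in
/-- The Følner sequence given by the orbit segments of the shift. -/
noncomputable def folner (Γ : FiniteDigraph) : EtaleGroupoid.Folner Γ.sftGroupoid where
  S N x := (Finset.range (N + 1)).image (shiftArr x)
  c N := N + 1
  pos N := N.succ_pos
  card_eq N x := by
    rw [Finset.card_image_of_injective _ (shiftArr_injective x), Finset.card_range]
  rng_eq h := by
    obtain ⟨j, -, rfl⟩ := Finset.mem_image.mp h
    rfl
  tendsto k := by
    obtain ⟨a, b, h1, h2⟩ := k.2
    -- Left translation by an arrow `(x, a - b, y)` with `σᵃ(x) = σᵇ(y)` moves the orbit segment of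
    -- `y` onto that of `x` with index shift `a - b`.
    have hmul : ∀ d, k ⬝ shiftArr (Γ.sftGroupoid.src k) (b + d) =
        shiftArr (Γ.sftGroupoid.rng k) (a + d) := by
      intro d
      rw [EtaleGroupoid.gmul_eq rfl]
      refine Subtype.ext (Prod.ext rfl (Prod.ext ?_ ?_))
      · change k.1.2.1 + ((b + d : ℕ) : ℤ) = ((a + d : ℕ) : ℤ)
        rw [h1]
        push_cast
        ring
      · exact (shift_eq_add h2 d).symm
    -- At most `a + b` of the `N + 1` elements are lost, independently of `N`.
    have hlow : ∀ N : ℕ, (N + 1 : ℝ) - (a + b) ≤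
        (((Finset.range (N + 1)).image (shiftArr (Γ.sftGroupoid.src k))).filter fun g =>
          k ⬝ g ∈ (Finset.range (N + 1)).image (shiftArr (Γ.sftGroupoid.rng k))).card := by
      intro N
      have : N + 1 - (a + b) ≤
        (((Finset.range (N + 1)).image (shiftArr (Γ.sftGroupoid.src k))).filter fun g =>
          k ⬝ g ∈ (Finset.range (N + 1)).image (shiftArr (Γ.sftGroupoid.rng k))).card := by
        rw [← Finset.card_range (N + 1 - (a + b))]
        refine Finset.card_le_card_of_injOn (fun d => shiftArr (Γ.sftGroupoid.src k) (b + d)) (fun d hd => ?_)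
          fun d _ d' _ e => Nat.add_left_cancel (shiftArr_injective _ e)
        have hd' := Finset.mem_range.mp hd
        refine Finset.mem_filter.mpr ⟨Finset.mem_image_of_mem _ (Finset.mem_range.mpr (by omega)), ?_⟩
        rw [hmul]
        exact Finset.mem_image_of_mem _ (Finset.mem_range.mpr (by omega))
      have h3 : N + 1 ≤ (((Finset.range (N + 1)).image (shiftArr (Γ.sftGroupoid.src k))).filter
          fun g => k ⬝ g ∈ (Finset.range (N + 1)).image
            (shiftArr (Γ.sftGroupoid.rng k))).card + (a + b) := by omega
      rw [sub_le_iff_le_add]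
      exact_mod_cast h3
    have hlim : Tendsto (fun N : ℕ => 1 - ((a : ℝ) + b) / ((N : ℝ) + 1)) atTop (𝓝 1) := by
      have := (tendsto_const_div_atTop_nhds_zero_nat ((a : ℝ) + b)).comp (tendsto_add_atTop_nat 1)
      simpa using this.const_sub 1
    refine tendsto_of_tendsto_of_tendsto_of_le_of_le hlim tendsto_const_nhds (fun N => ?_)
      fun N => ?_
    · have hN : (0 : ℝ) < (N : ℝ) + 1 := by positivity
      rw [Nat.cast_succ, le_div_iff₀ hN, sub_mul, one_mul, div_mul_cancel₀ _ hN.ne']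
      exact hlow N
    · refine div_le_one_of_le₀ ?_ (Nat.cast_nonneg _)
      refine Nat.cast_le.mpr ((Finset.card_filter_le _ _).trans (Finset.card_image_le.trans ?_))
      rw [Finset.card_range]

end FiniteDigraph

/-! ### Itineraries -/

open FiniteDigraph PathSpace

/-- A continuous dynamical system that is coded by the paths in a graph: every point carries an
edge, and the points of a given edge correspond to the points of the edges that follow. -/
structure Itinerary (Γ : FiniteDigraph) (Y : Type*) [TopologicalSpace Y] where
  edge : Y → Γ.E
  T : Y → Y
  continuous_edge : Continuous edge
  continuous_T : Continuous T
  ter_edge : ∀ y, Γ.ter (edge y) = Γ.ini (edge (T y))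
  exists_lift : ∀ e y, Γ.ter e = Γ.ini (edge y) → ∃ y', edge y' = e ∧ T y' = y
  inj : ∀ {y y'}, edge y = edge y' → T y = T y' → y = y'

namespace Itinerary

variable {Γ : FiniteDigraph} {Y : Type*} [TopologicalSpace Y] (I : Itinerary Γ Y)

/-- The path of a point. -/
def path (y : Y) : Γ.PathSpace :=
  ⟨fun k => I.edge (I.T^[k] y), fun k => by
    rw [I.ter_edge, ← Function.iterate_succ_apply' I.T]⟩

theorem continuous_path : Continuous I.path :=
  Continuous.subtype_mk (continuous_pi fun k =>
    I.continuous_edge.comp (I.continuous_T.iterate k)) _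

theorem path_T (y : Y) : I.path (I.T y) = shift (I.path y) := rfl

theorem path_iterate (k : ℕ) (y : Y) : I.path (I.T^[k] y) = shift^[k] (I.path y) := by
  induction k generalizing y with
  | zero => rfl
  | succ k ih => rw [Function.iterate_succ_apply, Function.iterate_succ_apply, ih, path_T]

theorem exists_lift_iterate (k : ℕ) {x : Γ.PathSpace} {y : Y} (h : shift^[k] x = I.path y) :
    ∃ y', I.path y' = x ∧ I.T^[k] y' = y := by
  induction k generalizing x with
  | zero => exact ⟨y, h.symm, rfl⟩
  | succ k ih =>
    obtain ⟨z, hz, hzy⟩ := ih (x := shift x) h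
    obtain ⟨y', he, rfl⟩ := I.exists_lift (x.1 0) z
      ((x.2 0).trans (congrArg (fun w => Γ.ini (w.1 0)) hz.symm))
    refine ⟨y', Subtype.ext (funext fun j => ?_), hzy⟩
    cases j with
    | zero => exact he
    | succ j => exact congrArg (fun w => w.1 j) hz

theorem eq_of_iterate {k : ℕ} {y y' : Y} (h : ∀ j < k, (I.path y).1 j = (I.path y').1 j)
    (h' : I.T^[k] y = I.T^[k] y') : y = y' := by
  induction k generalizing y y' with
  | zero => exact h'
  | succ k ih =>
    exact I.inj (h 0 (Nat.succ_pos k)) (ih (fun j hj => h (j + 1) (by omega)) h')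

theorem eq_of_path {k : ℕ} {y y' : Y} (h : I.path y = I.path y')
    (h' : I.T^[k] y = I.T^[k] y') : y = y' := I.eq_of_iterate (fun j _ => by rw [h]) h'

/-- Any finite path can be lifted backwards from a point over its end vertex, so the image is dense;
it is also compact. -/
theorem path_surjective [CompactSpace Y] (h : ∀ v, ∃ y, Γ.ini (I.edge y) = v) :
    Function.Surjective I.path := by
  have key : ∀ m (x : Γ.PathSpace), ∃ y, I.path y ∈ cyl x m := by
    intro m x
    obtain ⟨y, hy⟩ := h (Γ.ini (x.1 m))
    obtain ⟨w, hw, e⟩ := exists_splice x (I.path y) m hy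
    obtain ⟨y', rfl, -⟩ := I.exists_lift_iterate m e
    exact ⟨y', hw⟩
  have hd : Dense (range I.path) := by
    intro x
    rw [mem_closure_iff]
    intro O hO hx
    obtain ⟨m, hm⟩ := exists_cyl_subset hO hx
    obtain ⟨y, hy⟩ := key m x
    exact ⟨_, hm hy, y, rfl⟩
  rw [← range_eq_univ, ← hd.closure_eq, (isCompact_range I.continuous_path).isClosed.closure_eq]

end Itinerary

/-! ### Shift actions and their correspondences -/

namespace EtaleGroupoid

/-- An itinerary on the unit space of a groupoid whose dynamics is implemented by a continuous
section of the range map. -/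
structure ShiftAction (Γ : FiniteDigraph) (H : EtaleGroupoid.{u}) extends
    Itinerary Γ H.Obj where
  τ : H.Obj → H.Arr
  continuous_τ : Continuous τ
  rng_τ : ∀ y, H.rng (τ y) = y
  src_τ : ∀ y, H.src (τ y) = T y

namespace ShiftAction

variable {Γ : FiniteDigraph} {H : EtaleGroupoid.{u}} (A : ShiftAction Γ H)

/-- The arrow from `Tᵏ(y)` to `y`. -/
noncomputable def γ : ℕ → H.Obj → H.Arr
  | 0, y => H.unit y
  | k + 1, y => A.τ y ⬝ γ k (A.T y)

theorem rng_γ (k : ℕ) (y : H.Obj) : H.rng (A.γ k y) = y := by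
  cases k with
  | zero => exact H.rng_unit y
  | succ k => rw [γ, rng_gmul, A.rng_τ]

theorem src_γ (k : ℕ) (y : H.Obj) : H.src (A.γ k y) = A.T^[k] y := by
  induction k generalizing y with
  | zero => exact H.src_unit y
  | succ k ih => rw [γ, src_gmul (by rw [A.src_τ, rng_γ]), ih, Function.iterate_succ_apply]

theorem continuous_γ (k : ℕ) : Continuous (A.γ k) := by
  induction k with
  | zero => exact H.continuous_unit
  | succ k ih =>
    exact A.continuous_τ.gmul (ih.comp A.continuous_T) fun y => by rw [A.src_τ, rng_γ]

theorem γ_add (k d : ℕ) (y : H.Obj) : A.γ (k + d) y = A.γ k y ⬝ A.γ d (A.T^[k] y) := by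
  induction k generalizing y with
  | zero =>
    rw [zero_add, γ, Function.iterate_zero_apply, unit_gmul (A.rng_γ d y)]
  | succ k ih =>
    rw [show k + 1 + d = (k + d) + 1 by omega, γ, γ, ih, Function.iterate_succ_apply,
      gmul_assoc (by rw [A.src_τ, rng_γ]) (by rw [src_γ, rng_γ])]

theorem isOpenMap_γ (k : ℕ) : IsOpenMap (A.γ k) := by
  refine (IsLocalHomeomorph.of_comp ?_ H.isLocalHomeomorph_rng (A.continuous_γ k)).isOpenMap
  rw [show H.rng ∘ A.γ k = id from funext (A.rng_γ k)]
  exact (Homeomorph.refl _).isLocalHomeomorph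

/-- The arrow from `z` to `y` if `Tᵏ(y) = Tˡ(z)`. -/
noncomputable def δ (k l : ℕ) (y z : H.Obj) : H.Arr := A.γ k y ⬝ H.inv (A.γ l z)

variable {A} {k l k' l' : ℕ} {y z w : H.Obj}

theorem composable (h : A.T^[k] y = A.T^[l] z) : H.src (A.γ k y) = H.rng (H.inv (A.γ l z)) := by
  rw [src_γ, rng_inv, src_γ, h]

theorem rng_δ : H.rng (A.δ k l y z) = y := by rw [δ, rng_gmul, rng_γ]

theorem src_δ (h : A.T^[k] y = A.T^[l] z) : H.src (A.δ k l y z) = z := by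
  rw [δ, src_gmul (composable h), src_inv, rng_γ]

theorem inv_δ (h : A.T^[k] y = A.T^[l] z) : H.inv (A.δ k l y z) = A.δ l k z y := by
  rw [δ, δ, inv_gmul (composable h), inv_inv]

/-- Past the meeting point both orbits run along the same arrows, and these cancel. So the lift
depends only on `k - l`. -/
theorem δ_add (h : A.T^[k] y = A.T^[l] z) (d : ℕ) : A.δ (k + d) (l + d) y z = A.δ k l y z := by
  have h1 : H.src (A.γ k y) = H.rng (A.γ d (A.T^[k] y)) := by rw [src_γ, rng_γ]
  have h2 : H.src (A.γ l z) = H.rng (A.γ d (A.T^[l] z)) := by rw [src_γ, rng_γ]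
  rw [δ, γ_add, γ_add, inv_gmul h2, ← h, gmul_assoc h1 (by simp),
    gmul_inv_gmul (by rw [← h1, composable h]), δ]

theorem iterate_add (h : A.T^[k] y = A.T^[l] z) (d : ℕ) :
    A.T^[k + d] y = A.T^[l + d] z := by
  rw [add_comm k, add_comm l, Function.iterate_add_apply, Function.iterate_add_apply, h]

theorem δ_mul (h : A.T^[k] y = A.T^[l] z) (h' : A.T^[k'] z = A.T^[l'] w) :
    A.δ k l y z ⬝ A.δ k' l' z w = A.δ (k + k') (l' + l) y w := by
  have e : A.T^[k + k'] y = A.T^[k' + l] z := by rw [iterate_add h, add_comm]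
  have e' : A.T^[k' + l] z = A.T^[l' + l] w := iterate_add h' l
  rw [← δ_add h k', ← δ_add h' l, add_comm l k', δ, δ, δ,
    gmul_assoc (composable e) (by rw [src_inv, rng_γ, rng_gmul, rng_γ]),
    inv_gmul_gmul (composable e')]

variable (A)

/-- The correspondence from the groupoid of the shift given by a shift action. -/
noncomputable def corr : Corr Γ.sftGroupoid H where
  p := A.path
  continuous_p := A.continuous_path
  R g h := ∃ (y z : H.Obj) (k l : ℕ), A.path y = Γ.sftGroupoid.rng g ∧ A.path z = Γ.sftGroupoid.src g ∧
    g.1.2.1 = (k : ℤ) - l ∧ A.T^[k] y = A.T^[l] z ∧ h = A.δ k l y z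
  src_eq := by
    rintro g h ⟨y, z, k, l, -, hz, -, e, rfl⟩
    rw [src_δ e, hz]
  rng_eq := by
    rintro g h ⟨y, z, k, l, hy, -, -, e, rfl⟩
    rw [rng_δ, hy]
  unit y := ⟨y, y, 0, 0, rfl, rfl, rfl, rfl, by
    change _ = H.unit y ⬝ H.inv (H.unit y)
    rw [inv_unit, gmul_unit (H.src_unit y)]⟩
  inv := by
    rintro g h ⟨y, z, k, l, hy, hz, hn, e, rfl⟩
    exact ⟨z, y, l, k, hz, hy, by change -g.1.2.1 = _; omega, e.symm, inv_δ e⟩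
  mul := by
    rintro g h g' h' ⟨y, z, k, l, hy, hz, hn, e, rfl⟩ ⟨z', w, k', l', hz', hw, hn', e', rfl⟩ H'
    rw [src_δ e, rng_δ] at H'
    subst H'
    refine ⟨y, w, k + k', l' + l, ?_, ?_, ?_, ?_, δ_mul e e'⟩
    · rw [rng_gmul, hy]
    · rw [src_gmul (hz.symm.trans hz'), hw]
    · rw [gmul_eq (hz.symm.trans hz')]
      change g.1.2.1 + g'.1.2.1 = _
      rw [hn, hn']
      push_cast
      ring
    · rw [iterate_add e, add_comm l, iterate_add e']
  exists_lift := by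
    intro g z hz
    obtain ⟨k, l, hn, e⟩ := g.2
    obtain ⟨y, hy, hT⟩ := A.exists_lift_iterate k (x := g.1.1) (y := A.T^[l] z) (by
      rw [e, A.path_iterate, ← hz]
      rfl)
    exact ⟨_, ⟨y, z, k, l, hy, hz.symm, hn, hT, rfl⟩, src_δ hT⟩
  unique := by
    rintro g _ _ ⟨y, z, k, l, hy, hz, hn, e, rfl⟩ ⟨y', z', k', l', hy', hz', hn', e', rfl⟩ hs
    rw [src_δ e, src_δ e'] at hs
    subst hs
    -- Two presentations with the same degree are compared after passing to common exponents; the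
    -- ranges agree because they have the same path and eventually the same orbit.
    have hl : l + k' = l' + k := by omega
    have h1 := iterate_add e k'
    have h2 := iterate_add e' k
    rw [← hl, add_comm k'] at h2
    obtain rfl : y = y' := A.eq_of_path (hy.trans hy'.symm) (h1.trans h2.symm)
    rw [← δ_add e k', ← δ_add e' k, ← hl, add_comm k']
  exists_nhds := by
    intro g₀
    obtain ⟨k, l, hn, e⟩ := g₀.2
    -- On the second set an arrow is determined by its source `z`: its range `y` satisfies `Tᵏ(y) =
    -- Tˡ(z)`, and the first `k` edges of `y` are prescribed by the cylinder.
    refine ⟨SFTArr.basic (cyl g₀.1.1 k) (cyl g₀.1.2.2 l) k l,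
      setMul (A.γ k '' (A.path ⁻¹' cyl g₀.1.1 k)) (H.inv ⁻¹' (A.γ l '' (A.path ⁻¹' cyl g₀.1.2.2 l))),
      SFTArr.isOpen_basic (isOpen_cyl _ _) (isOpen_cyl _ _) _ _,
      ⟨mem_cyl _ _, mem_cyl _ _, hn, e⟩, isOpen_setMul ?_ (IsOpen.preimage H.continuous_inv ?_),
      ?_, ?_⟩
    · exact A.isOpenMap_γ k _ ((isOpen_cyl _ _).preimage A.continuous_path)
    · exact A.isOpenMap_γ l _ ((isOpen_cyl _ _).preimage A.continuous_path)
    · rintro _ ⟨_, ⟨y, hy, rfl⟩, a, ⟨z, hz, ha⟩, ea, rfl⟩ _ ⟨_, ⟨y', hy', rfl⟩, a', ⟨z', hz', ha'⟩,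
        ea', rfl⟩ hs
      have haz : H.src a = z := by rw [← rng_inv, ← ha, rng_γ]
      have haz' : H.src a' = z' := by rw [← rng_inv, ← ha', rng_γ]
      rw [src_gmul ea, src_gmul ea', haz, haz'] at hs
      subst hs
      obtain rfl : a = a' := inv_injective (ha.symm.trans ha')
      have hT : A.T^[k] y = A.T^[k] y' := by rw [← src_γ, ← src_γ, ea, ea']
      obtain rfl : y = y' := A.eq_of_iterate (fun j hj => (hy j hj).trans (hy' j hj).symm) hT
      rfl
    · rintro g ⟨hg1, hg2, hg3, hg4⟩ _ ⟨y, z, k', l', hy, hz, hn', e', rfl⟩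
      -- The lift may be presented with exponents other than `k, l`. If they are larger, `Tᵏ(y)` and
      -- `Tˡ(z)` have the same path and meet later, so they are equal.
      have hT : A.T^[k] y = A.T^[l] z := by
        rcases le_total k' k with hk | hk
        · have := iterate_add e' (k - k')
          rwa [show k' + (k - k') = k by omega, show l' + (k - k') = l by omega] at this
        · refine A.eq_of_path (k := k' - k) ?_ ?_
          · rw [A.path_iterate, A.path_iterate, hy, hz]
            exact hg4
          · rw [← Function.iterate_add_apply, ← Function.iterate_add_apply,
              show k' - k + k = k' by omega, show k' - k + l = l' by omega, e']
      have hδ : A.δ k' l' y z = A.δ k l y z := by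
        have h1 := δ_add hT k'
        have h2 := δ_add e' k
        rw [← h1, ← h2, show l' + k = l + k' by omega, add_comm k]
      rw [hδ]
      refine ⟨_, ⟨y, ?_, rfl⟩, _, ⟨z, ?_, (inv_inv _).symm⟩, composable hT, rfl⟩
      · rw [mem_preimage, hy]
        exact hg1
      · rw [mem_preimage, hz]
        exact hg2

end ShiftAction

end EtaleGroupoid

/-! ### The map on homology induced by a correspondence -/

namespace EtaleGroupoid.Corr

universe v

variable {G : EtaleGroupoid.{v}} {H : EtaleGroupoid.{u}} (T : Corr G H) [CompactSpace H.Obj]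

/-- The composition of functions with the anchor map. -/
noncomputable def pullback : C_c(G.Obj, ℤ) →+ C_c(H.Obj, ℤ) where
  toFun f := ⟨⟨f ∘ T.p, f.continuous.comp T.continuous_p⟩, HasCompactSupport.of_compactSpace _⟩
  map_zero' := rfl
  map_add' _ _ := rfl

theorem pullback_apply (f : C_c(G.Obj, ℤ)) (y : H.Obj) : T.pullback f y = f (T.p y) := rfl

theorem pullback_chi {A : Set G.Obj} (hc : IsCompact A) (ho : IsOpen A) :
    T.pullback (chi A) = chi (T.p ⁻¹' A) := by
  have hcl : IsClopen (T.p ⁻¹' A) := IsClopen.preimage ⟨hc.isClosed, ho⟩ T.continuous_p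
  ext y
  rw [pullback_apply, coe_chi hc ho, chi_coe hcl]
  rfl

variable [TotallyDisconnectedSpace G.Obj]

/-- The preimages under the anchor map of the source and range of `U` are the source and range of
the bisection `T.image U`. -/
theorem boundaries_le_comap : G.boundaries ≤ H.boundaries.comap T.pullback := by
  rw [boundaries_eq, AddSubgroup.closure_le]
  rintro _ ⟨U, hU, rfl⟩
  change T.pullback _ ∈ H.boundaries
  have hU' : IsBisection U := hU
  rw [map_sub, pullback_chi _ (hU'.isCompact.image G.continuous_src)
      (G.isLocalHomeomorph_src.isOpenMap _ hU'.isOpen),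
    pullback_chi _ (hU'.isCompact.image G.continuous_rng)
      (G.isLocalHomeomorph_rng.isOpenMap _ hU'.isOpen),
    ← src_image_image, ← rng_image_image]
  exact (T.isBisection_image hU').sub_mem_boundaries

/-- The homomorphism `[f] ↦ [f ∘ p]`. -/
noncomputable def mapH0 : G.H0 →+ H.H0 := QuotientAddGroup.map _ _ T.pullback T.boundaries_le_comap

theorem mapH0_toH0 (f : C_c(G.Obj, ℤ)) : T.mapH0 (G.toH0 f) = H.toH0 (T.pullback f) := rfl

theorem mapH0_cls {A : Set G.Obj} (hc : IsCompact A) (ho : IsOpen A) :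
    T.mapH0 (cls A) = cls (T.p ⁻¹' A) := by
  rw [cls, mapH0_toH0, T.pullback_chi hc ho, cls]

end EtaleGroupoid.Corr

namespace FiniteDigraph

open EtaleGroupoid PathSpace

variable {Γ : FiniteDigraph}

/-! ### The homology of the groupoid of a shift of finite type -/

theorem continuous_shiftArr : Continuous fun x : Γ.PathSpace => (shiftArr x 1 : Γ.SFTArr) := by
  refine continuous_generateFrom_iff.mpr ?_
  rintro _ ⟨P, Q, k, l, hP, hQ, rfl⟩
  by_cases hkl : k = l + 1
  · subst hkl
    convert hP.inter (hQ.preimage continuous_shift) using 1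
    ext x
    constructor
    · rintro ⟨h1, h2, -, -⟩
      exact ⟨h1, h2⟩
    · rintro ⟨h1, h2⟩
      exact ⟨h1, h2, by change ((1 : ℕ) : ℤ) = _; push_cast; ring, rfl⟩
  · convert isOpen_empty using 1
    refine eq_empty_of_forall_notMem fun x hx => hkl ?_
    have : ((1 : ℕ) : ℤ) = k - l := hx.2.2.1
    omega

/-- The paths that start with the edge `e`. -/
def edgeCyl (e : Γ.E) : Set Γ.sftGroupoid.Obj := {x : Γ.PathSpace | x.1 0 = e}

/-- The paths that start at the vertex `v`. -/
def vertexCyl (v : Γ.V) : Set Γ.sftGroupoid.Obj := {x : Γ.PathSpace | Γ.ini (x.1 0) = v}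

theorem isClopen_edgeCyl (e : Γ.E) : IsClopen (edgeCyl e) :=
  (isClopen_discrete {e}).preimage (continuous_coord 0)

theorem isClopen_vertexCyl (v : Γ.V) : IsClopen (vertexCyl v) :=
  (isClopen_discrete {e | Γ.ini e = v}).preimage (continuous_coord 0)

/-- The shift is injective on paths with a fixed first edge, so the arrows `(x, 1, σ(x))` with `x ∈
P` form a bisection from `Q` to `P`. -/
theorem cls_eq_of_shift {P Q : Set Γ.sftGroupoid.Obj} (hP : IsClopen P) {e : Γ.E}
    (he : P ⊆ edgeCyl e) (hQ : ∀ z : Γ.PathSpace, z ∈ Q ↔ ∃ x ∈ P, shift x = z) :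
    cls P = cls Q := by
  have hU : IsBisection (G := Γ.sftGroupoid) ((fun x : Γ.PathSpace => shiftArr x 1) '' P) := by
    refine ⟨hP.isClosed.isCompact.image continuous_shiftArr, ?_, ?_, ?_⟩
    · have hb : (fun x : Γ.PathSpace => shiftArr x 1) '' P = SFTArr.basic P univ 1 0 := ?_
      · rw [hb]
        exact SFTArr.isOpen_basic hP.isOpen isOpen_univ 1 0
      ext g
      constructor
      · rintro ⟨x, hx, rfl⟩
        exact ⟨hx, trivial, rfl, rfl⟩
      · rintro ⟨h1, -, h3, h4⟩
        exact ⟨g.1.1, h1, Subtype.ext (Prod.ext rfl (Prod.ext (by rw [h3]; rfl) h4))⟩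
    · rintro _ ⟨x, hx, rfl⟩ _ ⟨y, hy, rfl⟩ h
      obtain rfl : x = y := h
      rfl
    · rintro _ ⟨x, hx, rfl⟩ _ ⟨y, hy, rfl⟩ h
      have hs : shift^[1] x = shift^[1] y := h
      obtain rfl : x = y := eq_of_mem_cyl (m := 1) (fun j hj => by
        obtain rfl : j = 0 := by omega
        exact Eq.trans (he hx) (Eq.symm (he hy))) hs
      rfl
  have h1 : Γ.sftGroupoid.src '' ((fun x : Γ.PathSpace => shiftArr x 1) '' P) = Q := by
    ext z
    refine Iff.trans ?_ (hQ z).symm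
    constructor
    · rintro ⟨_, ⟨x, hx, rfl⟩, rfl⟩
      exact ⟨x, hx, rfl⟩
    · rintro ⟨x, hx, rfl⟩
      exact ⟨_, ⟨x, hx, rfl⟩, rfl⟩
  have h2 : Γ.sftGroupoid.rng '' ((fun x : Γ.PathSpace => shiftArr x 1) '' P) = P := by
    ext z
    constructor
    · rintro ⟨_, ⟨x, hx, rfl⟩, rfl⟩
      exact hx
    · exact fun hz => ⟨_, ⟨z, hz, rfl⟩, rfl⟩
  rw [← h1, hU.cls_eq, h2]

theorem cls_edgeCyl (e : Γ.E) : cls (edgeCyl e) = cls (vertexCyl (Γ.ter e)) := by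
  refine cls_eq_of_shift (isClopen_edgeCyl e) Subset.rfl fun z => ?_
  constructor
  · intro hz
    obtain ⟨x, hx, rfl⟩ := exists_cons (x := z) (Eq.symm hz)
    exact ⟨x, hx, rfl⟩
  · rintro ⟨x, rfl, rfl⟩
    exact (x.2 0).symm

/-! ### Cylinder sets and generators of the homology -/

theorem isTopologicalBasis_cyl : TopologicalSpace.IsTopologicalBasis
    (insert ∅ (range fun q : Γ.PathSpace × ℕ => cyl q.1 q.2)) := by
  refine TopologicalSpace.isTopologicalBasis_of_isOpen_of_nhds ?_ ?_
  · rintro _ (rfl | ⟨q, rfl⟩)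
    exacts [isOpen_empty, isOpen_cyl _ _]
  · intro x O hx hO
    obtain ⟨m, hm⟩ := exists_cyl_subset hO hx
    exact ⟨_, Or.inr ⟨(x, m), rfl⟩, mem_cyl _ _, hm⟩

theorem isClopen_cyl (x : Γ.PathSpace) (m : ℕ) : IsClopen (cyl x m) := by
  refine ⟨?_, isOpen_cyl x m⟩
  have : cyl x m = ⋂ j, ⋂ _ : j < m, (fun y : Γ.PathSpace => y.1 j) ⁻¹' {x.1 j} := by
    ext y
    simp [cyl]
  rw [this]
  exact isClosed_iInter fun j => isClosed_iInter fun _ =>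
    (isClosed_discrete _).preimage (continuous_coord j)

theorem cyl_inter_cyl (x y : Γ.PathSpace) {m m' : ℕ} (h : m ≤ m') :
    cyl x m ∩ cyl y m' = ∅ ∨ cyl x m ∩ cyl y m' = cyl y m' := by
  rcases (cyl x m ∩ cyl y m').eq_empty_or_nonempty with h0 | ⟨z, hz, hz'⟩
  · exact Or.inl h0
  · refine Or.inr (inter_eq_right.mpr fun w hw j hj => ?_)
    rw [hw j (by omega), ← hz' j (by omega), hz j hj]

theorem cyl_inter_mem (x y : Γ.PathSpace) (m m' : ℕ) : cyl x m ∩ cyl y m' ∈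
    (insert ∅ (range fun q : Γ.PathSpace × ℕ => cyl q.1 q.2) : Set (Set Γ.PathSpace)) := by
  rcases le_total m m' with h | h
  · rcases cyl_inter_cyl x y h with h | h <;> rw [h]
    exacts [Or.inl rfl, Or.inr ⟨(y, m'), rfl⟩]
  · rw [inter_comm]
    rcases cyl_inter_cyl y x h with h | h <;> rw [h]
    exacts [Or.inl rfl, Or.inr ⟨(x, m), rfl⟩]

/-- A homomorphism on `H₀` is determined by its values on the cylinders of length one. -/
theorem H0_hom_ext {M : Type*} [AddCommGroup M] {φ ψ : Γ.sftGroupoid.H0 →+ M}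
    (h : ∀ e, φ (cls (edgeCyl e)) = ψ (cls (edgeCyl e))) : φ = ψ := by
  have hcyl : ∀ m (x : Γ.PathSpace), φ (cls (G := Γ.sftGroupoid) (cyl x (m + 1))) =
      ψ (cls (G := Γ.sftGroupoid) (cyl x (m + 1))) := by
    intro m
    induction m with
    | zero =>
      intro x
      have : (cyl x (0 + 1) : Set Γ.sftGroupoid.Obj) = edgeCyl (x.1 0) := by
        ext y
        constructor
        · exact fun hy => hy 0 (by omega)
        · intro hy j hj
          obtain rfl : j = 0 := by omega
          exact hy
      rw [this, h]
    | succ m ih =>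
      intro x
      -- Deleting the first edge does not change the class, so longer cylinders reduce to cylinders
      -- of length one.
      have hsh := cls_eq_of_shift (P := cyl x (m + 1 + 1)) (Q := cyl (shift x) (m + 1))
        (isClopen_cyl x (m + 1 + 1)) (e := x.1 0) (fun y hy => hy 0 (by omega)) fun z => by
          constructor
          · intro hz
            obtain ⟨y, hy, rfl⟩ := exists_cons (e := x.1 0) (x := z)
              (by rw [hz 0 (by omega)]; exact x.2 0)
            refine ⟨y, fun j hj => ?_, rfl⟩
            cases j with
            | zero => exact hy
            | succ j => exact hz j (by omega)
          · rintro ⟨y, hy, rfl⟩ j hj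
            exact hy (j + 1) (by omega)
      rw [hsh]
      exact ih _
  have huniv : φ (cls (univ : Set Γ.sftGroupoid.Obj)) = ψ (cls univ) := by
    have : (univ : Set Γ.sftGroupoid.Obj) = ⋃ e ∈ (Finset.univ : Finset Γ.E), edgeCyl e := by
      refine (eq_univ_of_forall fun x => ?_).symm
      exact mem_iUnion₂.mpr ⟨_, Finset.mem_univ (x.1 0), rfl⟩
    rw [this, ← sum_cls _ isClopen_edgeCyl, map_sum, map_sum]
    · exact Finset.sum_congr rfl fun e _ => h e
    · intro e e' hne
      exact disjoint_left.mpr fun x hx hx' => hne (Eq.trans (Eq.symm hx) hx')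
  suffices φ.comp Γ.sftGroupoid.toH0Hom = ψ.comp Γ.sftGroupoid.toH0Hom by
    refine AddMonoidHom.ext fun c => ?_
    obtain ⟨f, rfl⟩ := toH0_surjective c
    exact DFunLike.congr_fun this f
  refine AddMonoidHom.eq_of_eqOn_dense (closure_chi_eq_top (Y := Γ.sftGroupoid.Obj)
    isTopologicalBasis_cyl ?_ ?_) ?_
  · rintro _ (rfl | ⟨⟨x, m⟩, rfl⟩)
    · exact isCompact_empty
    · exact (isClopen_cyl x m).isClosed.isCompact
  · rintro _ (rfl | ⟨⟨x, m⟩, rfl⟩) _ (rfl | ⟨⟨x', m'⟩, rfl⟩)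
    · exact Or.inl (inter_self _)
    · exact Or.inl (empty_inter _)
    · exact Or.inl (inter_empty _)
    · exact cyl_inter_mem x x' m m'
  · rintro _ ⟨_, (rfl | ⟨⟨x, m⟩, rfl⟩), rfl⟩
    · change φ (cls (∅ : Set Γ.sftGroupoid.Obj)) = ψ (cls ∅)
      rw [cls_empty, map_zero, map_zero]
    · cases m with
      | zero =>
        have : (cyl x 0 : Set Γ.PathSpace) = univ :=
          eq_univ_of_forall fun y j hj => absurd hj (Nat.not_lt_zero j)
        change φ (cls (G := Γ.sftGroupoid) (cyl x 0)) = ψ (cls (G := Γ.sftGroupoid) (cyl x 0))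
        rw [this]
        exact huniv
      | succ m => exact hcyl m x

end FiniteDigraph

/-! ### Existence of shift actions -/

namespace EtaleGroupoid

open FiniteDigraph PathSpace

variable {Γ : FiniteDigraph} {H : EtaleGroupoid.{u}}

/-- A family of bisections with the incidence relations of the edges of a graph gives a shift
action. -/
theorem exists_shiftAction_of_bisections {S : Γ.E → Set H.Arr} {D : Γ.V → Set H.Obj}
    (hS : ∀ e, IsBisection (S e)) (hD : ∀ v w x, x ∈ D v → x ∈ D w → v = w)
    (hrD : ∀ e, H.rng '' S e ⊆ D (Γ.ini e)) (hsD : ∀ e, H.src '' S e = D (Γ.ter e))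
    (hr : ∀ e e' x, x ∈ H.rng '' S e → x ∈ H.rng '' S e' → e = e')
    (hu : ⋃ e, H.rng '' S e = univ) :
    ∃ A : ShiftAction Γ H, ∀ e y, A.edge y = e ↔ y ∈ H.rng '' S e := by
  have hex : ∀ y, ∃ e, y ∈ H.rng '' S e := fun y => mem_iUnion.mp (hu.symm ▸ mem_univ y)
  choose edge hedge using hex
  have hiff : ∀ e y, edge y = e ↔ y ∈ H.rng '' S e := fun e y =>
    ⟨fun h => h ▸ hedge y, fun h => hr _ _ y (hedge y) h⟩
  have hec : Continuous edge := by
    rw [continuous_discrete_rng]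
    intro e
    convert (hS e).isClopen_rng.isOpen using 1
    ext y
    exact hiff e y
  have hcomp : CompactSpace (⋃ e, S e : Set H.Arr) :=
    isCompact_iff_compactSpace.mp (isCompact_iUnion fun e => (hS e).isCompact)
  -- The ranges partition the unit space, so exactly one arrow of the union ends at each unit. The
  -- inverse of this homeomorphism is `τ`, and the dynamics takes a unit to the source of that
  -- arrow.
  let er : (⋃ e, S e : Set H.Arr) ≃ₜ H.Obj :=
    (H.continuous_rng.comp continuous_subtype_val).homeoOfEquivCompactToT2
      (f := Equiv.ofBijective (fun g : (⋃ e, S e : Set H.Arr) => H.rng g) ⟨by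
        rintro ⟨g, hg⟩ ⟨g', hg'⟩ h
        obtain ⟨e, he⟩ := mem_iUnion.mp hg
        obtain ⟨e', he'⟩ := mem_iUnion.mp hg'
        change H.rng g = H.rng g' at h
        obtain rfl := hr e e' (H.rng g) ⟨g, he, rfl⟩ ⟨g', he', h.symm⟩
        exact Subtype.ext ((hS e).rng_injOn he he' h), fun y => by
        obtain ⟨g, hg, rfl⟩ := hedge y
        exact ⟨⟨g, mem_iUnion.mpr ⟨_, hg⟩⟩, rfl⟩⟩)
  let τ : H.Obj → H.Arr := fun y => (er.symm y : H.Arr)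
  have hτ : ∀ y, H.rng (τ y) = y := fun y => er.apply_symm_apply y
  have hτS : ∀ y, τ y ∈ S (edge y) := by
    intro y
    obtain ⟨e, he⟩ := mem_iUnion.mp (er.symm y).2
    rwa [(hiff e y).mpr ⟨_, he, hτ y⟩]
  have hτc : Continuous τ := continuous_subtype_val.comp er.symm.continuous
  have hsrc : ∀ y, H.src (τ y) ∈ D (Γ.ter (edge y)) := fun y => by
    rw [← hsD]
    exact ⟨_, hτS y, rfl⟩
  have hini : ∀ y, y ∈ D (Γ.ini (edge y)) := fun y => hrD _ (hedge y)
  refine ⟨{ edge := edge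
            T := fun y => H.src (τ y)
            continuous_edge := hec
            continuous_T := H.continuous_src.comp hτc
            ter_edge := fun y => hD _ _ _ (hsrc y) (hini _)
            exists_lift := ?_
            inj := ?_
            τ := τ
            continuous_τ := hτc
            rng_τ := hτ
            src_τ := fun _ => rfl }, hiff⟩
  · intro e y h
    obtain ⟨g, hg, rfl⟩ : y ∈ H.src '' S e := by
      rw [hsD, h]
      exact hini y
    have he : edge (H.rng g) = e := (hiff _ _).mpr ⟨g, hg, rfl⟩
    refine ⟨H.rng g, he, ?_⟩
    have : τ (H.rng g) = g := (hS e).rng_injOn (he ▸ hτS _) hg (hτ _)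
    rw [this]
  · intro y y' h h'
    have : τ y = τ y' := (hS (edge y)).src_injOn (hτS y) (h ▸ hτS y') h'
    rw [← hτ y, ← hτ y', this]

theorem iUnion_vertexCyl : ⋃ v ∈ (Finset.univ : Finset Γ.V), vertexCyl v = univ :=
  eq_univ_of_forall fun x =>
    mem_iUnion₂.mpr ⟨Γ.ini ((show Γ.PathSpace from x).1 0), Finset.mem_univ _, rfl⟩

theorem iUnion_edgeCyl (v : Γ.V) :
    ⋃ e ∈ Finset.univ.filter (fun e : Γ.E => Γ.ini e = v), edgeCyl e = vertexCyl v := by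
  refine Subset.antisymm (iUnion₂_subset fun e he => ?_) fun x hx => ?_
  · rintro x rfl
    exact (Finset.mem_filter.mp he).2
  · exact mem_iUnion₂.mpr ⟨(show Γ.PathSpace from x).1 0,
      Finset.mem_filter.mpr ⟨Finset.mem_univ _, hx⟩, rfl⟩

/-- Every homomorphism from `H₀` of the groupoid of a shift of finite type to `H₀` of a minimal
purely infinite groupoid that preserves the classes of the units comes from a shift action. -/
theorem exists_shiftAction [IsCantorSet H.Obj] (hΓ : Γ.IsIrreducible) (hper : ¬ Γ.IsPermutation)
    (hm : H.IsMinimal) (hp : H.IsPurelyInfinite) (φ : Γ.sftGroupoid.H0 →+ H.H0)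
    (hφ : φ (cls univ) = cls univ) :
    ∃ A : ShiftAction Γ H, Function.Surjective A.path ∧ A.corr.mapH0 = φ := by
  classical
  have hne : Nonempty H.Obj := IsCantorSet.nonempty
  obtain ⟨e₀, -⟩ := hΓ.exists_branch hper
  have hsumV : ∑ᶠ v ∈ (univ : Set Γ.V), φ (cls (vertexCyl v)) = cls univ := by
    rw [← Finset.coe_univ, finsum_mem_coe_finset, ← map_sum, sum_cls _ isClopen_vertexCyl,
      iUnion_vertexCyl, hφ]
    intro v w hvw
    exact disjoint_left.mpr fun x hx hx' => hvw (Eq.trans (Eq.symm hx) hx')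
  -- Copy the partition of the path space by initial vertices; the required classes add up correctly
  -- because `φ` preserves the class of the unit space.
  obtain ⟨D, hD, hDd, hDu⟩ := exists_partition_cls hm hp (s := (univ : Set Γ.V))
    ⟨Γ.ini e₀, trivial⟩ (fun v => φ (cls (vertexCyl v))) isClopen_univ univ_nonempty hsumV
  have hsumE : ∀ v, ∑ᶠ e ∈ {e : Γ.E | Γ.ini e = v}, φ (cls (edgeCyl e)) = cls (D v) := by
    intro v
    have hs : {e : Γ.E | Γ.ini e = v} = (Finset.univ.filter fun e : Γ.E => Γ.ini e = v) := by
      ext e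
      simp
    rw [hs, finsum_mem_coe_finset, ← map_sum, sum_cls _ isClopen_edgeCyl, iUnion_edgeCyl,
      (hD v trivial).2.2]
    intro e e' hne
    exact disjoint_left.mpr fun x hx hx' => hne (Eq.trans (Eq.symm hx) hx')
  choose R hR hRd hRu using fun v => exists_partition_cls hm hp
    (s := {e : Γ.E | Γ.ini e = v}) (hΓ.exists_ini v) (fun e => φ (cls (edgeCyl e)))
    (hD v trivial).1 (hD v trivial).2.1 (hsumE v)
  -- The shift relation `cls_edgeCyl` is what makes the two classes equal, so each edge can be
  -- realised by a bisection.
  choose S hS hSs hSr using fun e => exists_bisection_of_cls_eq hm hp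
    (hD (Γ.ter e) trivial).1 (hR (Γ.ini e) e rfl).1 (hD (Γ.ter e) trivial).2.1
    (hR (Γ.ini e) e rfl).2.1
    (by rw [(hD (Γ.ter e) trivial).2.2, (hR (Γ.ini e) e rfl).2.2, cls_edgeCyl])
  have hDd' : ∀ v w x, x ∈ D v → x ∈ D w → v = w := fun v w => hDd v trivial w trivial
  have hRD : ∀ e, R (Γ.ini e) e ⊆ D (Γ.ini e) := fun e => by
    conv_rhs => rw [← hRu (Γ.ini e)]
    exact subset_biUnion_of_mem (u := R (Γ.ini e)) (show e ∈ {e' : Γ.E | Γ.ini e' = Γ.ini e} from rfl)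
  obtain ⟨A, hA⟩ := exists_shiftAction_of_bisections hS hDd' (fun e => by rw [hSr]; exact hRD e)
    hSs (fun e e' x hx hx' => by
      rw [hSr] at hx hx'
      have h1 := hDd' _ _ x (hRD e hx) (hRD e' hx')
      rw [← h1] at hx'
      exact hRd (Γ.ini e) e rfl e' h1.symm x hx hx')
    (eq_univ_of_forall fun y => by
      obtain ⟨v, -, hv⟩ := mem_iUnion₂.mp (hDu.symm ▸ mem_univ y)
      rw [← hRu v] at hv
      obtain ⟨e, rfl, he⟩ := mem_iUnion₂.mp hv
      exact mem_iUnion.mpr ⟨e, by rwa [hSr]⟩)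
  refine ⟨A, A.path_surjective fun v => ?_, H0_hom_ext fun e => ?_⟩
  · obtain ⟨e, rfl⟩ := hΓ.exists_ini v
    obtain ⟨y, hy⟩ := (hR (Γ.ini e) e rfl).2.1
    exact ⟨y, by rw [(hA e y).mpr (by rwa [hSr])]⟩
  · rw [Corr.mapH0_cls _ (isClopen_edgeCyl e).isClosed.isCompact (isClopen_edgeCyl e).isOpen,
      ← (hR (Γ.ini e) e rfl).2.2, ← hSr]
    congr 1
    ext y
    exact hA e y

end EtaleGroupoid

/-! ### Local prefix replacement -/

section Bricks

theorem prependWord_ofFn_lt {N m : ℕ} (hm : m < N) (r : Fin N → Bool) (x : ℕ → Bool) :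
    prependWord (List.ofFn r) x m = r ⟨m, hm⟩ := by
  simp [prependWord, hm]

theorem prependWord_of_ge {w : List Bool} {m : ℕ} (hm : w.length ≤ m) (x : ℕ → Bool) :
    prependWord w x m = x (m - w.length) := dif_neg (not_lt.mpr hm)

theorem prependWord_congr_of_lt {w : List Bool} {m : ℕ} (hm : m < w.length) (x y : ℕ → Bool) :
    prependWord w x m = prependWord w y m := by
  simp [prependWord, hm]

theorem continuous_prependWord (w : List Bool) : Continuous (prependWord w) := by
  refine continuous_pi fun m => ?_
  by_cases hm : m < w.length
  · simpa [prependWord, hm] using continuous_const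
  · simpa [prependWord, hm] using continuous_apply _

variable {n : ℕ}

/-- The first `N` letters of all coordinates. -/
def res (N : ℕ) (x : Fin n → ℕ → Bool) : Fin n → Fin N → Bool := fun i j => x i j

/-- The words given by the letters `r`. -/
def words {N : ℕ} (r : Fin n → Fin N → Bool) : Fin n → List Bool := fun i => List.ofFn (r i)

theorem continuous_res (N : ℕ) : Continuous (res N : (Fin n → ℕ → Bool) → _) :=
  continuous_pi fun i => continuous_pi fun j => (continuous_apply (j : ℕ)).comp (continuous_apply i)

theorem brickMap_words_res (N : ℕ) (x : Fin n → ℕ → Bool) :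
    brickMap (words (res N x)) (fun i m => x i (m + N)) = x := by
  ext i m
  by_cases hm : m < N
  · exact prependWord_ofFn_lt hm _ _
  · have h : (words (res N x) i).length ≤ m := by simpa [words] using hm
    refine (prependWord_of_ge h _).trans ?_
    simp only [words, List.length_ofFn]
    congr 1
    omega

theorem res_brickMap_words {N : ℕ} (r : Fin n → Fin N → Bool) (x : Fin n → ℕ → Bool) :
    res N (brickMap (words r) x) = r := by
  ext i j
  exact prependWord_ofFn_lt j.2 _ _

theorem exists_words_append {u : Fin n → List Bool} {x : Fin n → ℕ → Bool}
    (hx : x ∈ range (brickMap u)) {M : ℕ} (hM : ∀ i, (u i).length ≤ M) :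
    ∃ a : Fin n → List Bool, words (res M x) = fun i => u i ++ a i := by
  obtain ⟨y, hy⟩ := hx
  have := fun i => exists_append_of_prependWord_eq
    (congrFun (hy.trans (brickMap_words_res M x).symm) i) (by simpa [words] using hM i)
  choose a ha using this
  exact ⟨a, funext ha⟩

theorem isBrickPartition_words (N : ℕ) :
    IsBrickPartition (words : (Fin n → Fin N → Bool) → Fin n → List Bool) := by
  refine fun x => ⟨res N x, ⟨_, brickMap_words_res N x⟩, ?_⟩
  rintro r ⟨y, rfl⟩
  exact (res_brickMap_words r y).symm

/-- A homeomorphism of the Cantor cube that is locally given by replacing prefixes belongs to the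
higher dimensional Thompson group. -/
theorem mem_brinThompson {f : (Fin n → ℕ → Bool) ≃ₜ (Fin n → ℕ → Bool)}
    (h : ∀ x, ∃ u v : Fin n → List Bool, x ∈ range (brickMap u) ∧
      ∀ t, f (brickMap u t) = brickMap v t) : f ∈ brinThompson n := by
  -- The points whose brick with all words of length `N` is mapped canonically. These open sets
  -- increase with `N`, so compactness yields one `N` for all points.
  let O : ℕ → Set (Fin n → ℕ → Bool) := fun N =>
    res N ⁻¹' {r | ∃ v, ∀ t, f (brickMap (words r) t) = brickMap v t}
  have hO : ∀ {u v : Fin n → List Bool} {x : Fin n → ℕ → Bool} {M : ℕ}, x ∈ range (brickMap u) →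
      (∀ t, f (brickMap u t) = brickMap v t) → (∀ i, (u i).length ≤ M) → x ∈ O M := by
    intro u v x M hx hf hM
    obtain ⟨a, ha⟩ := exists_words_append hx hM
    refine ⟨fun i => v i ++ a i, fun t => ?_⟩
    rw [ha, brickMap_append, hf, ← brickMap_append]
  obtain ⟨N, hN⟩ := isCompact_univ.elim_directed_cover O
    (fun N => (isOpen_discrete _).preimage (continuous_res N)) (fun x _ => by
      obtain ⟨u, v, hx, hf⟩ := h x
      -- The sum of the lengths is a crude common bound for all of them.
      exact mem_iUnion.mpr ⟨∑ i, (u i).length, hO hx hf fun i =>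
        Finset.single_le_sum (f := fun i => (u i).length) (fun _ _ => Nat.zero_le _)
          (Finset.mem_univ i)⟩)
    (directed_of_isDirected_le fun N M hNM x ⟨v, hv⟩ =>
      hO ⟨_, brickMap_words_res N x⟩ hv fun i => by simpa [words] using hNM)
  have hv : ∀ r : Fin n → Fin N → Bool, ∃ v, ∀ t, f (brickMap (words r) t) = brickMap v t := by
    intro r
    have := hN (mem_univ (brickMap (words r) fun _ _ => false))
    rwa [mem_preimage, res_brickMap_words] at this
  choose v hv using hv
  refine ⟨Fin n → Fin N → Bool, inferInstance, words, v, isBrickPartition_words N, fun x => ?_, hv⟩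
  have hiff : ∀ r, x ∈ range (brickMap (v r)) ↔ f.symm x ∈ range (brickMap (words r)) := by
    intro r
    constructor
    · rintro ⟨t, rfl⟩
      exact ⟨t, by rw [← hv, f.symm_apply_apply]⟩
    · rintro ⟨t, ht⟩
      exact ⟨t, by rw [← hv, ht, f.apply_symm_apply]⟩
  simp only [hiff]
  exact isBrickPartition_words N _

end Bricks

/-! ### Complete prefix codes -/

/-- The comb code `0, 10, 110, …`, ending with a word of ones only, does it. For a single index the
code word is empty. -/
theorem exists_prefixCode (ι : Type*) [Finite ι] [Nonempty ι] : ∃ c : ι → List Bool,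
    Function.Bijective fun q : ι × (ℕ → Bool) => prependWord (c q.1) q.2 := by
  have hcons : ∀ b (w : List Bool) (x : ℕ → Bool), prependWord (b :: w) x 0 = b ∧
      (fun m => prependWord (b :: w) x (m + 1)) = prependWord w x := by
    intro b w x
    refine ⟨rfl, funext fun m => ?_⟩
    simp [prependWord]
  have key : ∀ n : ℕ, ∃ c : Fin (n + 1) → List Bool,
      Function.Bijective fun q : Fin (n + 1) × (ℕ → Bool) => prependWord (c q.1) q.2 := by
    intro n
    induction n with
    | zero =>
      refine ⟨fun _ => [], ?_, fun x => ⟨(0, x), rfl⟩⟩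
      rintro ⟨i, x⟩ ⟨j, y⟩ h
      exact Prod.ext (Fin.ext (by omega)) h
    | succ n ih =>
      obtain ⟨c, hi, hs⟩ := ih
      refine ⟨Fin.cons [false] fun i => true :: c i, ?_, fun x => ?_⟩
      · rintro ⟨i, x⟩ ⟨j, y⟩ h
        dsimp only at h
        have h0 := congrFun h 0
        have h1 := congrArg (fun (z : ℕ → Bool) m => z (m + 1)) h
        induction i using Fin.cases with
        | zero =>
          induction j using Fin.cases with
          | zero =>
            simp only [Fin.cons_zero] at h
            rw [prependWord_injective _ h]
          | succ j =>
            simp only [Fin.cons_zero, Fin.cons_succ, (hcons _ _ _).1] at h0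
            exact absurd h0 (by simp)
        | succ i =>
          induction j using Fin.cases with
          | zero =>
            simp only [Fin.cons_zero, Fin.cons_succ, (hcons _ _ _).1] at h0
            exact absurd h0 (by simp)
          | succ j =>
            simp only [Fin.cons_succ, (hcons _ _ _).2] at h1
            have := hi (a₁ := (i, x)) (a₂ := (j, y)) h1
            simp only [Prod.mk.injEq] at this
            rw [this.1, this.2]
      · rcases hx : x 0 with _ | _
        · refine ⟨(0, fun m => x (m + 1)), funext fun m => ?_⟩
          cases m with
          | zero => exact ((hcons false [] _).1).trans hx.symm
          | succ m => exact congrFun (hcons false [] _).2 m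
        · obtain ⟨⟨i, y⟩, hy⟩ := hs fun m => x (m + 1)
          refine ⟨(i.succ, y), funext fun m => ?_⟩
          simp only [Fin.cons_succ]
          cases m with
          | zero => exact ((hcons true _ _).1).trans hx.symm
          | succ m => exact (congrFun (hcons true _ _).2 m).trans (congrFun hy m)
  obtain ⟨m, ⟨e⟩⟩ := Finite.exists_equiv_fin ι
  have hm : m ≠ 0 := by
    rintro rfl
    exact (e (Classical.arbitrary ι)).elim0
  obtain ⟨m, rfl⟩ := Nat.exists_eq_succ_of_ne_zero hm
  obtain ⟨c, hc⟩ := key m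
  exact ⟨c ∘ e, hc.comp (e.prodCongr (Equiv.refl _)).bijective⟩

/-! ### Binary codings of the shift space -/

namespace FiniteDigraph

open PathSpace

variable {Γ : FiniteDigraph}

instance : TopologicalSpace Γ.V := ⊥

instance : DiscreteTopology Γ.V := ⟨rfl⟩

/-- A system of complete prefix codes for the edges starting at the vertices of the graph gives
an itinerary on `Γ.V × {0,1}^ℕ`. -/
theorem exists_codeItinerary (h : Γ.IsIrreducible) :
    ∃ (c : Γ.E → List Bool) (I : Itinerary Γ (Γ.V × (ℕ → Bool))),
      (∀ e t, I.edge (Γ.ini e, prependWord (c e) t) = e ∧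
        I.T (Γ.ini e, prependWord (c e) t) = (Γ.ter e, t)) ∧
      (∀ y, Γ.ini (I.edge y) = y.1) ∧
      ∀ e e', e ≠ e' → Γ.ini e = Γ.ini e' → c e ≠ [] := by
  have hne : ∀ v, Nonempty {e // Γ.ini e = v} := fun v =>
    let ⟨e, he⟩ := h.exists_ini v
    ⟨⟨e, he⟩⟩
  choose d hd using fun v => exists_prefixCode {e // Γ.ini e = v}
  let c : Γ.E → List Bool := fun e => d (Γ.ini e) ⟨e, rfl⟩
  have hdc : ∀ v (e : {e // Γ.ini e = v}), d v e = c e := by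
    rintro _ ⟨e, rfl⟩
    rfl
  -- Completeness of the code at each vertex makes `B` a bijection. The itinerary reads off the edge
  -- by inverting `B`, deletes its code word and moves to the end of the edge.
  let B : Γ.E × (ℕ → Bool) → Γ.V × (ℕ → Bool) := fun q => (Γ.ini q.1, prependWord (c q.1) q.2)
  have hinj : Function.Injective B := by
    rintro ⟨e, t⟩ ⟨e', t'⟩ hB
    obtain ⟨h1, h2⟩ := Prod.ext_iff.mp hB
    have := (hd (Γ.ini e')).1 (a₁ := (⟨e, h1⟩, t)) (a₂ := (⟨e', rfl⟩, t')) (by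
      simp only [hdc]
      exact h2)
    simp only [Prod.mk.injEq, Subtype.mk.injEq] at this
    rw [this.1, this.2]
  have hsurj : Function.Surjective B := by
    rintro ⟨v, x⟩
    obtain ⟨⟨⟨e, rfl⟩, t⟩, ht⟩ := (hd v).2 x
    exact ⟨(e, t), Prod.ext rfl ht⟩
  have hcont : Continuous B := by
    rw [continuous_prod_of_discrete_left]
    exact fun e => (continuous_const (y := Γ.ini e)).prodMk (continuous_prependWord (c e))
  let b : Γ.E × (ℕ → Bool) ≃ₜ Γ.V × (ℕ → Bool) :=
    hcont.homeoOfEquivCompactToT2 (f := Equiv.ofBijective B ⟨hinj, hsurj⟩)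
  have hb : ∀ e t, b.symm (Γ.ini e, prependWord (c e) t) = (e, t) :=
    fun e t => b.symm_apply_apply (e, t)
  have hini : ∀ y, Γ.ini (b.symm y).1 = y.1 := fun y => congrArg Prod.fst (b.apply_symm_apply y)
  have hbc : Continuous fun y => (b.symm y).1 := continuous_fst.comp b.symm.continuous
  refine ⟨c, { edge := fun y => (b.symm y).1
               T := fun y => (Γ.ter (b.symm y).1, (b.symm y).2)
               continuous_edge := hbc
               continuous_T := (continuous_of_discreteTopology.comp hbc).prodMk
                 (continuous_snd.comp b.symm.continuous)
               ter_edge := fun y => (hini (Γ.ter (b.symm y).1, (b.symm y).2)).symm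
               exists_lift := fun e y he => ⟨(Γ.ini e, prependWord (c e) y.2), ?_, ?_⟩
               inj := ?_ }, fun e t => ⟨?_, ?_⟩, hini, ?_⟩
  · rw [hb]
  · rw [hb]
    exact Prod.ext (he.trans (hini y)) rfl
  · intro y y' h1 h2
    exact b.symm.injective (Prod.ext h1 (Prod.ext_iff.mp h2).2)
  · exact congrArg Prod.fst (hb e t)
  · change (Γ.ter (b.symm _).1, (b.symm _).2) = _
    rw [hb]
  -- An empty code word for `e` would let every sequence be read as starting with `e`, also those
  -- coded by `e'`.
  · intro e e' hee hi hc
    have h1 : B (e, prependWord (c e') fun _ => false) = B (e', fun _ => false) := by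
      simp only [B, hc, hi]
      rfl
    exact hee (Prod.ext_iff.mp (hinj h1)).1

theorem codeItinerary_eq {c : Γ.E → List Bool} {I : Itinerary Γ (Γ.V × (ℕ → Bool))}
    (hI : ∀ e t, I.edge (Γ.ini e, prependWord (c e) t) = e ∧
      I.T (Γ.ini e, prependWord (c e) t) = (Γ.ter e, t))
    (hini : ∀ y, Γ.ini (I.edge y) = y.1) (y : Γ.V × (ℕ → Bool)) :
    y.2 = prependWord (c (I.edge y)) (I.T y).2 := by
  have h1 := hI (I.edge y) (I.T y).2
  have : y = (Γ.ini (I.edge y), prependWord (c (I.edge y)) (I.T y).2) := by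
    refine I.inj h1.1.symm (Eq.symm (h1.2.trans (Prod.ext ?_ rfl)))
    rw [← hini (I.T y), ← I.ter_edge]
  exact congrArg Prod.snd this

/-- A binary sequence is the concatenation of the code words along its path. Some of these words may
be empty, but those at branching vertices are not, and the path meets such vertices infinitely
often; hence the path determines all letters. -/
theorem codeItinerary_path_injective (h : Γ.IsIrreducible) (hp : ¬ Γ.IsPermutation)
    {c : Γ.E → List Bool} {I : Itinerary Γ (Γ.V × (ℕ → Bool))}
    (hI : ∀ e t, I.edge (Γ.ini e, prependWord (c e) t) = e ∧
      I.T (Γ.ini e, prependWord (c e) t) = (Γ.ter e, t))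
    (hini : ∀ y, Γ.ini (I.edge y) = y.1)
    (hc : ∀ e e', e ≠ e' → Γ.ini e = Γ.ini e' → c e ≠ []) : Function.Injective I.path := by
  have hedge : ∀ {y y'}, I.path y = I.path y' → I.edge y = I.edge y' :=
    fun h => congrArg (fun x => x.1 0) h
  have hT : ∀ {y y'}, I.path y = I.path y' → I.path (I.T y) = I.path (I.T y') :=
    fun h => congrArg shift h
  have key : ∀ m y y', I.path y = I.path y' → ∀ i < m, y.2 i = y'.2 i := by
    intro m
    induction m with
    | zero => exact fun _ _ _ i hi => absurd hi (Nat.not_lt_zero i)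
    | succ m ih =>
      -- Inner induction on the waiting time until a nonempty code word. When it arrives, at least
      -- one letter is consumed and the outer induction hypothesis covers the rest.
      have inner : ∀ j y y', I.path y = I.path y' → c ((I.path y).1 j) ≠ [] →
          ∀ i < m + 1, y.2 i = y'.2 i := by
        intro j
        induction j with
        | zero =>
          intro y y' hy hne i hi
          rw [codeItinerary_eq hI hini y, codeItinerary_eq hI hini y', ← hedge hy]
          rcases lt_or_ge i (c (I.edge y)).length with hlt | hge
          · exact prependWord_congr_of_lt hlt _ _
          · rw [prependWord_of_ge hge, prependWord_of_ge hge]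
            have : 0 < (c (I.edge y)).length := List.length_pos_iff.mpr hne
            exact ih _ _ (hT hy) _ (by omega)
        | succ j ihj =>
          intro y y' hy hne i hi
          rw [codeItinerary_eq hI hini y, codeItinerary_eq hI hini y', ← hedge hy]
          rcases lt_or_ge i (c (I.edge y)).length with hlt | hge
          · exact prependWord_congr_of_lt hlt _ _
          · rw [prependWord_of_ge hge, prependWord_of_ge hge]
            exact ihj _ _ (hT hy) hne _ (by omega)
      intro y y' hy
      obtain ⟨j, -, e, he, hi⟩ := h.exists_branch_of_path hp (I.path y) 0
      exact inner j y y' hy (hc _ e he.symm hi.symm)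
  intro y y' hy
  refine Prod.ext ?_ (funext fun i => key (i + 1) y y' hy i (Nat.lt_succ_self i))
  rw [← hini, ← hini, hedge hy]

/-- A homeomorphism from the Cantor set onto the space of paths under which the cylinders
correspond to dyadic intervals, canonically. -/
theorem exists_coding (h : Γ.IsIrreducible) (hp : ¬ Γ.IsPermutation) :
    ∃ (q : (ℕ → Bool) ≃ₜ Γ.PathSpace) (ψ : Γ.V → (ℕ → Bool) → Γ.PathSpace),
      ∀ x m, ∃ w, (∃ t, q (prependWord w t) = x) ∧
        ∀ t, q (prependWord w t) ∈ cyl x m ∧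
          shift^[m] (q (prependWord w t)) = ψ (Γ.ini (x.1 m)) t := by
  obtain ⟨c, I, hI, hini, hc⟩ := exists_codeItinerary h
  have hinj := codeItinerary_path_injective h hp hI hini hc
  have hsurj : Function.Surjective I.path :=
    I.path_surjective fun v => ⟨(v, fun _ => false), hini _⟩
  obtain ⟨e₀, -⟩ := h.exists_branch hp
  have : Nonempty Γ.V := ⟨Γ.ini e₀⟩
  -- A second prefix code merges the copies of `{0,1}^ℕ`, one for each vertex, into a single one.
  obtain ⟨d, hd⟩ := exists_prefixCode Γ.V
  let P : Γ.V × (ℕ → Bool) ≃ₜ Γ.PathSpace := I.continuous_path.homeoOfEquivCompactToT2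
    (f := Equiv.ofBijective I.path ⟨hinj, hsurj⟩)
  have hdc : Continuous fun q : Γ.V × (ℕ → Bool) => prependWord (d q.1) q.2 := by
    rw [continuous_prod_of_discrete_left]
    exact fun v => continuous_prependWord (d v)
  let D : Γ.V × (ℕ → Bool) ≃ₜ (ℕ → Bool) := hdc.homeoOfEquivCompactToT2
    (f := Equiv.ofBijective _ hd)
  have hq : ∀ v t, (D.symm.trans P) (prependWord (d v) t) = I.path (v, t) := fun v t =>
    congrArg P (D.symm_apply_apply (v, t))
  -- The word `w` is the concatenation of the code words of the first `m` edges of `x`.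
  have hw : ∀ m (x : Γ.PathSpace), ∃ w, ∀ t, I.path (Γ.ini (x.1 0), prependWord w t) ∈ cyl x m ∧
      I.T^[m] (Γ.ini (x.1 0), prependWord w t) = (Γ.ini (x.1 m), t) := by
    intro m
    induction m with
    | zero => exact fun x => ⟨[], fun t => ⟨fun j hj => absurd hj (Nat.not_lt_zero j), rfl⟩⟩
    | succ m ih =>
      intro x
      obtain ⟨w, hw⟩ := ih (shift x)
      refine ⟨c (x.1 0) ++ w, fun t => ?_⟩
      obtain ⟨h1, h2⟩ := hw t
      obtain ⟨h3, h4⟩ := hI (x.1 0) (prependWord w t)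
      have h5 : I.T (Γ.ini (x.1 0), prependWord (c (x.1 0)) (prependWord w t)) =
          (Γ.ini ((shift x).1 0), prependWord w t) := h4.trans (Prod.ext (x.2 0) rfl)
      rw [prependWord_append]
      refine ⟨fun j hj => ?_, ?_⟩
      · cases j with
        | zero => exact h3
        | succ j =>
          have := h1 j (by omega)
          rw [← h5] at this
          exact this
      · rw [Function.iterate_succ_apply, h5, h2]
        rfl
  refine ⟨D.symm.trans P, fun v t => I.path (v, t), fun x m => ?_⟩
  obtain ⟨w, hw⟩ := hw m x
  refine ⟨d (Γ.ini (x.1 0)) ++ w, ?_, fun t => ?_⟩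
  · obtain ⟨y, rfl⟩ := hsurj x
    refine ⟨(I.T^[m] y).2, ?_⟩
    rw [prependWord_append, hq]
    obtain ⟨h1, h2⟩ := hw (I.T^[m] y).2
    congr 1
    refine I.eq_of_iterate h1 (h2.trans (Prod.ext ?_ rfl))
    exact hini _
  · rw [prependWord_append, hq]
    obtain ⟨h1, h2⟩ := hw t
    exact ⟨h1, by rw [← I.path_iterate, h2]⟩

end FiniteDigraph

/-! ### The embedding into the higher dimensional Thompson group -/

-- Conjugation by the product `Q` of the codings gives the embedding. Near a given point, an element
-- of the full group replaces in each coordinate an initial segment of the path by another one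
-- ending at the same vertex, and the codings turn both segments into binary words followed by the
-- same tail.
open FiniteDigraph PathSpace in
theorem exists_hom_brinThompson {n : ℕ} {Γ : Fin n → FiniteDigraph}
    (hirr : ∀ i, (Γ i).IsIrreducible) (hperm : ∀ i, ¬ (Γ i).IsPermutation) :
    ∃ ι : (sftProduct Γ).topologicalFullGroup →* brinThompson n, Function.Injective ι := by
  choose q ψ hq using fun i => exists_coding (hirr i) (hperm i)
  let Q : (Fin n → ℕ → Bool) ≃ₜ (sftProduct Γ).Obj := Homeomorph.piCongrRight q
  have hQ : ∀ x i, Q x i = q i (x i) := fun _ _ => rfl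
  have hmem : ∀ α : (sftProduct Γ).topologicalFullGroup,
      (Q.trans (α : (sftProduct Γ).Obj ≃ₜ (sftProduct Γ).Obj)).trans Q.symm ∈ brinThompson n := by
    rintro ⟨α, U, hU⟩
    refine mem_brinThompson fun s => ?_
    obtain ⟨g, hg, hgs⟩ : Q s ∈ (sftProduct Γ).src '' U := hU.src_image.symm ▸ mem_univ _
    obtain ⟨O, hO, hOU⟩ := isOpen_pi_iff'.mp U.isOpen g hg
    have hloc : ∀ i, ∃ u v : List Bool, (∃ t, q i (prependWord u t) = Q s i) ∧
        ∀ t, ∃ a : (Γ i).SFTArr, a ∈ O i ∧ a.1.1 = q i (prependWord v t) ∧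
          a.1.2.2 = q i (prependWord u t) := by
      intro i
      obtain ⟨_, ⟨A, B, k, l, hA, hB, rfl⟩, ⟨h1, h2, h3, h4⟩, hsub⟩ :=
        (SFTArr.isTopologicalBasis_basic (Γ := Γ i)).exists_subset_of_mem_open (hO i).2 (hO i).1
      have hy : (g i).1.2.2 = Q s i := congrFun hgs i
      obtain ⟨M, hM⟩ := exists_cyl_subset hA h1
      obtain ⟨N, hN⟩ := exists_cyl_subset hB h2
      -- Both segments extend by the same amount `M + N` beyond `l` and `k`: long enough to stay in
      -- `A` and `B`, and with common end vertex because the shifted paths agree.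
      obtain ⟨u, hux, hu⟩ := hq i (g i).1.2.2 (l + (M + N))
      obtain ⟨v, -, hv⟩ := hq i (g i).1.1 (k + (M + N))
      refine ⟨u, v, by rwa [hy] at hux, fun t => ?_⟩
      obtain ⟨hu1, hu2⟩ := hu t
      obtain ⟨hv1, hv2⟩ := hv t
      have hini : (g i).1.2.2.1 (l + (M + N)) = (g i).1.1.1 (k + (M + N)) := by
        have := congrArg (fun z => z.1 (M + N)) h4
        simp only [shift_iterate_apply] at this
        rw [add_comm l, add_comm k, this]
      have hs := shift_eq_of_cyl hv1 hu1 h4 (by rw [hu2, hv2, hini])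
      exact ⟨⟨(_, (k : ℤ) - l, _), k, l, rfl, hs⟩, hsub
        ⟨hM (mem_cyl_of_le hv1 (by omega)), hN (mem_cyl_of_le hu1 (by omega)), rfl, hs⟩, rfl, rfl⟩
    choose u v hus huv using hloc
    refine ⟨u, v, ?_, fun t => ?_⟩
    · choose t ht using hus
      exact ⟨t, Q.injective (funext ht)⟩
    · choose a ha har has using fun i => huv i (t i)
      have haU : (a : (sftProduct Γ).Arr) ∈ U := hOU fun i _ => ha i
      have h1 := hU.apply_src a haU
      have h2 : (sftProduct Γ).src a = Q (brickMap u t) := funext has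
      have h3 : (sftProduct Γ).rng a = Q (brickMap v t) := funext har
      rw [h2, h3] at h1
      change Q.symm (α (Q (brickMap u t))) = _
      rw [h1, Q.symm_apply_apply]
  refine ⟨MonoidHom.mk' (fun α => ⟨_, hmem α⟩) fun α β => Subtype.ext (Homeomorph.ext fun x => ?_),
    fun α β hαβ => Subtype.ext (Homeomorph.ext fun x => ?_)⟩
  · change Q.symm ((α : (sftProduct Γ).Obj ≃ₜ _) ((β : (sftProduct Γ).Obj ≃ₜ _) (Q x))) =
      Q.symm ((α : (sftProduct Γ).Obj ≃ₜ _) (Q (Q.symm ((β : (sftProduct Γ).Obj ≃ₜ _) (Q x)))))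
    rw [Q.apply_symm_apply]
  · obtain ⟨y, rfl⟩ := Q.surjective x
    exact Q.symm.injective (DFunLike.congr_fun (congrArg Subtype.val hαβ) y)

/-! ### The main theorem -/

namespace EtaleGroupoid

universe v

/-- The map on `H₀` induced by a product of correspondences is the tensor product of the maps
induced by the factors. -/
theorem mapH0_corr_pi {n : ℕ} {G : Fin n → EtaleGroupoid.{v}} {H : Fin n → EtaleGroupoid.{u}}
    [∀ i, CompactSpace (G i).Obj] [∀ i, TotallyDisconnectedSpace (G i).Obj]
    [∀ i, CompactSpace (H i).Obj] [∀ i, TotallyDisconnectedSpace (H i).Obj]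
    (T : ∀ i, Corr (G i) (H i)) (c : (pi G).H0) :
    (Corr.pi T).mapH0 c = kunneth H
      (PiTensorProduct.map (fun i => (T i).mapH0.toIntLinearMap) ((kunneth G).symm c)) := by
  obtain ⟨f, rfl⟩ := toH0_surjective c
  let L : (pi G).H0 →+ (pi H).H0 := ((kunneth H).toLinearMap ∘ₗ
    (PiTensorProduct.map fun i => (T i).mapH0.toIntLinearMap) ∘ₗ
      (kunneth G).symm.toLinearMap).toAddMonoidHom
  suffices h : (Corr.pi T).mapH0.comp (pi G).toH0Hom = L.comp (pi G).toH0Hom from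
    DFunLike.congr_fun h f
  refine AddMonoidHom.eq_of_eqOn_dense (closure_range_extProd G) ?_
  rintro _ ⟨f, rfl⟩
  change (pi H).toH0 ((Corr.pi T).pullback (extProd G f)) = kunneth H
    (PiTensorProduct.map (fun i => (T i).mapH0.toIntLinearMap)
      ((kunneth G).symm ((pi G).toH0 (extProd G f))))
  rw [kunneth_symm_toH0_extProd, PiTensorProduct.map_tprod]
  exact (kunneth_tprod H fun i => (T i).pullback (f i)).symm

end EtaleGroupoid

open EtaleGroupoid

theorem mainTheorem10 (n : ℕ) (hn : 1 ≤ n) (Γ : Fin n → FiniteDigraph)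
    (hirr : ∀ i, (Γ i).IsIrreducible) (hperm : ∀ i, ¬ (Γ i).IsPermutation) :
    (∀ (H : Fin n → EtaleGroupoid.{u}) [∀ i, IsCantorSet (H i).Obj],
      (∀ i, (H i).IsEssentiallyPrincipal) →
      (∀ i, (H i).IsMinimal) →
      (∀ i, (H i).IsPurelyInfinite) →
      ∀ φ : ∀ i, (Γ i).sftGroupoid.H0 →+ (H i).H0,
      (∀ i, φ i ((Γ i).sftGroupoid.toH0 (charFn ℤ ⊤)) = (H i).toH0 (charFn ℤ ⊤)) →
      -- the identifications of `H₀` of a product with the tensor product of the `H₀`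
      ∃ (κG : (⨂[ℤ] i, (Γ i).sftGroupoid.H0) ≃ₗ[ℤ] (sftProduct Γ).H0)
        (κH : (⨂[ℤ] i, (H i).H0) ≃ₗ[ℤ] (EtaleGroupoid.pi H).H0),
        (∀ f : ∀ i, C_c((Γ i).sftGroupoid.Obj, ℤ),
          κG (PiTensorProduct.tprod ℤ fun i => (Γ i).sftGroupoid.toH0 (f i)) =
            (sftProduct Γ).toH0 (EtaleGroupoid.extProd _ f)) ∧
        (∀ f : ∀ i, C_c((H i).Obj, ℤ),
          κH (PiTensorProduct.tprod ℤ fun i => (H i).toH0 (f i)) =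
            (EtaleGroupoid.pi H).toH0 (EtaleGroupoid.extProd H f)) ∧
        ∃ π : (sftProduct Γ).reducedCStar →⋆ₐ[ℂ] (EtaleGroupoid.pi H).reducedCStar,
          (∀ a ∈ (sftProduct Γ).diagonal, π a ∈ (EtaleGroupoid.pi H).diagonal) ∧
          (∀ U : TopologicalSpace.CompactOpens (sftProduct Γ).Arr, (sftProduct Γ).IsGSet U →
            ∃ V : TopologicalSpace.CompactOpens (EtaleGroupoid.pi H).Arr,
              (EtaleGroupoid.pi H).IsGSet V ∧
              π ((sftProduct Γ).ofCc (charFn ℂ U)) =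
                (EtaleGroupoid.pi H).ofCc (charFn ℂ V)) ∧
          (∀ C : TopologicalSpace.CompactOpens (sftProduct Γ).Obj,
            ∃ D : TopologicalSpace.CompactOpens (EtaleGroupoid.pi H).Obj,
              π ((sftProduct Γ).ofCc (charFn ℂ ((sftProduct Γ).unitSet C))) =
                (EtaleGroupoid.pi H).ofCc (charFn ℂ ((EtaleGroupoid.pi H).unitSet D)) ∧
              (EtaleGroupoid.pi H).toH0 (charFn ℤ D) =
                κH (PiTensorProduct.map (fun i => (φ i).toIntLinearMap)
                  (κG.symm ((sftProduct Γ).toH0 (charFn ℤ C))))) ∧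
          -- the embedding of topological full groups induced by `π`
          ∃ ι : (sftProduct Γ).topologicalFullGroup →* (EtaleGroupoid.pi H).topologicalFullGroup,
            Function.Injective ι ∧
            ∀ (α : (sftProduct Γ).topologicalFullGroup)
              (U : TopologicalSpace.CompactOpens (sftProduct Γ).Arr)
              (V : TopologicalSpace.CompactOpens (EtaleGroupoid.pi H).Arr),
              (sftProduct Γ).IsTheta U α → (EtaleGroupoid.pi H).IsGSet V →
              π ((sftProduct Γ).ofCc (charFn ℂ U)) = (EtaleGroupoid.pi H).ofCc (charFn ℂ V) →
              (EtaleGroupoid.pi H).IsTheta V (ι α : (EtaleGroupoid.pi H).Obj ≃ₜ _)) ∧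
    ∃ ι : (sftProduct Γ).topologicalFullGroup →* brinThompson n, Function.Injective ι := by
  refine ⟨?_, exists_hom_brinThompson hirr hperm⟩
  intro H _ hess hmin hpi φ hφ
  have hφ' : ∀ i, φ i (cls univ) = cls univ := by
    intro i
    have := hφ i
    rw [charFn_eq_chi, charFn_eq_chi] at this
    exact this
  choose A hA hAφ using fun i =>
    exists_shiftAction (hirr i) (hperm i) (hmin i) (hpi i) (φ i) (hφ' i)
  let T := Corr.pi fun i => (A i).corr
  let F := Folner.pi fun i => (Γ i).folner
  have hTp : Function.Surjective T.p := by
    intro x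
    choose y hy using fun i => hA i (x i)
    exact ⟨y, funext hy⟩
  have hG := sftProduct_isEssentiallyPrincipal hirr hperm
  obtain ⟨π, hπ⟩ := T.exists_starAlgHom F
  have hπU : ∀ {U : Set (sftProduct Γ).Arr} (hU : IsBisection U),
      π ((sftProduct Γ).ofCc (charFn ℂ hU.toCompactOpens)) =
        (EtaleGroupoid.pi H).ofCc (charFn ℂ (T.isBisection_image hU).toCompactOpens) :=
    fun hU => hπ _ _ _ (T.isTransfer_charFn hU)
  obtain ⟨ι, hι, hιθ⟩ := T.exists_fullGroupHom hG
  refine ⟨kunneth _, kunneth H, kunneth_tprod _, kunneth_tprod H, π, ?_, ?_, ?_, ι, hι hTp, ?_⟩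
  -- Such an `f` is supported in the unit bisection, and lifts of units are units, so its transfer
  -- is again supported on units.
  · rintro _ ⟨f, hf, rfl⟩
    have hU : IsBisection ((sftProduct Γ).unit '' univ) :=
      IsBisection.image_unit isCompact_univ isOpen_univ
    have hf0 : ∀ g, g ∉ (sftProduct Γ).unit '' univ → f g = 0 := fun g hg =>
      hf g (by rwa [image_univ] at hg)
    obtain ⟨f', hf'⟩ := T.exists_transfer hU hf0
    refine ⟨f', fun h hh => hf'.apply_eq_zero h fun g hg hr => ?_, (hπ _ _ _ hf').symm⟩
    obtain ⟨x, -, rfl⟩ := hg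
    exact hh ⟨_, (T.eq_unit hr).1.symm⟩
  · intro U hU
    have hU' := IsBisection.of_compactOpens U hU
    exact ⟨_, (T.isBisection_image hU').isGSet, hπU hU'⟩
  · intro C
    have hC : IsClopen (T.p ⁻¹' (C : Set (sftProduct Γ).Obj)) :=
      IsClopen.preimage ⟨C.isCompact.isClosed, C.isOpen⟩ T.continuous_p
    refine ⟨⟨⟨_, hC.isClosed.isCompact⟩, hC.isOpen⟩, ?_, ?_⟩
    · have h1 := hπU (IsBisection.image_unit C.isCompact C.isOpen)
      refine h1.trans (congrArg (fun V => (EtaleGroupoid.pi H).ofCc (charFn ℂ V)) ?_)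
      exact TopologicalSpace.CompactOpens.ext (T.image_unit _)
    · rw [charFn_eq_chi, charFn_eq_chi]
      have h1 := mapH0_corr_pi (fun i => (A i).corr) ((sftProduct Γ).toH0 (chi C))
      simp only [hAφ] at h1
      rw [← h1]
      exact (T.mapH0_cls C.isCompact C.isOpen).symm
  · intro α U V hU hV hUV
    -- Since `ofCc` is injective, `V` can only be the image of `U` under the correspondence.
    have h1 := hUV.symm.trans (hπU hU.isBisection)
    have h2 := ofCc_injective h1
    have h3 : V = (T.isBisection_image hU.isBisection).toCompactOpens := by
      ext g
      have := DFunLike.congr_fun h2 g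
      by_contra hne
      change ((V : Set (EtaleGroupoid.pi H).Arr).indicator 1 g : ℂ) =
        (T.image (U : Set (sftProduct Γ).Arr)).indicator 1 g at this
      by_cases hg : g ∈ (V : Set (EtaleGroupoid.pi H).Arr)
      · rw [indicator_of_mem hg] at this
        have hg' : g ∈ T.image (U : Set (sftProduct Γ).Arr) := by
          by_contra hg'
          rw [indicator_of_notMem hg'] at this
          exact one_ne_zero this
        exact hne ⟨fun _ => hg', fun _ => hg⟩
      · rw [indicator_of_notMem hg] at this
        have hg' : g ∉ T.image (U : Set (sftProduct Γ).Arr) := by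
          intro hg'
          rw [indicator_of_mem hg'] at this
          exact one_ne_zero this.symm
        exact hne ⟨fun h => absurd h hg, fun h => absurd h hg'⟩
    rw [h3]
    exact hιθ α U hU
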